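/- Let $p\ge 3$, $n\ge 1$, and let $X\sim N_p(\theta,\sigma^2I_p)$ and $S\sim\sigma^2\chi^2_n$ be independent, with $\theta\in\mathbb R^p$ and $\sigma^2>0$ unknown. Put $W=\|X\|^2/S$ and, for $\phi:(0,\infty)\to\mathbb R$, $\delta_\phi=(1-\phi(W)/W)X$. Let $M(\delta_\phi)=\mathrm E[(\delta_\phi-\theta)(\delta_\phi-\theta)']$ and $M^*(\delta_\phi)=\sigma^2I_p-M(\delta_\phi)$ (both depend on $\theta,\sigma^2$). For $w>0$ let $$g_i(w)=w^{n/2}\int_w^\infty t^{-n/2}\,\frac{h_i(t)}{t}\,dt\ (i=1,2),\quad h_1(t)=\frac{\phi(t)}{t},\quad h_2(t)=2\Big(\frac{\phi(t)}{t}-\phi'(t)\Big),\quad g_3(w)=g_2(w)+\frac{\phi(w)^2}{w},$$ $$b(w)=\frac{4\phi(w)}{w}+\frac{(n+2)\phi(w)^2}{w}-4\phi'(w)-4\phi(w)\phi'(w).$$ With independent $u_j\sim\chi^2_{p+2j}$ and $v\sim\chi^2_n$ let $$\beta^{(2)}_{p,n}=\sup_{j\ge0}\mathrm E\Big[\frac{2\phi(u_j/v)}{u_j/v}-\frac{b(u_j/v)}{p+2j}\Big].$$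 Let $P=XX'/\|X\|^2$, and for functions $\xi,\eta$ on $(0,\infty)$ let $$\hat M^*(\xi,\eta;\delta_\phi)=S\{g_1(W)\xi(W)(I_p-P)-(g_3(W)-g_1(W)\eta(W))P\},\qquad \hat M_0^*(\delta_\phi)=\hat M^*(1,1;\delta_\phi)=S\{g_1(W)I_p-g_3(W)P\}.$$ Assume that $\phi$ is continuous on $(0,\infty)$ and differentiable there outside a countable set, that for every $j\ge 0$ the quantities $\phi(w)/w$, $\phi(w)^2/w$, $\phi'(w)$ and $\phi(w)\phi'(w)$ are integrable under the law of $w=u_j/v$ (so that the expectations above exist; this holds for instance if $\phi$ and $\phi'$ are bounded), and that $\delta_\phi$ improves on $X$, that is $\mathrm E\|\delta_\phi-\theta\|^2\le \mathrm E\|X-\theta\|^2$ for all $\theta$ and $\sigma^2$. **Theorem.** Suppose that (i) $g_1$ is nonincreasing and $g_3/g_1$ is nondecreasing on $(0,\infty)$; (ii) $\xi$ and $\eta$ are nondecreasing on $(0,\infty)$, with $\lim_{w\to\infty}\xi(w)=\lim_{w\to\infty}\eta(w)=1$; (iii) $\xi(w)\ge\xi_2(w)$ and $\eta(w)\ge\eta_2(w)$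 for all $w>0$, where $$\xi_2(w)=\min\Big(1,\ \frac{1}{g_1(w)}\cdot\frac{\beta^{(2)}_{p,n}}{n+2}\Big),\qquad \eta_2(w)=\min\Big(1,\ \frac1{g_1(w)}\Big(g_3(w)+\frac{\beta^{(2)}_{p,n}}{n+2}\Big)\Big).$$ Then $\hat M^*_0(\delta_\phi)$ is a uniformly minimum variance unbiased estimator (entry by entry) of $M^*(\delta_\phi)$, and $\hat M^*(\xi,\eta;\delta_\phi)$ improves on it under the loss $L(\hat M^*;M^*)=\mathrm{tr}(\hat M^*-M^*)^2$: for all $\theta\in\mathbb R^p$ and $\sigma^2>0$, $$\mathrm E\,\mathrm{tr}\big(\hat M^*(\xi,\eta;\delta_\phi)-M^*(\delta_\phi)\big)^2\ \le\ \mathrm E\,\mathrm{tr}\big(\hat M^*_0(\delta_\phi)-M^*(\delta_\phi)\big)^2,$$ where the risks take values in $[0,\infty]$. -/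

import Mathlib

open MeasureTheory ProbabilityTheory Filter Topology Set
open scoped ENNReal NNReal Matrix

namespace Shrinkage

noncomputable section

/-! ### The sampling model -/

/-- The chi-square law with `k` degrees of freedom (Gamma with shape `k / 2` and rate `1 / 2`). -/
def chiSq (k : ℕ) : Measure ℝ := gammaMeasure ((k : ℝ) / 2) (1 / 2)

/-- The law of the data `(X, S)`: `X ∼ N_p(θ, v I_p)` and `S ∼ v χ²_n` are independent,
where `v` stands for the variance `σ²`. -/
def sampleLaw (p n : ℕ) (θ : Fin p → ℝ) (v : ℝ≥0) : Measure ((Fin p → ℝ) × ℝ) :=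
  (Measure.pi fun i => gaussianReal (θ i) v).prod ((chiSq n).map fun y => (v : ℝ) * y)

/-- The law of `u / w` for independent `u ∼ χ²_{p + 2j}` and `w ∼ χ²_n`. -/
def ratioLaw (p n j : ℕ) : Measure ℝ :=
  ((chiSq (p + 2 * j)).prod (chiSq n)).map fun z => z.1 / z.2

/-- The statistic `W = ‖X‖² / S`. -/
def statW {p : ℕ} (z : (Fin p → ℝ) × ℝ) : ℝ := (z.1 ⬝ᵥ z.1) / z.2

/-- The shrinkage estimator `δ_φ = (1 - φ(W) / W) X`. -/
def delta {p : ℕ} (φ : ℝ → ℝ) (z : (Fin p → ℝ) × ℝ) : Fin p → ℝ :=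
  (1 - φ (statW z) / statW z) • z.1

/-- The squared error risk `E ‖d - θ‖²` of an estimator `d` of `θ` (possibly infinite). -/
def meanRisk {p : ℕ} (n : ℕ) (d : (Fin p → ℝ) × ℝ → Fin p → ℝ)
    (θ : Fin p → ℝ) (v : ℝ≥0) : ℝ≥0∞ :=
  ∫⁻ z, ENNReal.ofReal ((d z - θ) ⬝ᵥ (d z - θ)) ∂(sampleLaw p n θ v)

/-- The MSE matrix `M(δ_φ) = E[(δ_φ - θ)(δ_φ - θ)']`. -/
def mseMatrix {p : ℕ} (n : ℕ) (φ : ℝ → ℝ) (θ : Fin p → ℝ) (v : ℝ≥0) :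
    Matrix (Fin p) (Fin p) ℝ :=
  Matrix.of fun i k =>
    ∫ z, (delta φ z - θ) i * (delta φ z - θ) k ∂(sampleLaw p n θ v)

/-- The risk reduction matrix `M*(δ_φ) = σ² I_p - M(δ_φ)`. -/
def redMatrix {p : ℕ} (n : ℕ) (φ : ℝ → ℝ) (θ : Fin p → ℝ) (v : ℝ≥0) :
    Matrix (Fin p) (Fin p) ℝ :=
  (v : ℝ) • (1 : Matrix (Fin p) (Fin p) ℝ) - mseMatrix n φ θ v

/-! ### The functions entering the estimators -/

/-- `w ^ (n/2) * ∫_w^∞ t ^ (-n/2) * h t / t dt`. -/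
def tailTransform (n : ℕ) (h : ℝ → ℝ) (w : ℝ) : ℝ :=
  w ^ ((n : ℝ) / 2) * ∫ t in Ioi w, t ^ (-((n : ℝ) / 2)) * (h t / t)

/-- `g₁`, built from `h₁(w) = φ(w) / w`. -/
def g₁ (n : ℕ) (φ : ℝ → ℝ) (w : ℝ) : ℝ :=
  tailTransform n (fun t => φ t / t) w

/-- `g₂`, built from `h₂(w) = 2 (φ(w) / w - φ'(w))`. -/
def g₂ (n : ℕ) (φ : ℝ → ℝ) (w : ℝ) : ℝ :=
  tailTransform n (fun t => 2 * (φ t / t - deriv φ t)) w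

/-- `g₃(w) = g₂(w) + φ(w)² / w`. -/
def g₃ (n : ℕ) (φ : ℝ → ℝ) (w : ℝ) : ℝ := g₂ n φ w + φ w ^ 2 / w

/-- `b(w) = 4 φ(w)/w + (n+2) φ(w)²/w - 4 φ'(w) - 4 φ(w) φ'(w)`. -/
def bFun (n : ℕ) (φ : ℝ → ℝ) (w : ℝ) : ℝ :=
  4 * φ w / w + ((n : ℝ) + 2) * φ w ^ 2 / w - 4 * deriv φ w - 4 * φ w * deriv φ w

/-- `β⁽²⁾_{p,n}(j; δ_φ)`. -/
def beta₂At (p n : ℕ) (φ : ℝ → ℝ) (j : ℕ) : ℝ :=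
  ∫ w, (2 * φ w / w - bFun n φ w / ((p : ℝ) + 2 * j)) ∂(ratioLaw p n j)

/-- `β⁽²⁾_{p,n}(δ_φ) = sup_{j ≥ 0} β⁽²⁾_{p,n}(j; δ_φ)`. -/
def beta₂ (p n : ℕ) (φ : ℝ → ℝ) : ℝ := ⨆ j : ℕ, beta₂At p n φ j

/-- `ξ₂(w) = min(1, β⁽²⁾ / ((n+2) g₁(w)))`. -/
def xi₂ (p n : ℕ) (φ : ℝ → ℝ) (w : ℝ) : ℝ :=
  min 1 (1 / g₁ n φ w * (beta₂ p n φ / ((n : ℝ) + 2)))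

/-- `η₂(w) = min(1, (g₃(w) + β⁽²⁾ / (n+2)) / g₁(w))`. -/
def eta₂ (p n : ℕ) (φ : ℝ → ℝ) (w : ℝ) : ℝ :=
  min 1 (1 / g₁ n φ w * (g₃ n φ w + beta₂ p n φ / ((n : ℝ) + 2)))

/-! ### Matrix estimators -/

/-- The projection `x x' / ‖x‖²`. -/
def proj {p : ℕ} (x : Fin p → ℝ) : Matrix (Fin p) (Fin p) ℝ :=
  (x ⬝ᵥ x)⁻¹ • Matrix.vecMulVec x x

/-- If `Γ x = (‖x‖, 0, …, 0)'` with `Γ` orthogonal and `x ≠ 0`, then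
`Γ' diag(l₀, l₁, …, l₁) Γ = l₁ (I - x x' / ‖x‖²) + l₀ x x' / ‖x‖²`; the matrix estimators below
are written in the second form, which does not involve the choice of `Γ`. -/
theorem rotate_diag {p : ℕ} (i : Fin p) (x : Fin p → ℝ) (hx : x ≠ 0)
    (Γ : Matrix (Fin p) (Fin p) ℝ) (hΓ : Γᵀ * Γ = 1)
    (hΓx : Γ *ᵥ x = Pi.single i (Real.sqrt (x ⬝ᵥ x))) (l₀ l₁ : ℝ) :
    Γᵀ * (l₁ • (1 - Matrix.single i i (1 : ℝ)) + l₀ • Matrix.single i i (1 : ℝ)) * Γ =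
      l₁ • (1 - proj x) + l₀ • proj x := by
  have h0 : 0 < x ⬝ᵥ x := by
    refine lt_of_le_of_ne ?_ ?_
    · exact Finset.sum_nonneg fun j _ => mul_self_nonneg _
    · intro h
      exact hx (dotProduct_self_eq_zero.mp h.symm)
  have hx' : x = Real.sqrt (x ⬝ᵥ x) • Γ i := by
    have : Γᵀ *ᵥ (Γ *ᵥ x) = x := by rw [Matrix.mulVec_mulVec, hΓ, Matrix.one_mulVec]
    rw [hΓx] at this
    ext k
    have hk := congrFun this k
    simp [Matrix.mulVec_single] at hk
    simp [← hk, mul_comm]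
  have hP : Γᵀ * Matrix.single i i (1 : ℝ) * Γ = proj x := by
    have e1 : Γᵀ * Matrix.single i i (1 : ℝ) * Γ = Matrix.vecMulVec (Γ i) (Γ i) := by
      ext a c
      simp [Matrix.mul_apply, Matrix.single_apply, Matrix.vecMulVec_apply, ite_and]
    have e2 : Matrix.vecMulVec x x = (x ⬝ᵥ x) • Matrix.vecMulVec (Γ i) (Γ i) := by
      ext a c
      have ha := congrFun hx' a
      have hc := congrFun hx' c
      simp only [Pi.smul_apply, smul_eq_mul] at ha hc
      simp only [Matrix.vecMulVec_apply, Matrix.smul_apply, smul_eq_mul]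
      rw [ha, hc]
      conv_rhs => rw [← Real.mul_self_sqrt h0.le]
      ring
    rw [e1, proj, e2, smul_smul, inv_mul_cancel₀ h0.ne', one_smul]
  rw [Matrix.mul_add, Matrix.add_mul, Matrix.mul_smul, Matrix.smul_mul, Matrix.mul_smul,
    Matrix.smul_mul, hP, Matrix.mul_sub, Matrix.sub_mul, hP, Matrix.mul_one, hΓ]

/-- The matrix `M̂₀(δ_φ) = (S/n) I - S g₁(W) I + S g₂(W) XX'/‖X‖² + S (φ(W)²/W) XX'/‖X‖²`. -/
def mseHat₀ {p : ℕ} (n : ℕ) (φ : ℝ → ℝ) (z : (Fin p → ℝ) × ℝ) : Matrix (Fin p) (Fin p) ℝ :=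
  (z.2 / n) • (1 : Matrix (Fin p) (Fin p) ℝ)
    - (z.2 * g₁ n φ (statW z)) • (1 : Matrix (Fin p) (Fin p) ℝ)
    + (z.2 * g₂ n φ (statW z)) • proj z.1
    + (z.2 * (φ (statW z) ^ 2 / statW z)) • proj z.1

/-- `M̂*₀(δ_φ) = (S/n) I - M̂₀(δ_φ)`. -/
def redHat₀ {p : ℕ} (n : ℕ) (φ : ℝ → ℝ) (z : (Fin p → ℝ) × ℝ) : Matrix (Fin p) (Fin p) ℝ :=
  (z.2 / n) • (1 : Matrix (Fin p) (Fin p) ℝ) - mseHat₀ n φ z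

/-- `M̂(ξ, η; δ_φ) = S Γ' {I/n - g₁ ξ (I - E₁₁) + (g₃ - g₁ η) E₁₁} Γ`. -/
def mseHat {p : ℕ} (n : ℕ) (φ ξ η : ℝ → ℝ) (z : (Fin p → ℝ) × ℝ) : Matrix (Fin p) (Fin p) ℝ :=
  z.2 • ((1 / (n : ℝ)) • (1 : Matrix (Fin p) (Fin p) ℝ)
    - (g₁ n φ (statW z) * ξ (statW z)) • (1 - proj z.1)
    + (g₃ n φ (statW z) - g₁ n φ (statW z) * η (statW z)) • proj z.1)

/-- `M̂*(ξ, η; δ_φ) = (S/n) I - M̂(ξ, η; δ_φ)`. -/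
def redHat {p : ℕ} (n : ℕ) (φ ξ η : ℝ → ℝ) (z : (Fin p → ℝ) × ℝ) : Matrix (Fin p) (Fin p) ℝ :=
  (z.2 / n) • (1 : Matrix (Fin p) (Fin p) ℝ) - mseHat n φ ξ η z

/-! ### Criteria for estimators of a matrix-valued parametric function -/

/-- `T` is an unbiased estimator of `τ(θ, σ²)`. -/
def IsUnbiased {p : ℕ} (n : ℕ) (T : (Fin p → ℝ) × ℝ → Matrix (Fin p) (Fin p) ℝ)
    (τ : (Fin p → ℝ) → ℝ≥0 → Matrix (Fin p) (Fin p) ℝ) : Prop :=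
  ∀ (θ : Fin p → ℝ) (v : ℝ≥0), 0 < v → ∀ i k,
    Integrable (fun z => T z i k) (sampleLaw p n θ v) ∧
      ∫ z, T z i k ∂(sampleLaw p n θ v) = τ θ v i k

/-- `T` is a uniformly minimum variance unbiased estimator of `τ(θ, σ²)`, entry by entry
(variances are taken in `[0, ∞]`). -/
def IsUMVUE {p : ℕ} (n : ℕ) (T : (Fin p → ℝ) × ℝ → Matrix (Fin p) (Fin p) ℝ)
    (τ : (Fin p → ℝ) → ℝ≥0 → Matrix (Fin p) (Fin p) ℝ) : Prop :=
  IsUnbiased n T τ ∧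
    ∀ T' : (Fin p → ℝ) × ℝ → Matrix (Fin p) (Fin p) ℝ, IsUnbiased n T' τ →
      ∀ (θ : Fin p → ℝ) (v : ℝ≥0), 0 < v → ∀ i k,
        evariance (fun z => T z i k) (sampleLaw p n θ v) ≤
          evariance (fun z => T' z i k) (sampleLaw p n θ v)

/-- The risk of `T` as an estimator of `τ(θ, σ²)` under the loss `tr (T - τ)²`
(possibly infinite). -/
def matrixRisk {p : ℕ} (n : ℕ) (T : (Fin p → ℝ) × ℝ → Matrix (Fin p) (Fin p) ℝ)
    (τ : (Fin p → ℝ) → ℝ≥0 → Matrix (Fin p) (Fin p) ℝ) (θ : Fin p → ℝ) (v : ℝ≥0) : ℝ≥0∞ :=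
  ∫⁻ z, ENNReal.ofReal (((T z - τ θ v) * (T z - τ θ v)).trace) ∂(sampleLaw p n θ v)

end

end Shrinkage

namespace Shrinkage

noncomputable section

set_option linter.unusedSectionVars false

/-! Optimality. The laws of `(X, S)` form an exponential family with statistic `(X, ‖X‖² + S)`, and
exponential tilting does not leave the family. A function whose mean vanishes under every law
therefore has a vanishing Laplace transform near `0` and is zero almost everywhere
(`ae_eq_zero_of_forall_integral_eq_zero`). Unbiased estimators are thus unique up to null sets, and
only unbiasedness remains to be shown. Put `h(w) = φ(w) / w`. Integration by parts gives `g₂ = 2h -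
n g₁` (`g₂_eq`), so the estimator depends on `h` alone. Moments of `X` against a function of `(‖X‖²,
S)` are moments of Poisson mixtures of chi-square laws with two or four more degrees of freedom
(`map_noncentral_withDensity_sq`). For a central pair the tail transform satisfies `n E_{k,n+2}[g₁]
= 2 E_{k,n}[h]` (`integral_tailTransform`); with the recurrence `integral_chiRatio_add` this yields
the Stein identity `integral_stein_mixLaw`, hence unbiasedness (`integral_unbiasedRed_eq`).

Shape of the target. The same moments give `M* = v a I - d θθ'`, where `a` is a Poisson average of
the numbers `beta₂At p n φ j` and `d` is an expectation of a positive multiple of `g₃`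
(`exists_redMatrix_eq`). Since `g₁' = -g₂ / (2w)` and `g₁` is nonincreasing, `g₂` and `g₃` are
nonnegative; hence `d ≥ 0`, and `a ≤ beta₂`. Improvement on `X` says that `M*` has nonnegative
trace, which forces `a ≥ 0`. It also forces `g₁ ≥ 0`: the Poisson averages of `E[S g₁]` are at least
`a`, and a nonincreasing function that is negative somewhere would make them negative for large
noncentrality (`g₁_nonneg`).

Risk. For an estimator `α (I - P) + γ P` the part of the loss that involves `d` is nondecreasing in
`α` and `γ`, so lowering them can only help there. What is left is a pair of scalar problems with
target `v a ≤ v β`, where `β = beta₂`. By condition (iii), wherever a coefficient is strictly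
lowered, the change in squared error is at most `2 β S (v - S/(n+2)) ψ(W)` with `ψ = g₁ (1 - ξ)` or
`g₁ (1 - η)` (`shrink_coefficient_le`). The factor `S (v - S/(n+2))` has mean zero and changes sign
once, from plus to minus, while `ψ(W)` increases with `S` for fixed `X`. Its expectation against
`ψ(W)` is therefore nonpositive (`integral_mul_antitone_statW_nonpos`). -/

/-! ### Exponential tilting and completeness of the model. -/

/-- Finite measures on `ℝ` whose moment generating functions are finite and agree near `0`
are equal. -/
theorem measure_eq_of_mgf_eq {μ ν : Measure ℝ} [IsFiniteMeasure μ] [IsFiniteMeasure ν] {δ : ℝ}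
    (hδ : 0 < δ) (hμ : ∀ t, |t| < δ → Integrable (fun x => Real.exp (t * x)) μ)
    (hν : ∀ t, |t| < δ → Integrable (fun x => Real.exp (t * x)) ν)
    (h : ∀ t, |t| < δ → ∫ x, Real.exp (t * x) ∂μ = ∫ x, Real.exp (t * x) ∂ν) : μ = ν := by
  have sub : ∀ {ρ : Measure ℝ}, (∀ t, |t| < δ → Integrable (fun x => Real.exp (t * x)) ρ) →
      Ioo (-δ) δ ⊆ interior (integrableExpSet id ρ) := fun hρ =>
    interior_maximal (fun t ht => hρ t (abs_lt.mpr ht)) isOpen_Ioo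
  set U : Set ℂ := {z | z.re ∈ Ioo (-δ) δ} with hU
  have hX : AnalyticOnNhd ℂ (complexMGF id μ) U :=
    analyticOnNhd_complexMGF.mono fun z hz => sub hμ hz
  have hY : AnalyticOnNhd ℂ (complexMGF id ν) U :=
    analyticOnNhd_complexMGF.mono fun z hz => sub hν hz
  -- The identity theorem on a connected vertical strip: the two transforms agree at real points
  -- accumulating at `0`. The strip contains the imaginary axis, where they are the characteristic
  -- functions.
  have key : EqOn (complexMGF id μ) (complexMGF id ν) U := by
    refine AnalyticOnNhd.eqOn_of_preconnected_of_frequently_eq hX hY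
      ((convex_Ioo _ _).linear_preimage Complex.reLm).isPreconnected (z₀ := ((0 : ℝ) : ℂ))
      (by simp [hU, hδ]) ?_
    have h_real : ∃ᶠ (x : ℝ) in 𝓝[≠] 0, complexMGF id μ x = complexMGF id ν x := by
      refine Eventually.frequently ?_
      filter_upwards [nhdsWithin_le_nhds (Ioo_mem_nhds (neg_lt_zero.mpr hδ) hδ)] with x hx
      rw [complexMGF_ofReal, complexMGF_ofReal]
      exact congrArg _ (h x (abs_lt.mpr hx))
    rw [frequently_iff_seq_forall] at h_real ⊢
    obtain ⟨xs, hx_tendsto, hx_eq⟩ := h_real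
    refine ⟨fun n ↦ xs n, ?_, fun n ↦ ?_⟩
    · rw [tendsto_nhdsWithin_iff] at hx_tendsto ⊢
      refine ⟨?_, by simpa using hx_tendsto.2⟩
      have := (Complex.continuous_ofReal.tendsto (0 : ℝ)).comp hx_tendsto.1
      exact this
    · simp [hx_eq]
  refine Measure.ext_of_charFun (funext fun t => ?_)
  rw [← complexMGF_id_mul_I, ← complexMGF_id_mul_I]
  exact key (by simp [hU, hδ])

/-- Reweighting the factors of a finite product of probability measures. -/
theorem pi_withDensity {ι : Type*} [Fintype ι] {μ : ι → Measure ℝ} [∀ i, IsProbabilityMeasure (μ i)]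
    {f : ι → ℝ → ℝ≥0∞} (hf : ∀ i, Measurable (f i))
    [∀ i, SigmaFinite ((μ i).withDensity (f i))] :
    (Measure.pi μ).withDensity (fun x => ∏ i, f i (x i)) =
      Measure.pi fun i => (μ i).withDensity (f i) := by
  symm
  refine Measure.pi_eq fun s hs => ?_
  rw [withDensity_apply _ (MeasurableSet.univ_pi hs), ← lintegral_indicator (MeasurableSet.univ_pi hs)]
  have e : (fun x : ι → ℝ => (pi univ s).indicator (fun x => ∏ i, f i (x i)) x) =
      fun x => ∏ i, (s i).indicator (f i) (x i) := by
    funext x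
    by_cases hx : x ∈ pi univ s
    · rw [indicator_of_mem hx]
      exact Finset.prod_congr rfl fun i _ => by rw [indicator_of_mem (hx i (mem_univ i))]
    · rw [indicator_of_notMem hx]
      simp only [Set.mem_pi, mem_univ, forall_true_left, not_forall] at hx
      obtain ⟨i, hi⟩ := hx
      exact (Finset.prod_eq_zero (Finset.mem_univ i) (indicator_of_notMem hi _)).symm
  rw [e]
  have hind : iIndepFun (fun i (x : ι → ℝ) => (s i).indicator (f i) (x i)) (Measure.pi μ) :=
    iIndepFun_pi (X := fun i => (s i).indicator (f i))
      fun i => ((hf i).indicator (hs i)).aemeasurable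
  rw [lintegral_prod_eq_prod_lintegral_of_indepFun Finset.univ _ hind
    fun i => ((hf i).indicator (hs i)).comp (measurable_pi_apply i)]
  refine Finset.prod_congr rfl fun i _ => ?_
  rw [withDensity_apply _ (hs i), ← lintegral_indicator (hs i)]
  have : (fun x : ι → ℝ => (s i).indicator (f i) (x i)) = (fun x => (s i).indicator (f i) x) ∘ Function.eval i := rfl
  have hmp := measurePreserving_eval (μ := μ) i
  exact hmp.lintegral_comp ((hf i).indicator (hs i))

/-- Exponential tilting of a Gaussian by a quadratic function. -/
theorem gaussianReal_withDensity_exp (μ : ℝ) {v v' : ℝ≥0} (hv : v ≠ 0) (hv' : v' ≠ 0) (a c : ℝ)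
    (hvv : (v' : ℝ) * (1 - 2 * c * v) = v) :
    (gaussianReal μ v).withDensity (fun x => ENNReal.ofReal (Real.exp (a * x + c * x ^ 2))) =
      ENNReal.ofReal (Real.sqrt (v' / v) *
        Real.exp ((v' / v) * (a * μ + c * μ ^ 2 + a ^ 2 * v / 2))) •
        gaussianReal (v' / v * (μ + a * v)) v' := by
  have h0 : (0 : ℝ) < v := by positivity
  have h0' : (0 : ℝ) < v' := by positivity
  rw [gaussianReal_of_var_ne_zero _ hv, gaussianReal_of_var_ne_zero _ hv',
    ← withDensity_smul _ (measurable_gaussianPDF _ _),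
    ← withDensity_mul _ (measurable_gaussianPDF _ _) (by fun_prop)]
  congr 1
  funext x
  simp only [Pi.mul_apply, Pi.smul_apply, smul_eq_mul, gaussianPDF, gaussianPDFReal]
  rw [← ENNReal.ofReal_mul (by positivity), ← ENNReal.ofReal_mul (by positivity)]
  congr 1
  have e1 : (√(2 * Real.pi * v))⁻¹ = √(v' / v) * (√(2 * Real.pi * v'))⁻¹ := by
    rw [← Real.sqrt_inv, ← Real.sqrt_inv, ← Real.sqrt_mul (by positivity)]
    congr 1
    field_simp
  -- Completing the square; `hvv` says that the precision moves from `1/v` to `1/v' = 1/v - 2c`.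
  have e2 : -(x - μ) ^ 2 / (2 * v) + (a * x + c * x ^ 2) =
      (v' / v) * (a * μ + c * μ ^ 2 + a ^ 2 * v / 2) +
        (-(x - v' / v * (μ + a * v)) ^ 2 / (2 * v')) := by
    have hc : c = (1 - v / v') / (2 * v) := by
      field_simp
      linarith
    rw [hc]
    field_simp
    ring
  calc _ = (√(2 * Real.pi * v))⁻¹ * (Real.exp (-(x - μ) ^ 2 / (2 * v)) * Real.exp (a * x + c * x ^ 2)) := by ring
    _ = _ := by rw [← Real.exp_add, e2, Real.exp_add, e1]; ring

instance isProbabilityMeasure_chiSq (k : ℕ) [NeZero k] : IsProbabilityMeasure (chiSq k) :=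
  isProbabilityMeasure_gammaMeasure (by have := NeZero.pos k; positivity) (by norm_num)

theorem gammaPDF_scale {a : ℝ} {v : ℝ} (hv : 0 < v) (r : ℝ) (hr : 0 < r) (z : ℝ) :
    gammaPDF a (r / v) z = ENNReal.ofReal v⁻¹ * gammaPDF a r (v⁻¹ * z) := by
  rcases lt_or_ge z 0 with hz | hz
  · have : v⁻¹ * z < 0 := mul_neg_of_pos_of_neg (by positivity) hz
    rw [gammaPDF_of_neg hz, gammaPDF_of_neg this, mul_zero]
  · have : 0 ≤ v⁻¹ * z := by positivity
    rw [gammaPDF_of_nonneg hz, gammaPDF_of_nonneg this, ← ENNReal.ofReal_mul (by positivity)]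
    congr 1
    rw [Real.mul_rpow (by positivity) hz, Real.div_rpow hr.le hv.le, Real.inv_rpow hv.le,
      Real.rpow_sub_one hv.ne']
    have : r / v * z = r * (v⁻¹ * z) := by ring
    rw [this]
    field_simp

theorem gammaMeasure_map_mul {a r v : ℝ} (hr : 0 < r) (hv : 0 < v) :
    (gammaMeasure a r).map (fun y => v * y) = gammaMeasure a (r / v) := by
  have hm : ∀ r, Measurable (gammaPDF a r) := fun r => (measurable_gammaPDFReal a r).ennreal_ofReal
  refine Measure.ext_of_lintegral _ fun f hf => ?_
  rw [lintegral_map hf (by fun_prop), gammaMeasure, gammaMeasure,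
    lintegral_withDensity_eq_lintegral_mul _ (hm _) (by fun_prop),
    lintegral_withDensity_eq_lintegral_mul _ (hm _) hf]
  have hg : Measurable fun z => gammaPDF a r (v⁻¹ * z) * f z :=
    ((hm r).comp (measurable_const_mul _)).mul hf
  have e : ∫⁻ y, gammaPDF a r (v⁻¹ * (v * y)) * f (v * y) =
      ∫⁻ z, gammaPDF a r (v⁻¹ * z) * f z ∂(Measure.map (v * ·) volume) :=
    (lintegral_map hg (by fun_prop)).symm
  rw [Real.map_volume_mul_left hv.ne', lintegral_smul_measure, abs_of_pos (by positivity),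
    smul_eq_mul, ← lintegral_const_mul _ hg] at e
  simp only [Pi.mul_apply, gammaPDF_scale hv r hr]
  simp only [inv_mul_cancel_left₀ hv.ne'] at e
  rw [e]
  simp only [mul_assoc]

theorem gammaMeasure_withDensity_exp {a r r' c : ℝ} (hr : 0 < r) (hr' : 0 < r') (h : r' = r - c) :
    (gammaMeasure a r).withDensity (fun y => ENNReal.ofReal (Real.exp (c * y))) =
      ENNReal.ofReal ((r / r') ^ a) • gammaMeasure a r' := by
  have hm : ∀ r, Measurable (gammaPDF a r) := fun r => (measurable_gammaPDFReal a r).ennreal_ofReal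
  rw [gammaMeasure, gammaMeasure, ← withDensity_smul _ (hm _),
    ← withDensity_mul _ (hm _) (by fun_prop)]
  congr 1
  funext y
  simp only [Pi.mul_apply, Pi.smul_apply, smul_eq_mul]
  rcases lt_or_ge y 0 with hy | hy
  · simp [gammaPDF_of_neg hy]
  · rw [gammaPDF_of_nonneg hy, gammaPDF_of_nonneg hy, ← ENNReal.ofReal_mul' (by positivity),
      ← ENNReal.ofReal_mul (by positivity)]
    congr 1
    rw [Real.div_rpow hr.le hr'.le]
    have : Real.exp (-(r' * y)) = Real.exp (-(r * y)) * Real.exp (c * y) := by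
      rw [← Real.exp_add, h]; ring_nf
    rw [this]
    field_simp

/-- The law of `v χ²` is a gamma law of rate `1/(2v)`, and the tilt lowers the rate by `c`. This is
the same relation between `v` and `v'` as for the Gaussian factor tilted by `c ‖x‖²`, so `X` and `S`
can be tilted together and still share one variance. -/
theorem chiSq_map_withDensity_exp (k : ℕ) {v v' : ℝ≥0} (hv : 0 < v) (hv' : 0 < v') {c : ℝ}
    (hvv : (v' : ℝ) * (1 - 2 * c * v) = v) :
    ((chiSq k).map fun y => (v : ℝ) * y).withDensity (fun y => ENNReal.ofReal (Real.exp (c * y))) =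
      ENNReal.ofReal (((v' : ℝ) / v) ^ ((k : ℝ) / 2)) • ((chiSq k).map fun y => (v' : ℝ) * y) := by
  have h0 : (0 : ℝ) < v := hv
  have h0' : (0 : ℝ) < v' := hv'
  rw [chiSq, gammaMeasure_map_mul (by norm_num) h0, gammaMeasure_map_mul (by norm_num) h0',
    gammaMeasure_withDensity_exp (r := 1 / 2 / v) (r' := 1 / 2 / v') (by positivity) (by positivity)]
  · congr 3
    field_simp
  · field_simp
    linarith

instance (k : ℕ) [NeZero k] (v : ℝ≥0) :
    IsProbabilityMeasure ((chiSq k).map fun y => (v : ℝ) * y) :=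
  Measure.isProbabilityMeasure_map (by fun_prop)

instance (p n : ℕ) [NeZero n] (θ : Fin p → ℝ) (v : ℝ≥0) :
    IsProbabilityMeasure (sampleLaw p n θ v) := by
  unfold sampleLaw; infer_instance

/-- Gaussian product measures are closed under tilting by `exp (a ⬝ x + c ‖x‖²)`. -/
theorem pi_gaussianReal_withDensity_exp {p : ℕ} (θ : Fin p → ℝ) {v v' : ℝ≥0} (hv : 0 < v)
    (hv' : 0 < v') (a : Fin p → ℝ) {c : ℝ} (hvv : (v' : ℝ) * (1 - 2 * c * v) = v) :
    (Measure.pi fun i => gaussianReal (θ i) v).withDensity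
        (fun x => ENNReal.ofReal (Real.exp (a ⬝ᵥ x + c * (x ⬝ᵥ x)))) =
      ENNReal.ofReal (∏ i, (Real.sqrt (v' / v) *
        Real.exp ((v' / v) * (a i * θ i + c * θ i ^ 2 + a i ^ 2 * v / 2)))) •
        Measure.pi fun i => gaussianReal (v' / v * (θ i + a i * v)) v' := by
  have hf : ∀ i, Measurable fun x : ℝ => ENNReal.ofReal (Real.exp (a i * x + c * x ^ 2)) := by
    intro i; fun_prop
  have e1 : (fun x : Fin p → ℝ => ENNReal.ofReal (Real.exp (a ⬝ᵥ x + c * (x ⬝ᵥ x)))) =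
      fun x => ∏ i, ENNReal.ofReal (Real.exp (a i * x i + c * x i ^ 2)) := by
    funext x
    rw [← ENNReal.ofReal_prod_of_nonneg fun i _ => (Real.exp_pos _).le, ← Real.exp_sum]
    simp only [dotProduct, Finset.mul_sum, ← Finset.sum_add_distrib, sq]
  have e2 := fun i => gaussianReal_withDensity_exp (θ i) hv.ne' hv'.ne' (a i) c hvv
  have hs : ∀ i, IsFiniteMeasure ((gaussianReal (θ i) v).withDensity
      fun x => ENNReal.ofReal (Real.exp (a i * x + c * x ^ 2))) := by
    intro i; rw [e2]; exact Measure.smul_finite _ ENNReal.ofReal_ne_top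
  rw [e1, pi_withDensity hf]
  refine Measure.pi_eq fun s hs => ?_
  simp only [e2, Measure.smul_apply, Measure.pi_pi, smul_eq_mul]
  rw [ENNReal.ofReal_prod_of_nonneg fun i _ => by positivity, Finset.prod_mul_distrib]

/-- The exponential family structure: up to a finite constant, tilting by the statistic `(X, ‖X‖² +
S)` gives another law of the model. The value of the constant is irrelevant for completeness. -/
theorem exists_sampleLaw_withDensity_exp (p n : ℕ) [NeZero n] (θ : Fin p → ℝ) {v v' : ℝ≥0}
    (hv : 0 < v) (hv' : 0 < v') (a : Fin p → ℝ) {c : ℝ} (hvv : (v' : ℝ) * (1 - 2 * c * v) = v) :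
    ∃ C : ℝ≥0∞, C ≠ ∞ ∧ (sampleLaw p n θ v).withDensity
        (fun z => ENNReal.ofReal (Real.exp (a ⬝ᵥ z.1 + c * (z.1 ⬝ᵥ z.1 + z.2)))) =
      C • sampleLaw p n (fun i => v' / v * (θ i + a i * v)) v' := by
  refine ⟨ENNReal.ofReal (∏ i, (Real.sqrt (v' / v) *
        Real.exp ((v' / v) * (a i * θ i + c * θ i ^ 2 + a i ^ 2 * v / 2)))) *
      ENNReal.ofReal (((v' : ℝ) / v) ^ ((n : ℝ) / 2)),
    ENNReal.mul_ne_top ENNReal.ofReal_ne_top ENNReal.ofReal_ne_top, ?_⟩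
  · have e : (fun z : (Fin p → ℝ) × ℝ =>
        ENNReal.ofReal (Real.exp (a ⬝ᵥ z.1 + c * (z.1 ⬝ᵥ z.1 + z.2)))) =
        fun z => ENNReal.ofReal (Real.exp (a ⬝ᵥ z.1 + c * (z.1 ⬝ᵥ z.1))) *
          ENNReal.ofReal (Real.exp (c * z.2)) := by
      funext z
      rw [← ENNReal.ofReal_mul (Real.exp_pos _).le, ← Real.exp_add]
      ring_nf
    have hm1 : Measurable fun x : Fin p → ℝ =>
        ENNReal.ofReal (Real.exp (a ⬝ᵥ x + c * (x ⬝ᵥ x))) := by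
      simp only [dotProduct]; fun_prop
    have hm2 : Measurable fun y : ℝ => ENNReal.ofReal (Real.exp (c * y)) := by fun_prop
    rw [e, sampleLaw, ← prod_withDensity hm1 hm2, pi_gaussianReal_withDensity_exp θ hv hv' a hvv,
      chiSq_map_withDensity_exp n hv hv' hvv, Measure.prod_smul_left, Measure.prod_smul_right,
      smul_smul]
    rfl

/-- The family of laws of `(X, S)` is complete. -/
theorem ae_eq_zero_of_forall_integral_eq_zero {p n : ℕ} [NeZero n] {f : (Fin p → ℝ) × ℝ → ℝ}
    (hf : ∀ (θ : Fin p → ℝ) (v : ℝ≥0), 0 < v → Integrable f (sampleLaw p n θ v))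
    (h0 : ∀ (θ : Fin p → ℝ) (v : ℝ≥0), 0 < v → ∫ z, f z ∂(sampleLaw p n θ v) = 0)
    (θ : Fin p → ℝ) (v : ℝ≥0) (hv : 0 < v) : f =ᵐ[sampleLaw p n θ v] 0 := by
  set P := sampleLaw p n θ v with hP
  have h0v : (0 : ℝ) < v := hv
  have hfP : Integrable f P := hf θ v hv
  obtain ⟨g, hgm, hfg⟩ : ∃ g, StronglyMeasurable g ∧ f =ᵐ[P] g := hfP.1
  have hgP : Integrable g P := hfP.congr hfg
  have tilt : ∀ (a : Fin p → ℝ) (c : ℝ), 2 * c * v < 1 →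
      Integrable (fun z => Real.exp (a ⬝ᵥ z.1 + c * (z.1 ⬝ᵥ z.1 + z.2)) * g z) P ∧
      ∫ z, Real.exp (a ⬝ᵥ z.1 + c * (z.1 ⬝ᵥ z.1 + z.2)) * g z ∂P = 0 := by
    intro a c hc
    have hpos : 0 < 1 - 2 * c * v := by linarith
    let v' : ℝ≥0 := ⟨v / (1 - 2 * c * v), by positivity⟩
    have hv'c : (v' : ℝ) = v / (1 - 2 * c * v) := rfl
    have hv' : 0 < v' := by
      rw [← NNReal.coe_pos, hv'c]; positivity
    obtain ⟨C, hC, hCe⟩ := exists_sampleLaw_withDensity_exp p n θ hv hv' a (c := c)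
      (by rw [hv'c]; exact div_mul_cancel₀ _ hpos.ne')
    have hE : Measurable fun z : (Fin p → ℝ) × ℝ =>
        Real.exp (a ⬝ᵥ z.1 + c * (z.1 ⬝ᵥ z.1 + z.2)) := by
      simp only [dotProduct]; fun_prop
    -- The tilted law is absolutely continuous with respect to `P`, so the measurable version `g`,
    -- chosen for `P` alone, serves for all tilts at once.
    have hgQ : f =ᵐ[C • sampleLaw p n (fun i => v' / v * (θ i + a i * v)) v'] g := by
      rw [← hCe]; exact (withDensity_absolutelyContinuous _ _).ae_eq hfg
    have hi : Integrable g (P.withDensity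
        (fun z => ENNReal.ofReal (Real.exp (a ⬝ᵥ z.1 + c * (z.1 ⬝ᵥ z.1 + z.2))))) := by
      rw [hCe]; exact ((hf _ v' hv').smul_measure hC).congr hgQ
    have hz : ∫ z, g z ∂(P.withDensity
        (fun z => ENNReal.ofReal (Real.exp (a ⬝ᵥ z.1 + c * (z.1 ⬝ᵥ z.1 + z.2))))) = 0 := by
      rw [hCe, ← integral_congr_ae hgQ, integral_smul_measure, h0 _ v' hv', smul_zero]
    rw [integrable_withDensity_iff_integrable_smul' hE.ennreal_ofReal (by simp)] at hi
    rw [integral_withDensity_eq_integral_toReal_smul hE.ennreal_ofReal (by simp)] at hz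
    simp only [ENNReal.toReal_ofReal (Real.exp_pos _).le, smul_eq_mul] at hi hz
    exact ⟨hi, hz⟩
  -- `ν 1` and `ν (-1)` have the positive and negative parts of `g` as densities. The goal becomes
  -- `ν 1 = ν (-1)`, an equality of finite positive measures.
  set ν : ℝ → Measure ((Fin p → ℝ) × ℝ) :=
    fun ε => P.withDensity fun z => ENNReal.ofReal (ε * g z) with hν
  have hgm' : ∀ ε : ℝ, Measurable fun z => ENNReal.ofReal (ε * g z) := fun ε =>
    (hgm.measurable.const_mul ε).ennreal_ofReal
  have hfin : ∀ ε, IsFiniteMeasure (ν ε) := fun ε =>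
    isFiniteMeasure_withDensity_ofReal (hgP.const_mul ε).2
  -- The tilts are exponentials of linear functionals of `T`. Nothing is lost by passing to images
  -- under `T`, because `T'` is a measurable left inverse.
  set T : (Fin p → ℝ) × ℝ → (Fin p → ℝ) × ℝ := fun z => (z.1, z.1 ⬝ᵥ z.1 + z.2) with hT
  have hTm : Measurable T := by
    simp only [hT, dotProduct]; fun_prop
  set T' : (Fin p → ℝ) × ℝ → (Fin p → ℝ) × ℝ := fun z => (z.1, z.2 - z.1 ⬝ᵥ z.1) with hT'
  have hTm' : Measurable T' := by
    simp only [hT', dotProduct]; fun_prop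
  have hTT : T' ∘ T = id := by
    funext z; simp [hT, hT']
  have key : (ν 1).map T = (ν (-1)).map T := by
    refine Measure.ext_of_charFunDual (funext fun L => ?_)
    rw [charFunDual_eq_charFun_map_one, charFunDual_eq_charFun_map_one,
      Measure.map_map (by fun_prop) hTm, Measure.map_map (by fun_prop) hTm]
    set a : Fin p → ℝ := fun i => L (Pi.single i 1, 0) with ha
    set c : ℝ := L (0, 1) with hc
    have hL : ∀ z, L (T z) = a ⬝ᵥ z.1 + c * (z.1 ⬝ᵥ z.1 + z.2) := by
      intro z
      have e1 : T z = ∑ i, z.1 i • ((Pi.single i 1, 0) : (Fin p → ℝ) × ℝ) +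
          (z.1 ⬝ᵥ z.1 + z.2) • ((0, 1) : (Fin p → ℝ) × ℝ) := by
        refine Prod.ext ?_ ?_
        · ext k
          simp [hT, Prod.fst_sum, Finset.sum_apply, Pi.single_apply]
        · simp [hT, Prod.snd_sum]
      rw [e1, map_add, map_sum]
      simp only [map_smul, smul_eq_mul, dotProduct, ← hc]
      rw [mul_comm c]
      congr 1
      exact Finset.sum_congr rfl fun i _ => mul_comm _ _
    have hLm : Measurable (⇑L ∘ T) := L.continuous.measurable.comp hTm
    -- The radius keeps the tilted variance finite; the `+ 1` keeps the radius meaningful when `c =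
    -- 0`.
    have hbound : ∀ t : ℝ, |t| < 1 / (2 * v * (|c| + 1)) → 2 * (t * c) * v < 1 := by
      intro t ht
      rw [lt_div_iff₀ (by positivity)] at ht
      have h1 : t * c ≤ |t| * |c| := by rw [← abs_mul]; exact le_abs_self _
      nlinarith [abs_nonneg t, abs_nonneg c]
    have hint : ∀ ε t : ℝ, |t| < 1 / (2 * v * (|c| + 1)) →
        Integrable (fun z => Real.exp (t * (L ∘ T) z)) (ν ε) ∧
        ∫ z, Real.exp (t * (L ∘ T) z) ∂(ν ε) =
          ∫ z, Real.exp ((t • a) ⬝ᵥ z.1 + (t * c) * (z.1 ⬝ᵥ z.1 + z.2)) * max (ε * g z) 0 ∂P := by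
      intro ε t ht
      have ht' := tilt (t • a) (t * c) (hbound t ht)
      have e : ∀ z, Real.exp (t * (L ∘ T) z) =
          Real.exp ((t • a) ⬝ᵥ z.1 + (t * c) * (z.1 ⬝ᵥ z.1 + z.2)) := by
        intro z
        simp only [Function.comp, hL, smul_dotProduct, smul_eq_mul]
        ring_nf
      simp only [e, hν]
      have hE : Measurable fun z : (Fin p → ℝ) × ℝ =>
          Real.exp ((t • a) ⬝ᵥ z.1 + (t * c) * (z.1 ⬝ᵥ z.1 + z.2)) := by
        simp only [dotProduct]; fun_prop
      rw [integrable_withDensity_iff_integrable_smul' (hgm' ε) (by simp),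
        integral_withDensity_eq_integral_toReal_smul (hgm' ε) (by simp)]
      simp only [ENNReal.toReal_ofReal', smul_eq_mul]
      refine ⟨?_, integral_congr_ae (ae_of_all _ fun z => mul_comm _ _)⟩
      refine (ht'.1.const_mul ε).mono ?_ (ae_of_all _ fun z => ?_)
      · exact (((hgm.measurable.const_mul ε).max measurable_const).mul hE).aestronglyMeasurable
      · simp only [norm_mul, Real.norm_eq_abs, Real.abs_exp]
        have : |max (ε * g z) 0| ≤ |ε| * |g z| := by
          rw [abs_of_nonneg (le_max_right _ _), ← abs_mul]
          exact max_le (le_abs_self _) (abs_nonneg _)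
        calc _ ≤ (|ε| * |g z|) * _ := mul_le_mul_of_nonneg_right this (Real.exp_pos _).le
          _ = _ := by ring
    have : ((ν 1).map (L ∘ T)) = ((ν (-1)).map (L ∘ T)) := by
      refine measure_eq_of_mgf_eq (δ := 1 / (2 * v * (|c| + 1))) (by positivity) ?_ ?_ ?_
      · intro t ht
        exact (integrable_map_measure (by fun_prop) hLm.aemeasurable).mpr (hint 1 t ht).1
      · intro t ht
        exact (integrable_map_measure (by fun_prop) hLm.aemeasurable).mpr (hint (-1) t ht).1
      · intro t ht
        rw [integral_map hLm.aemeasurable (by fun_prop), integral_map hLm.aemeasurable (by fun_prop),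
          (hint 1 t ht).2, (hint (-1) t ht).2, ← sub_eq_zero, ← integral_sub]
        · refine (integral_congr_ae (ae_of_all _ fun z => ?_)).trans
            (tilt (t • a) (t * c) (hbound t ht)).2
          simp only [one_mul, neg_mul]
          rw [← mul_sub]
          congr 1
          rcases le_total 0 (g z) with h | h
          · rw [max_eq_left h, max_eq_right (by linarith)]; ring
          · rw [max_eq_right h, max_eq_left (by linarith)]; ring
        all_goals
          have ht' := tilt (t • a) (t * c) (hbound t ht)
          have hE : Measurable fun z : (Fin p → ℝ) × ℝ =>
              Real.exp ((t • a) ⬝ᵥ z.1 + (t * c) * (z.1 ⬝ᵥ z.1 + z.2)) := by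
            simp only [dotProduct]; fun_prop
          refine ht'.1.mono ((hE.mul ((hgm.measurable.const_mul _).max
            measurable_const)).aestronglyMeasurable) (ae_of_all _ fun z => ?_)
          simp only [norm_mul, Real.norm_eq_abs, Real.abs_exp]
          refine mul_le_mul_of_nonneg_left ?_ (Real.exp_pos _).le
          rw [abs_of_nonneg (le_max_right _ _)]
          refine max_le ?_ (abs_nonneg _)
          simp [le_abs_self, neg_le_abs]
    rw [this]
  have key2 : ν 1 = ν (-1) := by
    have := congrArg (fun m => Measure.map T' m) key
    simpa [Measure.map_map hTm' hTm, hTT] using this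
  have hae := (withDensity_eq_iff (hgm' 1).aemeasurable (hgm' (-1)).aemeasurable
    (by simpa using (hgP.const_mul 1).lintegral_lt_top.ne)).mp key2
  filter_upwards [hfg, hae] with z h1 h2
  rw [h1]
  rcases le_total 0 (g z) with h | h
  · rw [ENNReal.ofReal_of_nonpos (p := -1 * g z) (by linarith), ENNReal.ofReal_eq_zero] at h2
    simp only [Pi.zero_apply]; linarith
  · rw [ENNReal.ofReal_of_nonpos (p := 1 * g z) (by linarith), eq_comm, ENNReal.ofReal_eq_zero] at h2
    simp only [Pi.zero_apply]; linarith

/-! ### Noncentral chi-square laws and moments of `X` against functions of `(‖X‖², S)`. -/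

/-- Finiteness of the measures need not be assumed: it is the exponent `t = 0`. This makes the
criterion directly usable for weighted mixtures. -/
theorem measure_eq_of_lintegral_exp_eq {μ ν : Measure ℝ} {δ : ℝ} (hδ : 0 < δ)
    (hμ : ∀ t, |t| < δ → ∫⁻ x, ENNReal.ofReal (Real.exp (t * x)) ∂μ ≠ ∞)
    (h : ∀ t, |t| < δ → ∫⁻ x, ENNReal.ofReal (Real.exp (t * x)) ∂μ =
      ∫⁻ x, ENNReal.ofReal (Real.exp (t * x)) ∂ν) : μ = ν := by
  have hν : ∀ t, |t| < δ → ∫⁻ x, ENNReal.ofReal (Real.exp (t * x)) ∂ν ≠ ∞ := fun t ht =>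
    h t ht ▸ hμ t ht
  have i1 : ∀ {ρ : Measure ℝ}, (∀ t, |t| < δ → ∫⁻ x, ENNReal.ofReal (Real.exp (t * x)) ∂ρ ≠ ∞) →
      ∀ t, |t| < δ → Integrable (fun x => Real.exp (t * x)) ρ := by
    intro ρ hρ t ht
    rw [← lintegral_ofReal_ne_top_iff_integrable (by fun_prop)
      (ae_of_all _ fun x => (Real.exp_pos _).le)]
    exact hρ t ht
  have fin : ∀ {ρ : Measure ℝ}, (∀ t, |t| < δ → ∫⁻ x, ENNReal.ofReal (Real.exp (t * x)) ∂ρ ≠ ∞) →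
      IsFiniteMeasure ρ := by
    intro ρ hρ
    refine ⟨?_⟩
    have := hρ 0 (by simpa using hδ)
    simpa [lt_top_iff_ne_top] using this
  have := fin hμ
  have := fin hν
  refine measure_eq_of_mgf_eq hδ (i1 hμ) (i1 hν) fun t ht => ?_
  rw [integral_eq_lintegral_of_nonneg_ae (ae_of_all _ fun x => (Real.exp_pos _).le) (by fun_prop),
    integral_eq_lintegral_of_nonneg_ae (ae_of_all _ fun x => (Real.exp_pos _).le) (by fun_prop),
    h t ht]

theorem lintegral_exp_chiSq (k : ℕ) [NeZero k] {t : ℝ} (ht : t < 1 / 2) :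
    ∫⁻ y, ENNReal.ofReal (Real.exp (t * y)) ∂(chiSq k) =
      ENNReal.ofReal ((1 - 2 * t)⁻¹ ^ ((k : ℝ) / 2)) := by
  have hk : 0 < (k : ℝ) / 2 := by have := NeZero.pos k; positivity
  have h := gammaMeasure_withDensity_exp (a := (k : ℝ) / 2) (r := 1 / 2) (r' := 1 / 2 - t) (c := t)
    (by norm_num) (by linarith) rfl
  have := isProbabilityMeasure_gammaMeasure hk (r := 1 / 2 - t) (by linarith)
  have h2 := congrArg (fun m => m univ) h
  simp only [withDensity_apply _ MeasurableSet.univ, Measure.restrict_univ, Measure.smul_apply,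
    measure_univ, smul_eq_mul, mul_one] at h2
  rw [chiSq, h2]
  congr 2
  have : 1 / 2 - t ≠ 0 := by linarith
  have : 1 - 2 * t ≠ 0 := by linarith
  field_simp

/-- The Poisson probabilities. -/
def poissonWeight (lam : ℝ) (j : ℕ) : ℝ := Real.exp (-lam) * lam ^ j / (j.factorial : ℝ)

theorem poissonWeight_nonneg {lam : ℝ} (h : 0 ≤ lam) (j : ℕ) : 0 ≤ poissonWeight lam j := by
  unfold poissonWeight; positivity

theorem hasSum_poissonWeight_mul_pow (lam y : ℝ) :
    HasSum (fun j => poissonWeight lam j * y ^ j) (Real.exp (lam * (y - 1))) := by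
  have h := (NormedSpace.expSeries_div_hasSum_exp (𝔸 := ℝ) (lam * y)).mul_left (Real.exp (-lam))
  rw [← Real.exp_eq_exp_ℝ, ← Real.exp_add] at h
  have e1 : lam * (y - 1) = -lam + lam * y := by ring
  have e2 : (fun j => poissonWeight lam j * y ^ j) =
      fun j : ℕ => Real.exp (-lam) * ((lam * y) ^ j / (j.factorial : ℝ)) := by
    funext j
    rw [poissonWeight, mul_pow]; ring
  rw [e1, e2]
  exact h

theorem hasSum_poissonWeight (lam : ℝ) : HasSum (poissonWeight lam) 1 := by
  simpa using hasSum_poissonWeight_mul_pow lam 1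

/-- The noncentral chi-square law with `d` degrees of freedom. -/
def noncentralChiSq (d : ℕ) (lam : ℝ) : Measure ℝ :=
  Measure.sum fun j => ENNReal.ofReal (poissonWeight lam j) • chiSq (d + 2 * j)

/-- With `y = (1 - 2t)⁻¹`, each pair of degrees of freedom contributes a factor `y`, and the Poisson
average of `y ^ j` is `exp (lam (y - 1))`. -/
theorem lintegral_exp_noncentralChiSq (d : ℕ) [NeZero d] {lam t : ℝ} (hl : 0 ≤ lam) (ht : t < 1 / 2) :
    ∫⁻ y, ENNReal.ofReal (Real.exp (t * y)) ∂(noncentralChiSq d lam) =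
      ENNReal.ofReal ((1 - 2 * t)⁻¹ ^ ((d : ℝ) / 2) * Real.exp (lam * ((1 - 2 * t)⁻¹ - 1))) := by
  have hy : 0 < (1 - 2 * t)⁻¹ := inv_pos.mpr (by linarith)
  set y := (1 - 2 * t)⁻¹ with hyd
  have hd := NeZero.pos d
  have : ∀ j, NeZero (d + 2 * j) := fun j => ⟨by omega⟩
  rw [noncentralChiSq, lintegral_sum_measure]
  simp only [lintegral_smul_measure, smul_eq_mul, lintegral_exp_chiSq _ ht, ← hyd]
  have hs := (hasSum_poissonWeight_mul_pow lam y).mul_left (y ^ ((d : ℝ) / 2))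
  have e : ∀ j, ENNReal.ofReal (poissonWeight lam j) * ENNReal.ofReal (y ^ (((d + 2 * j : ℕ) : ℝ) / 2))
      = ENNReal.ofReal (y ^ ((d : ℝ) / 2) * (poissonWeight lam j * y ^ j)) := by
    intro j
    rw [← ENNReal.ofReal_mul (poissonWeight_nonneg hl j)]
    congr 1
    have : (((d + 2 * j : ℕ) : ℝ) / 2) = (d : ℝ) / 2 + j := by push_cast; ring
    rw [this, Real.rpow_add hy, Real.rpow_natCast]
    ring
  simp only [e]
  rw [← hs.tsum_eq, ENNReal.ofReal_tsum_of_nonneg _ hs.summable]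
  intro j
  have := poissonWeight_nonneg hl j
  positivity

theorem lintegral_sq_pi_gaussianReal {p : ℕ} (θ : Fin p → ℝ) (v : ℝ≥0) (e : Fin p → ℝ) (c : ℝ) :
    ∫⁻ x, ENNReal.ofReal ((c + e ⬝ᵥ x) ^ 2) ∂(Measure.pi fun i => gaussianReal (θ i) v) =
      ENNReal.ofReal ((c + e ⬝ᵥ θ) ^ 2 + v * (e ⬝ᵥ e)) := by
  have hL : ∀ i, MemLp (fun y : ℝ => e i * y) 2 (gaussianReal (θ i) v) := fun i =>
    (memLp_id_gaussianReal' 2 (by simp)).const_mul (e i)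
  have hLi : ∀ i, MemLp (fun x : Fin p → ℝ => e i * x i) 2 (Measure.pi fun i => gaussianReal (θ i) v) :=
    fun i => (hL i).comp_measurePreserving (measurePreserving_eval _ i)
  have hY : MemLp (fun x : Fin p → ℝ => e ⬝ᵥ x) 2 (Measure.pi fun i => gaussianReal (θ i) v) := by
    simp only [dotProduct]; exact memLp_finsetSum _ fun i _ => hLi i
  have hint : ∫ x, e ⬝ᵥ x ∂(Measure.pi fun i => gaussianReal (θ i) v) = e ⬝ᵥ θ := by
    simp only [dotProduct]
    rw [integral_finsetSum _ fun i _ => (hLi i).integrable (by norm_num)]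
    refine Finset.sum_congr rfl fun i _ => ?_
    rw [integral_const_mul]
    congr 1
    have h2 := integral_map (μ := Measure.pi fun i => gaussianReal (θ i) v)
      (measurable_pi_apply i).aemeasurable (f := fun y : ℝ => y) (by fun_prop)
    have h3 := (measurePreserving_eval (fun i => gaussianReal (θ i) v) i).map_eq
    exact h2.symm.trans ((congrArg (fun m : Measure ℝ => ∫ y, y ∂m) h3).trans
      integral_id_gaussianReal)
  have hvar : Var[fun x => e ⬝ᵥ x; Measure.pi fun i => gaussianReal (θ i) v] = v * (e ⬝ᵥ e) := by
    have := variance_sum_pi hL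
    have h3 : (∑ i, fun ω : Fin p → ℝ => e i * ω i) = fun x => e ⬝ᵥ x := by
      funext x; simp [dotProduct]
    rw [h3] at this
    rw [this, dotProduct, Finset.mul_sum]
    refine Finset.sum_congr rfl fun i _ => ?_
    rw [variance_const_mul, variance_fun_id_gaussianReal]
    ring
  have hcY : MemLp (fun x : Fin p → ℝ => c + e ⬝ᵥ x) 2 (Measure.pi fun i => gaussianReal (θ i) v) :=
    (memLp_const c).add hY
  rw [← ofReal_integral_eq_lintegral_ofReal hcY.integrable_sq (ae_of_all _ fun x => sq_nonneg _)]
  congr 1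
  have h4 := variance_eq_sub hcY
  rw [variance_const_add hY.1.aemeasurable.aestronglyMeasurable, hvar, integral_add (integrable_const _) (hY.integrable (by norm_num)),
    hint] at h4
  simp only [integral_const, probReal_univ, one_smul, Pi.pow_apply] at h4
  linarith

/-- Compare Laplace transforms. Tilting by `t ‖x‖² / v` turns the mean `θ` into `yθ` and the
variance `v` into `yv`, with `y = (1 - 2t)⁻¹`, so the weight integrates to `(c + y e·θ)² + y v ‖e‖²`
times the noncentral transform. Each power of `y` is worth two degrees of freedom; collecting powers
gives the three components. The signs of `c` and `e·θ` ensure that the middle weight is nonnegative,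
so that the mixture is a measure. -/
theorem map_noncentral_withDensity_sq {p : ℕ} [NeZero p] (θ : Fin p → ℝ) {v : ℝ≥0} (hv : 0 < v)
    (e : Fin p → ℝ) {c : ℝ} (hc : 0 ≤ c) (he : 0 ≤ e ⬝ᵥ θ) :
    ((Measure.pi fun i => gaussianReal (θ i) v).withDensity
        fun x => ENNReal.ofReal ((c + e ⬝ᵥ x) ^ 2)).map (fun x => (v : ℝ)⁻¹ * (x ⬝ᵥ x)) =
      ENNReal.ofReal (c ^ 2) • noncentralChiSq p (θ ⬝ᵥ θ / (2 * v)) +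
      ENNReal.ofReal (2 * c * (e ⬝ᵥ θ) + v * (e ⬝ᵥ e)) •
        noncentralChiSq (p + 2) (θ ⬝ᵥ θ / (2 * v)) +
      ENNReal.ofReal ((e ⬝ᵥ θ) ^ 2) • noncentralChiSq (p + 4) (θ ⬝ᵥ θ / (2 * v)) := by
  have h0v : (0 : ℝ) < v := hv
  have hee : 0 ≤ e ⬝ᵥ e := Finset.sum_nonneg fun i _ => mul_self_nonneg _
  have hθθ : 0 ≤ θ ⬝ᵥ θ := Finset.sum_nonneg fun i _ => mul_self_nonneg _
  set lam := θ ⬝ᵥ θ / (2 * v) with hlam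
  have hl : 0 ≤ lam := by positivity
  have hm1 : Measurable fun x : Fin p → ℝ => ENNReal.ofReal ((c + e ⬝ᵥ x) ^ 2) := by
    simp only [dotProduct]; fun_prop
  have hm2 : Measurable fun x : Fin p → ℝ => (v : ℝ)⁻¹ * (x ⬝ᵥ x) := by
    simp only [dotProduct]; fun_prop
  have hmp : NeZero (p + 2) := ⟨by omega⟩
  have hmp : NeZero (p + 4) := ⟨by omega⟩
  have rhs : ∀ t : ℝ, t < 1 / 2 → ∫⁻ y, ENNReal.ofReal (Real.exp (t * y)) ∂(
      ENNReal.ofReal (c ^ 2) • noncentralChiSq p lam +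
      ENNReal.ofReal (2 * c * (e ⬝ᵥ θ) + v * (e ⬝ᵥ e)) • noncentralChiSq (p + 2) lam +
      ENNReal.ofReal ((e ⬝ᵥ θ) ^ 2) • noncentralChiSq (p + 4) lam) =
      ENNReal.ofReal ((1 - 2 * t)⁻¹ ^ ((p : ℝ) / 2) * Real.exp (lam * ((1 - 2 * t)⁻¹ - 1)) *
        ((c + (1 - 2 * t)⁻¹ * (e ⬝ᵥ θ)) ^ 2 + (1 - 2 * t)⁻¹ * v * (e ⬝ᵥ e))) := by
    intro t ht
    have hy : 0 < (1 - 2 * t)⁻¹ := inv_pos.mpr (by linarith)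
    rw [lintegral_add_measure, lintegral_add_measure, lintegral_smul_measure,
      lintegral_smul_measure, lintegral_smul_measure, lintegral_exp_noncentralChiSq _ hl ht,
      lintegral_exp_noncentralChiSq _ hl ht, lintegral_exp_noncentralChiSq _ hl ht]
    set y := (1 - 2 * t)⁻¹
    rw [smul_eq_mul, smul_eq_mul, smul_eq_mul, ← ENNReal.ofReal_mul (by positivity),
      ← ENNReal.ofReal_mul (by positivity), ← ENNReal.ofReal_mul (by positivity),
      ← ENNReal.ofReal_add (by positivity) (by positivity),
      ← ENNReal.ofReal_add (by positivity) (by positivity)]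
    congr 1
    have e1 : ((p + 2 : ℕ) : ℝ) / 2 = (p : ℝ) / 2 + 1 := by push_cast; ring
    have e2 : ((p + 4 : ℕ) : ℝ) / 2 = (p : ℝ) / 2 + 1 + 1 := by push_cast; ring
    rw [e1, e2, Real.rpow_add hy (_ + 1) 1, Real.rpow_add hy _ 1, Real.rpow_one]
    ring
  have lhs : ∀ t : ℝ, t < 1 / 2 → ∫⁻ y, ENNReal.ofReal (Real.exp (t * y)) ∂(
      ((Measure.pi fun i => gaussianReal (θ i) v).withDensity
        fun x => ENNReal.ofReal ((c + e ⬝ᵥ x) ^ 2)).map (fun x => (v : ℝ)⁻¹ * (x ⬝ᵥ x))) =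
      ENNReal.ofReal ((1 - 2 * t)⁻¹ ^ ((p : ℝ) / 2) * Real.exp (lam * ((1 - 2 * t)⁻¹ - 1)) *
        ((c + (1 - 2 * t)⁻¹ * (e ⬝ᵥ θ)) ^ 2 + (1 - 2 * t)⁻¹ * v * (e ⬝ᵥ e))) := by
    intro t ht
    have hpos : 0 < 1 - 2 * t := by linarith
    have hy : 0 < (1 - 2 * t)⁻¹ := inv_pos.mpr hpos
    have hty : t = (1 - ((1 - 2 * t)⁻¹)⁻¹) / 2 := by rw [inv_inv]; ring
    set y := (1 - 2 * t)⁻¹ with hyd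
    let v' : ℝ≥0 := ⟨y * v, by positivity⟩
    have hv'c : (v' : ℝ) = y * v := rfl
    have hv' : 0 < v' := by rw [← NNReal.coe_pos, hv'c]; positivity
    have htilt := pi_gaussianReal_withDensity_exp θ hv hv' 0 (c := t / v) (by
      rw [hv'c]
      have : 1 - 2 * (t / v) * v = 1 - 2 * t := by field_simp
      rw [this, hyd]
      field_simp)
    have hm3 : Measurable fun x : Fin p → ℝ =>
        ENNReal.ofReal (Real.exp (0 ⬝ᵥ x + t / v * (x ⬝ᵥ x))) := by
      simp only [dotProduct]; fun_prop
    rw [lintegral_map (by fun_prop) hm2,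
      lintegral_withDensity_eq_lintegral_mul _ hm1 (by fun_prop)]
    have e1 : ((fun x : Fin p → ℝ => ENNReal.ofReal ((c + e ⬝ᵥ x) ^ 2)) * fun x : Fin p → ℝ =>
        ENNReal.ofReal (Real.exp (t * ((v : ℝ)⁻¹ * (x ⬝ᵥ x))))) =
        (fun x => ENNReal.ofReal (Real.exp (0 ⬝ᵥ x + t / v * (x ⬝ᵥ x)))) *
          fun x => ENNReal.ofReal ((c + e ⬝ᵥ x) ^ 2) := by
      funext x
      simp only [Pi.mul_apply, zero_dotProduct, zero_add]
      rw [mul_comm]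
      congr 3
      ring
    rw [e1, ← lintegral_withDensity_eq_lintegral_mul _ hm3 hm1, htilt, lintegral_smul_measure,
      lintegral_sq_pi_gaussianReal, smul_eq_mul, ← ENNReal.ofReal_mul (by positivity)]
    have hvy : (v' : ℝ) / v = y := by rw [hv'c]; field_simp
    have hprod : ∏ i, (Real.sqrt (v' / v) * Real.exp ((v' / v) *
        ((0 : Fin p → ℝ) i * θ i + t / v * θ i ^ 2 + (0 : Fin p → ℝ) i ^ 2 * v / 2))) =
        y ^ ((p : ℝ) / 2) * Real.exp (lam * (y - 1)) := by
      rw [Finset.prod_mul_distrib, ← Real.exp_sum, Finset.prod_const, hvy]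
      simp only [Finset.card_univ, Fintype.card_fin, Pi.zero_apply, zero_mul, zero_add,
        ne_eq, OfNat.ofNat_ne_zero, not_false_eq_true, zero_pow, zero_div, add_zero]
      congr 1
      · rw [Real.sqrt_eq_rpow, ← Real.rpow_natCast, ← Real.rpow_mul hy.le]
        congr 1
        ring
      · congr 1
        rw [← Finset.mul_sum, ← Finset.mul_sum, hlam]
        have : ∑ i, θ i ^ 2 = θ ⬝ᵥ θ := by simp only [dotProduct, sq]
        rw [this]
        have h2 : y * t = (y - 1) / 2 := by
          rw [hty]; field_simp
        have h3 : y * (t / v * (θ ⬝ᵥ θ)) = (y * t) * (θ ⬝ᵥ θ) / v := by ring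
        rw [h3, h2]
        field_simp
    rw [hprod]
    congr 2
    have : (e ⬝ᵥ fun i => v' / v * (θ i + (0 : Fin p → ℝ) i * v)) = y * (e ⬝ᵥ θ) := by
      rw [hvy, dotProduct, dotProduct, Finset.mul_sum]
      refine Finset.sum_congr rfl fun i _ => ?_
      simp only [Pi.zero_apply]
      ring
    rw [this, hv'c]
  refine measure_eq_of_lintegral_exp_eq (δ := 1 / 2) (by norm_num) (fun t ht => ?_) fun t ht => ?_
  · rw [lhs t (lt_of_le_of_lt (le_abs_self t) ht)]
    exact ENNReal.ofReal_ne_top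
  · have := lt_of_le_of_lt (le_abs_self t) ht
    rw [lhs t this, rhs t this]

/-- The joint law of a noncentral and an independent central chi-square variable. -/
def mixLaw (d n : ℕ) (lam : ℝ) : Measure (ℝ × ℝ) := (noncentralChiSq d lam).prod (chiSq n)

/-- The rescaled statistics `(‖X‖² / v, S / v)`. -/
def scaledStat {p : ℕ} (v : ℝ≥0) (z : (Fin p → ℝ) × ℝ) : ℝ × ℝ :=
  ((v : ℝ)⁻¹ * (z.1 ⬝ᵥ z.1), (v : ℝ)⁻¹ * z.2)

theorem measurable_scaledStat {p : ℕ} (v : ℝ≥0) : Measurable (scaledStat (p := p) v) := by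
  unfold scaledStat; simp only [dotProduct]; fun_prop

instance (d : ℕ) [NeZero d] (lam : ℝ) : SFinite (noncentralChiSq d lam) := by
  have : ∀ j, NeZero (d + 2 * j) := fun j => ⟨by have := NeZero.ne d; omega⟩
  unfold noncentralChiSq; infer_instance

theorem map_sampleLaw_withDensity_sq {p n : ℕ} [NeZero p] [NeZero n] (θ : Fin p → ℝ) {v : ℝ≥0}
    (hv : 0 < v) (e : Fin p → ℝ) {c : ℝ} (hc : 0 ≤ c) (he : 0 ≤ e ⬝ᵥ θ) :
    ((sampleLaw p n θ v).withDensity fun z => ENNReal.ofReal ((c + e ⬝ᵥ z.1) ^ 2)).map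
        (scaledStat v) =
      ENNReal.ofReal (c ^ 2) • mixLaw p n (θ ⬝ᵥ θ / (2 * v)) +
      ENNReal.ofReal (2 * c * (e ⬝ᵥ θ) + v * (e ⬝ᵥ e)) • mixLaw (p + 2) n (θ ⬝ᵥ θ / (2 * v)) +
      ENNReal.ofReal ((e ⬝ᵥ θ) ^ 2) • mixLaw (p + 4) n (θ ⬝ᵥ θ / (2 * v)) := by
  have h0v : (0 : ℝ) < v := hv
  have hm1 : Measurable fun x : Fin p → ℝ => ENNReal.ofReal ((c + e ⬝ᵥ x) ^ 2) := by
    simp only [dotProduct]; fun_prop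
  have hm2 : Measurable fun x : Fin p → ℝ => (v : ℝ)⁻¹ * (x ⬝ᵥ x) := by
    simp only [dotProduct]; fun_prop
  have e1 : scaledStat (p := p) v =
      Prod.map (fun x => (v : ℝ)⁻¹ * (x ⬝ᵥ x)) (fun y => (v : ℝ)⁻¹ * y) := rfl
  have hsc : ((chiSq n).map fun y => (v : ℝ) * y).map (fun y => (v : ℝ)⁻¹ * y) = chiSq n := by
    rw [Measure.map_map (by fun_prop) (by fun_prop)]
    convert Measure.map_id
    funext y
    simp [h0v.ne']
  rw [sampleLaw, ← prod_withDensity_left hm1, e1, ← Measure.map_prod_map _ _ hm2 (by fun_prop),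
    map_noncentral_withDensity_sq θ hv e hc he, hsc]
  have hmp : NeZero (p + 2) := ⟨by omega⟩
  have hmp : NeZero (p + 4) := ⟨by omega⟩
  simp only [mixLaw, Measure.add_prod, Measure.prod_smul_left]

theorem integral_sq_mul_scaledStat {p n : ℕ} [NeZero p] [NeZero n] (θ : Fin p → ℝ) {v : ℝ≥0}
    (hv : 0 < v) (e : Fin p → ℝ) {c : ℝ} (hc : 0 ≤ c) (he : 0 ≤ e ⬝ᵥ θ) {G : ℝ × ℝ → ℝ}
    (hG : Measurable G)
    (hi : Integrable (fun z => (c + e ⬝ᵥ z.1) ^ 2 * G (scaledStat v z)) (sampleLaw p n θ v)) :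
    ∫ z, (c + e ⬝ᵥ z.1) ^ 2 * G (scaledStat v z) ∂(sampleLaw p n θ v) =
      c ^ 2 * ∫ y, G y ∂(mixLaw p n (θ ⬝ᵥ θ / (2 * v))) +
      (2 * c * (e ⬝ᵥ θ) + v * (e ⬝ᵥ e)) * ∫ y, G y ∂(mixLaw (p + 2) n (θ ⬝ᵥ θ / (2 * v))) +
      (e ⬝ᵥ θ) ^ 2 * ∫ y, G y ∂(mixLaw (p + 4) n (θ ⬝ᵥ θ / (2 * v))) := by
  have hee : 0 ≤ e ⬝ᵥ e := Finset.sum_nonneg fun i _ => mul_self_nonneg _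
  have hm1 : Measurable fun z : (Fin p → ℝ) × ℝ => ENNReal.ofReal ((c + e ⬝ᵥ z.1) ^ 2) := by
    simp only [dotProduct]; fun_prop
  have hGs : Measurable fun z : (Fin p → ℝ) × ℝ => G (scaledStat v z) :=
    hG.comp (measurable_scaledStat v)
  have hmap := map_sampleLaw_withDensity_sq (n := n) θ hv e hc he
  have hi2 : Integrable (fun z => G (scaledStat v z))
      ((sampleLaw p n θ v).withDensity fun z => ENNReal.ofReal ((c + e ⬝ᵥ z.1) ^ 2)) := by
    rw [integrable_withDensity_iff_integrable_smul' hm1 (by simp)]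
    simpa [ENNReal.toReal_ofReal, sq_nonneg] using hi
  have hi3 : Integrable G (((sampleLaw p n θ v).withDensity
      fun z => ENNReal.ofReal ((c + e ⬝ᵥ z.1) ^ 2)).map (scaledStat v)) :=
    (integrable_map_measure hG.aestronglyMeasurable (measurable_scaledStat v).aemeasurable).mpr hi2
  have h1 : ∫ z, (c + e ⬝ᵥ z.1) ^ 2 * G (scaledStat v z) ∂(sampleLaw p n θ v) =
      ∫ y, G y ∂(((sampleLaw p n θ v).withDensity
        fun z => ENNReal.ofReal ((c + e ⬝ᵥ z.1) ^ 2)).map (scaledStat v)) := by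
    rw [integral_map (measurable_scaledStat v).aemeasurable hG.aestronglyMeasurable,
      integral_withDensity_eq_integral_toReal_smul hm1 (by simp)]
    simp [ENNReal.toReal_ofReal, sq_nonneg]
  rw [h1]
  rw [hmap] at hi3 ⊢
  have hi4 := integrable_add_measure.mp hi3
  have hi5 := integrable_add_measure.mp hi4.1
  have p1 : 0 ≤ 2 * c * (e ⬝ᵥ θ) + v * (e ⬝ᵥ e) := by positivity
  rw [integral_add_measure hi4.1 hi4.2, integral_add_measure hi5.1 hi5.2, integral_smul_measure,
    integral_smul_measure, integral_smul_measure, ENNReal.toReal_ofReal (by positivity),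
    ENNReal.toReal_ofReal p1, ENNReal.toReal_ofReal (by positivity)]
  simp only [smul_eq_mul]

theorem lintegral_scaledStat {p n : ℕ} [NeZero p] [NeZero n] (θ : Fin p → ℝ) {v : ℝ≥0}
    (hv : 0 < v) {G : ℝ × ℝ → ℝ≥0∞} (hG : Measurable G) :
    ∫⁻ z, G (scaledStat v z) ∂(sampleLaw p n θ v) = ∫⁻ y, G y ∂(mixLaw p n (θ ⬝ᵥ θ / (2 * v))) := by
  have h := map_sampleLaw_withDensity_sq (n := n) θ hv 0 (c := 1) zero_le_one (by simp)
  simp only [zero_dotProduct, add_zero, one_pow, ENNReal.ofReal_one, withDensity_const, one_smul,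
    mul_zero, ENNReal.ofReal_zero, zero_smul, ne_eq, OfNat.ofNat_ne_zero, not_false_eq_true,
    zero_pow] at h
  rw [← h, lintegral_map hG (measurable_scaledStat v)]

theorem map_scaledStat {p n : ℕ} [NeZero p] [NeZero n] (θ : Fin p → ℝ) {v : ℝ≥0}
    (hv : 0 < v) : (sampleLaw p n θ v).map (scaledStat v) = mixLaw p n (θ ⬝ᵥ θ / (2 * v)) := by
  refine Measure.ext_of_lintegral _ fun f hf => ?_
  rw [lintegral_map hf (measurable_scaledStat v), lintegral_scaledStat θ hv hf]

/-- Without the constant term, replacing `e` by `-e` changes nothing, so the sign restriction on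
`e·θ` disappears. -/
theorem integral_quadratic_mul_scaledStat {p n : ℕ} [NeZero p] [NeZero n] (θ : Fin p → ℝ) {v : ℝ≥0}
    (hv : 0 < v) (e : Fin p → ℝ) {G : ℝ × ℝ → ℝ} (hG : Measurable G)
    (hi : Integrable (fun z => (e ⬝ᵥ z.1) ^ 2 * G (scaledStat v z)) (sampleLaw p n θ v)) :
    ∫ z, (e ⬝ᵥ z.1) ^ 2 * G (scaledStat v z) ∂(sampleLaw p n θ v) =
      v * (e ⬝ᵥ e) * ∫ y, G y ∂(mixLaw (p + 2) n (θ ⬝ᵥ θ / (2 * v))) +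
      (e ⬝ᵥ θ) ^ 2 * ∫ y, G y ∂(mixLaw (p + 4) n (θ ⬝ᵥ θ / (2 * v))) := by
  rcases le_total 0 (e ⬝ᵥ θ) with he | he
  · have := integral_sq_mul_scaledStat θ hv e (le_refl 0) he hG (by simpa using hi)
    simpa using this
  · have := integral_sq_mul_scaledStat θ hv (-e) (le_refl 0) (by simpa using he) hG (by simpa using hi)
    simpa using this

theorem integrable_sq_mul {p n : ℕ} {θ : Fin p → ℝ} {v : ℝ≥0} {H : (Fin p → ℝ) × ℝ → ℝ}
    (hH : AEStronglyMeasurable H (sampleLaw p n θ v))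
    (hi : Integrable (fun z => (z.1 ⬝ᵥ z.1) * H z) (sampleLaw p n θ v)) (e : Fin p → ℝ) :
    Integrable (fun z => (e ⬝ᵥ z.1) ^ 2 * H z) (sampleLaw p n θ v) := by
  have hm : Measurable fun z : (Fin p → ℝ) × ℝ => (e ⬝ᵥ z.1) ^ 2 := by
    simp only [dotProduct]; fun_prop
  refine (hi.const_mul (e ⬝ᵥ e)).mono (hm.aestronglyMeasurable.mul hH) (ae_of_all _ fun z => ?_)
  simp only [norm_mul, Real.norm_eq_abs]
  rw [← mul_assoc]
  refine mul_le_mul_of_nonneg_right ?_ (abs_nonneg _)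
  rw [← abs_mul, abs_of_nonneg (sq_nonneg _)]
  refine le_trans ?_ (le_abs_self _)
  simp only [dotProduct, ← sq]
  exact Finset.sum_mul_sq_le_sq_mul_sq _ _ _

/-- Polarization: `4 xᵢ xₖ = (xᵢ + xₖ)² - (xᵢ - xₖ)²`. -/
theorem integrable_coord_mul_coord_mul {p n : ℕ} {θ : Fin p → ℝ} {v : ℝ≥0}
    {H : (Fin p → ℝ) × ℝ → ℝ} (hH : AEStronglyMeasurable H (sampleLaw p n θ v))
    (hi : Integrable (fun z => (z.1 ⬝ᵥ z.1) * H z) (sampleLaw p n θ v)) (i k : Fin p) :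
    Integrable (fun z => z.1 i * z.1 k * H z) (sampleLaw p n θ v) := by
  have h1 := integrable_sq_mul hH hi (Pi.single i 1 + Pi.single k 1)
  have h2 := integrable_sq_mul hH hi (Pi.single i 1 - Pi.single k 1)
  refine ((h1.sub h2).const_mul (1 / 4)).congr (ae_of_all _ fun z => ?_)
  simp only [Pi.sub_apply, add_dotProduct, sub_dotProduct, single_dotProduct, one_mul]
  ring

/-- Second moments of `X` against a function of `(‖X‖², S)`. -/
theorem integral_coord_mul_coord_mul {p n : ℕ} [NeZero p] [NeZero n] (θ : Fin p → ℝ) {v : ℝ≥0}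
    (hv : 0 < v) {G : ℝ × ℝ → ℝ} (hG : Measurable G)
    (hi : Integrable (fun z => (z.1 ⬝ᵥ z.1) * G (scaledStat v z)) (sampleLaw p n θ v))
    (i k : Fin p) :
    ∫ z, z.1 i * z.1 k * G (scaledStat v z) ∂(sampleLaw p n θ v) =
      v * (1 : Matrix (Fin p) (Fin p) ℝ) i k * ∫ y, G y ∂(mixLaw (p + 2) n (θ ⬝ᵥ θ / (2 * v))) +
      θ i * θ k * ∫ y, G y ∂(mixLaw (p + 4) n (θ ⬝ᵥ θ / (2 * v))) := by
  have hH : AEStronglyMeasurable (fun z => G (scaledStat v z)) (sampleLaw p n θ v) :=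
    (hG.comp (measurable_scaledStat v)).aestronglyMeasurable
  have h1 := integrable_sq_mul hH hi (Pi.single i 1 + Pi.single k 1)
  have h2 := integrable_sq_mul hH hi (Pi.single i 1 - Pi.single k 1)
  -- Polarization reduces mixed moments to the squares of linear forms treated above.
  have e : ∀ z : (Fin p → ℝ) × ℝ, z.1 i * z.1 k * G (scaledStat v z) =
      1 / 4 * (((Pi.single i 1 + Pi.single k 1) ⬝ᵥ z.1) ^ 2 * G (scaledStat v z) -
        ((Pi.single i 1 - Pi.single k 1) ⬝ᵥ z.1) ^ 2 * G (scaledStat v z)) := by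
    intro z
    simp only [add_dotProduct, sub_dotProduct, single_dotProduct, one_mul]
    ring
  simp only [e]
  rw [integral_const_mul, integral_sub h1 h2, integral_quadratic_mul_scaledStat θ hv _ hG h1,
    integral_quadratic_mul_scaledStat θ hv _ hG h2]
  simp only [add_dotProduct, sub_dotProduct, single_dotProduct, one_mul, Pi.add_apply,
    Pi.sub_apply, Matrix.one_apply, Pi.single_apply]
  by_cases hik : i = k
  · subst hik; simp; ring
  · have : ¬ k = i := fun h => hik h.symm
    simp [hik, this]; ring

/-- First moments of `X` against a function of `(‖X‖², S)`. -/
theorem integral_coord_mul {p n : ℕ} [NeZero p] [NeZero n] (θ : Fin p → ℝ) {v : ℝ≥0}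
    (hv : 0 < v) {G : ℝ × ℝ → ℝ} (hG : Measurable G)
    (hi0 : Integrable (fun z => G (scaledStat v z)) (sampleLaw p n θ v))
    (hi : Integrable (fun z => (z.1 ⬝ᵥ z.1) * G (scaledStat v z)) (sampleLaw p n θ v))
    (i : Fin p) :
    Integrable (fun z => z.1 i * G (scaledStat v z)) (sampleLaw p n θ v) ∧
    ∫ z, z.1 i * G (scaledStat v z) ∂(sampleLaw p n θ v) =
      θ i * ∫ y, G y ∂(mixLaw (p + 2) n (θ ⬝ᵥ θ / (2 * v))) := by
  have hH : AEStronglyMeasurable (fun z => G (scaledStat v z)) (sampleLaw p n θ v) :=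
    (hG.comp (measurable_scaledStat v)).aestronglyMeasurable
  have hint : Integrable (fun z => z.1 i * G (scaledStat v z)) (sampleLaw p n θ v) := by
    refine (hi0.norm.add hi.norm).mono ?_ (ae_of_all _ fun z => ?_)
    · exact Measurable.aestronglyMeasurable (by fun_prop) |>.mul hH
    · have h1 : |z.1 i| ≤ 1 + |z.1 ⬝ᵥ z.1| := by
        have : z.1 i * z.1 i ≤ z.1 ⬝ᵥ z.1 :=
          Finset.single_le_sum (f := fun j => z.1 j * z.1 j) (fun j _ => mul_self_nonneg _)
            (Finset.mem_univ i)
        have h2 := le_abs_self (z.1 ⬝ᵥ z.1)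
        rw [abs_le]
        constructor <;> nlinarith [sq_nonneg (z.1 i - 1), sq_nonneg (z.1 i + 1)]
      simp only [norm_mul, Real.norm_eq_abs, Pi.add_apply]
      rw [abs_of_nonneg (by positivity : 0 ≤ |G (scaledStat v z)| + |z.1 ⬝ᵥ z.1| * |G (scaledStat v z)|)]
      nlinarith [abs_nonneg (G (scaledStat v z))]
  refine ⟨hint, ?_⟩
  -- The linear moment is extracted from `(1 + e·x)²` by removing the constant and quadratic parts.
  -- Only `e·θ ≥ 0` is treated; the case `θ i < 0` uses `-eᵢ`.
  have aux : ∀ e : Fin p → ℝ, 0 ≤ e ⬝ᵥ θ →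
      Integrable (fun z => (e ⬝ᵥ z.1) * G (scaledStat v z)) (sampleLaw p n θ v) →
      ∫ z, (e ⬝ᵥ z.1) * G (scaledStat v z) ∂(sampleLaw p n θ v) =
        (e ⬝ᵥ θ) * ∫ y, G y ∂(mixLaw (p + 2) n (θ ⬝ᵥ θ / (2 * v))) := by
    intro e he hie
    have h2 := integrable_sq_mul hH hi e
    have exp1 : ∀ z : (Fin p → ℝ) × ℝ, (1 + e ⬝ᵥ z.1) ^ 2 * G (scaledStat v z) =
        G (scaledStat v z) + (2 * ((e ⬝ᵥ z.1) * G (scaledStat v z)) +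
          (e ⬝ᵥ z.1) ^ 2 * G (scaledStat v z)) := by intro z; ring
    have hi1 : Integrable (fun z => (1 + e ⬝ᵥ z.1) ^ 2 * G (scaledStat v z))
        (sampleLaw p n θ v) := by
      simp only [exp1]; exact hi0.add ((hie.const_mul 2).add h2)
    have k1 := integral_sq_mul_scaledStat θ hv e zero_le_one he hG hi1
    have k2 := integral_quadratic_mul_scaledStat θ hv e hG h2
    have k0 : ∫ z, G (scaledStat v z) ∂(sampleLaw p n θ v) =
        ∫ y, G y ∂(mixLaw p n (θ ⬝ᵥ θ / (2 * v))) := by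
      rw [← map_scaledStat θ hv,
        integral_map (measurable_scaledStat v).aemeasurable hG.aestronglyMeasurable]
    have hi2 : Integrable (fun z : (Fin p → ℝ) × ℝ => 2 * ((e ⬝ᵥ z.1) * G (scaledStat v z)) +
          (e ⬝ᵥ z.1) ^ 2 * G (scaledStat v z)) (sampleLaw p n θ v) := (hie.const_mul 2).add h2
    simp only [exp1] at k1
    rw [integral_add hi0 hi2, integral_add (hie.const_mul 2) h2,
      integral_const_mul, k2, k0] at k1
    linarith
  rcases le_total 0 (θ i) with h | h
  · simpa using aux (Pi.single i 1) (by simpa using h) (by simpa using hint)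
  · have := aux (-Pi.single i 1) (by simpa using h) (by simpa using hint.neg)
    simp only [neg_dotProduct, single_dotProduct, one_mul, neg_mul, integral_neg] at this
    linarith

/-! ### The ratio of independent chi-square variables and the tail transform. -/

theorem lintegral_gammaMeasure {a r : ℝ} (ha : 0 < a) (hr : 0 < r) {F : ℝ → ℝ≥0∞} (hF : Measurable F) :
    ∫⁻ y, F y ∂(gammaMeasure a r) =
      ∫⁻ y in Ioi 0, ENNReal.ofReal (r ^ a / Real.Gamma a) *
        ENNReal.ofReal (y ^ (a - 1) * Real.exp (-(r * y))) * F y := by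
  have hG := Real.Gamma_pos_of_pos ha
  have hm : Measurable (gammaPDF a r) := (measurable_gammaPDFReal a r).ennreal_ofReal
  rw [gammaMeasure, lintegral_withDensity_eq_lintegral_mul _ hm hF,
    ← lintegral_indicator measurableSet_Ioi]
  refine lintegral_congr_ae ?_
  have : ∀ᵐ y : ℝ, y ≠ 0 := by
    rw [ae_iff]; simp
  filter_upwards [this] with y hy
  rcases lt_or_gt_of_ne hy with h | h
  · rw [indicator_of_notMem (by simpa using h.le), Pi.mul_apply]
    simp only [gammaPDF_of_neg h, zero_mul]
  · rw [indicator_of_mem (by simpa using h), Pi.mul_apply]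
    rw [gammaPDF_of_nonneg h.le, ← ENNReal.ofReal_mul (by positivity), ← mul_assoc]

theorem lintegral_rpow_mul_exp {a r : ℝ} (ha : 0 < a) (hr : 0 < r) :
    ∫⁻ y in Ioi (0 : ℝ), ENNReal.ofReal (y ^ (a - 1) * Real.exp (-(r * y))) =
      ENNReal.ofReal (Real.Gamma a / r ^ a) := by
  have hG := Real.Gamma_pos_of_pos ha
  have := isProbabilityMeasure_gammaMeasure ha hr
  have h := lintegral_gammaMeasure ha hr (F := fun _ => 1) measurable_const
  simp only [lintegral_const, measure_univ, mul_one] at h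
  rw [lintegral_const_mul _ (by fun_prop)] at h
  have e : ENNReal.ofReal (Real.Gamma a / r ^ a) =
      ENNReal.ofReal (Real.Gamma a / r ^ a) * (ENNReal.ofReal (r ^ a / Real.Gamma a) *
      ∫⁻ y in Ioi (0 : ℝ), ENNReal.ofReal (y ^ (a - 1) * Real.exp (-(r * y)))) := by
    rw [← h, mul_one]
  rw [e, ← mul_assoc, ← ENNReal.ofReal_mul (by positivity)]
  have : Real.Gamma a / r ^ a * (r ^ a / Real.Gamma a) = 1 := by field_simp
  rw [this, ENNReal.ofReal_one, one_mul]

theorem lintegral_Ioi_comp_mul {F : ℝ → ℝ≥0∞} (hF : Measurable F) {s : ℝ} (hs : 0 < s) :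
    ∫⁻ u in Ioi (0 : ℝ), F u = ∫⁻ w in Ioi (0 : ℝ), ENNReal.ofReal s * F (s * w) := by
  have hm : Measurable ((Ioi (0 : ℝ)).indicator F) := hF.indicator measurableSet_Ioi
  rw [← lintegral_indicator measurableSet_Ioi, ← lintegral_indicator measurableSet_Ioi]
  have h1 : ∫⁻ w, (Ioi (0 : ℝ)).indicator F (s * w) =
      ENNReal.ofReal s⁻¹ * ∫⁻ u, (Ioi (0 : ℝ)).indicator F u := by
    rw [← lintegral_map hm (by fun_prop : Measurable fun w => s * w), Real.map_volume_mul_left hs.ne',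
      lintegral_smul_measure, abs_of_pos (by positivity), smul_eq_mul]
  have h2 : ∀ w, (Ioi (0 : ℝ)).indicator (fun w => ENNReal.ofReal s * F (s * w)) w =
      ENNReal.ofReal s * (Ioi (0 : ℝ)).indicator F (s * w) := by
    intro w
    by_cases hw : 0 < w
    · rw [indicator_of_mem (by simpa using hw), indicator_of_mem (by simpa using mul_pos hs hw)]
    · rw [indicator_of_notMem (by simpa using hw), indicator_of_notMem, mul_zero]
      simpa using mul_nonpos_of_nonneg_of_nonpos hs.le (not_lt.mp hw)
  have hm2 : Measurable fun w => (Ioi (0 : ℝ)).indicator F (s * w) :=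
    hm.comp (measurable_const_mul s)
  simp only [h2]
  rw [lintegral_const_mul _ hm2, h1, ← mul_assoc,
    ← ENNReal.ofReal_mul hs.le, mul_inv_cancel₀ hs.ne', ENNReal.ofReal_one, one_mul]

/-- The size bias of a chi-square law. -/
theorem chiSq_withDensity (k : ℕ) [NeZero k] :
    (chiSq k).withDensity (fun y => ENNReal.ofReal y) = ENNReal.ofReal k • chiSq (k + 2) := by
  have hk : 0 < (k : ℝ) / 2 := by have := NeZero.pos k; positivity
  have e1 : ((k + 2 : ℕ) : ℝ) / 2 = (k : ℝ) / 2 + 1 := by push_cast; ring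
  refine Measure.ext_of_lintegral _ fun F hF => ?_
  rw [lintegral_smul_measure, smul_eq_mul,
    lintegral_withDensity_eq_lintegral_mul _ (by fun_prop) hF, chiSq, chiSq, e1,
    lintegral_gammaMeasure hk (by norm_num) (by fun_prop),
    lintegral_gammaMeasure (by positivity) (by norm_num) hF, ← lintegral_const_mul _ (by fun_prop)]
  refine setLIntegral_congr_fun measurableSet_Ioi fun y hy => ?_
  have hy : 0 < y := hy
  have hG := Real.Gamma_pos_of_pos hk
  simp only [Pi.mul_apply]
  rw [Real.Gamma_add_one hk.ne', ← mul_assoc, ← mul_assoc, ← ENNReal.ofReal_mul (by positivity),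
    ← ENNReal.ofReal_mul (by positivity), ← ENNReal.ofReal_mul (by positivity),
    ← ENNReal.ofReal_mul (by positivity)]
  congr 2
  rw [Real.rpow_add (by norm_num : (0 : ℝ) < 1 / 2), Real.rpow_one, add_sub_cancel_right,
    Real.rpow_sub_one hy.ne']
  have : (k : ℝ) ≠ 0 := by have := NeZero.ne k; exact_mod_cast this
  field_simp

/-- The density of the ratio of independent chi-square variables. -/
def ratioDensity (k n : ℕ) (w : ℝ) : ℝ :=
  Real.Gamma (((k : ℝ) + n) / 2) / (Real.Gamma ((k : ℝ) / 2) * Real.Gamma ((n : ℝ) / 2)) *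
    (w ^ ((k : ℝ) / 2 - 1) * (1 + w) ^ (-(((k : ℝ) + n) / 2)))

theorem measurable_ratioDensity (k n : ℕ) : Measurable (ratioDensity k n) := by
  unfold ratioDensity; fun_prop

theorem ratioDensity_pos (k n : ℕ) [NeZero k] [NeZero n] {w : ℝ} (hw : 0 < w) :
    0 < ratioDensity k n w := by
  have hk : 0 < (k : ℝ) := by have := NeZero.pos k; positivity
  have hn : 0 < (n : ℝ) := by have := NeZero.pos n; positivity
  have h1 := Real.Gamma_pos_of_pos (s := ((k : ℝ) + n) / 2) (by positivity)
  have h2 := Real.Gamma_pos_of_pos (s := (k : ℝ) / 2) (by positivity)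
  have h3 := Real.Gamma_pos_of_pos (s := (n : ℝ) / 2) (by positivity)
  unfold ratioDensity
  positivity

/-- The law of the ratio of independent chi-square variables. -/
def chiRatio (k n : ℕ) : Measure ℝ := ((chiSq k).prod (chiSq n)).map fun z => z.1 / z.2

theorem ratioLaw_eq_chiRatio (p n j : ℕ) : ratioLaw p n j = chiRatio (p + 2 * j) n := rfl

/-- For a fixed denominator `s` substitute `u = s w`, then interchange the integrals. The remaining
integral in `s` is a gamma integral of shape `(k + n)/2` and rate `(1 + w)/2`. -/
theorem chiRatio_eq_withDensity (k n : ℕ) [NeZero k] [NeZero n] :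
    chiRatio k n =
      (volume.restrict (Ioi 0)).withDensity fun w => ENNReal.ofReal (ratioDensity k n w) := by
  have hk : 0 < (k : ℝ) / 2 := by have := NeZero.pos k; positivity
  have hn : 0 < (n : ℝ) / 2 := by have := NeZero.pos n; positivity
  refine Measure.ext_of_lintegral _ fun F hF => ?_
  have hFd : Measurable fun z : ℝ × ℝ => F (z.1 / z.2) := hF.comp (measurable_fst.div measurable_snd)
  rw [chiRatio, lintegral_map hF (by fun_prop), lintegral_prod_symm _ hFd.aemeasurable,
    lintegral_withDensity_eq_lintegral_mul _ (measurable_ratioDensity k n).ennreal_ofReal hF]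
  have inner : Measurable fun s => ∫⁻ u, F (u / s) ∂(chiSq k) :=
    Measurable.lintegral_prod_left' hFd
  rw [chiSq, lintegral_gammaMeasure (a := (n : ℝ) / 2) hn (by norm_num) inner]
  set ck := (1 / 2 : ℝ) ^ ((k : ℝ) / 2) / Real.Gamma ((k : ℝ) / 2)
  set cn := (1 / 2 : ℝ) ^ ((n : ℝ) / 2) / Real.Gamma ((n : ℝ) / 2)
  have hGk := Real.Gamma_pos_of_pos hk
  have hGn := Real.Gamma_pos_of_pos hn
  have hck : 0 < ck := by positivity
  have hcn : 0 < cn := by positivity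
  have step : ∀ s ∈ Ioi (0 : ℝ), ENNReal.ofReal cn *
      ENNReal.ofReal (s ^ ((n : ℝ) / 2 - 1) * Real.exp (-(1 / 2 * s))) *
        ∫⁻ u, F (u / s) ∂(chiSq k) =
      ∫⁻ w in Ioi (0 : ℝ), ENNReal.ofReal (ck * cn * w ^ ((k : ℝ) / 2 - 1)) *
        ENNReal.ofReal (s ^ (((k : ℝ) + n) / 2 - 1) * Real.exp (-((1 + w) / 2 * s))) * F w := by
    intro s hs
    have hs : 0 < s := hs
    have hFs : Measurable fun u => F (u / s) := hF.comp (measurable_id.div_const s)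
    rw [chiSq, lintegral_gammaMeasure (a := (k : ℝ) / 2) hk (by norm_num) hFs,
      lintegral_Ioi_comp_mul (by fun_prop) hs, ← lintegral_const_mul _ (by fun_prop)]
    refine setLIntegral_congr_fun measurableSet_Ioi fun w hw => ?_
    have hw : 0 < w := hw
    have e1 : s * w / s = w := by field_simp
    simp only [e1]
    rw [← mul_assoc, ← mul_assoc, ← ENNReal.ofReal_mul (by positivity),
      ← ENNReal.ofReal_mul (by positivity), ← ENNReal.ofReal_mul (by positivity),
      ← ENNReal.ofReal_mul (by positivity), ← ENNReal.ofReal_mul (by positivity)]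
    congr 2
    have e2 : Real.exp (-((1 + w) / 2 * s)) = Real.exp (-(1 / 2 * s)) * Real.exp (-(1 / 2 * (s * w))) := by
      rw [← Real.exp_add]; ring_nf
    have e3 : s ^ (((k : ℝ) + n) / 2 - 1) = s ^ ((n : ℝ) / 2 - 1) * s * s ^ ((k : ℝ) / 2 - 1) := by
      rw [Real.rpow_sub_one hs.ne', Real.rpow_sub_one hs.ne', Real.rpow_sub_one hs.ne', add_div,
        Real.rpow_add hs]
      field_simp
    rw [e2, e3, Real.mul_rpow hs.le hw.le]
    ring
  rw [setLIntegral_congr_fun measurableSet_Ioi step, lintegral_lintegral_swap]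
  · refine setLIntegral_congr_fun measurableSet_Ioi fun w hw => ?_
    have hw : 0 < w := hw
    have hm : 0 < ((k : ℝ) + n) / 2 := by linarith
    have hGm := Real.Gamma_pos_of_pos hm
    rw [lintegral_mul_const _ (by fun_prop), lintegral_const_mul _ (by fun_prop),
      lintegral_rpow_mul_exp hm (by positivity), Pi.mul_apply, ← ENNReal.ofReal_mul (by positivity)]
    congr 2
    rw [ratioDensity, Real.rpow_neg (by positivity), Real.div_rpow (by positivity) (by norm_num)]
    have e4 : ck * cn = 1 / (2 ^ (((k : ℝ) + n) / 2) *
        (Real.Gamma ((k : ℝ) / 2) * Real.Gamma ((n : ℝ) / 2))) := by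
      simp only [ck, cn]
      rw [add_div, Real.rpow_add (by norm_num), Real.div_rpow (by norm_num) (by norm_num),
        Real.div_rpow (by norm_num) (by norm_num), Real.one_rpow, Real.one_rpow]
      field_simp
    rw [e4]
    field_simp
  · refine Measurable.aemeasurable ?_
    fun_prop

/-- Here `(1 + w)⁻¹` is the share of the denominator in the sum of the two variables, and `w (1 +
w)⁻¹` in `mul_ratioDensity_left` is that of the numerator. The shares add up to one, which gives
`integral_chiRatio_add`; both are bounded by one, which transfers integrability to larger degrees of
freedom. -/
theorem mul_ratioDensity_right (k n : ℕ) [NeZero k] [NeZero n] {w : ℝ} (hw : 0 < w) :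
    n * ratioDensity k (n + 2) w = (k + n) * (1 + w)⁻¹ * ratioDensity k n w := by
  have hk : 0 < (k : ℝ) := by have := NeZero.pos k; positivity
  have hn : 0 < (n : ℝ) := by have := NeZero.pos n; positivity
  have h2 := Real.Gamma_pos_of_pos (s := (k : ℝ) / 2) (by positivity)
  have h3 := Real.Gamma_pos_of_pos (s := (n : ℝ) / 2) (by positivity)
  have e1 : ((k : ℝ) + (n + 2 : ℕ)) / 2 = ((k : ℝ) + n) / 2 + 1 := by push_cast; ring
  have e2 : ((n + 2 : ℕ) : ℝ) / 2 = (n : ℝ) / 2 + 1 := by push_cast; ring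
  rw [ratioDensity, ratioDensity, e1, e2, Real.Gamma_add_one (by positivity),
    Real.Gamma_add_one (by positivity), neg_add, Real.rpow_add (by positivity), Real.rpow_neg_one]
  field_simp

theorem mul_ratioDensity_left (k n : ℕ) [NeZero k] [NeZero n] {w : ℝ} (hw : 0 < w) :
    k * ratioDensity (k + 2) n w = (k + n) * (w * (1 + w)⁻¹) * ratioDensity k n w := by
  have hk : 0 < (k : ℝ) := by have := NeZero.pos k; positivity
  have hn : 0 < (n : ℝ) := by have := NeZero.pos n; positivity
  have h2 := Real.Gamma_pos_of_pos (s := (k : ℝ) / 2) (by positivity)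
  have h3 := Real.Gamma_pos_of_pos (s := (n : ℝ) / 2) (by positivity)
  have e1 : (((k + 2 : ℕ) : ℝ) + n) / 2 = ((k : ℝ) + n) / 2 + 1 := by push_cast; ring
  have e2 : ((k + 2 : ℕ) : ℝ) / 2 = (k : ℝ) / 2 + 1 := by push_cast; ring
  rw [ratioDensity, ratioDensity, e1, e2, Real.Gamma_add_one (by positivity),
    Real.Gamma_add_one (by positivity), neg_add, Real.rpow_add (by positivity : 0 < 1 + w), Real.rpow_neg_one,
    add_sub_cancel_right, Real.rpow_sub_one hw.ne']
  field_simp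

theorem integrable_chiRatio_iff {k n : ℕ} [NeZero k] [NeZero n] {F : ℝ → ℝ} :
    Integrable F (chiRatio k n) ↔ IntegrableOn (fun w => ratioDensity k n w * F w) (Ioi 0) := by
  rw [chiRatio_eq_withDensity, integrable_withDensity_iff_integrable_smul'
    (measurable_ratioDensity k n).ennreal_ofReal (by simp)]
  refine integrable_congr ((ae_restrict_iff' measurableSet_Ioi).mpr (ae_of_all _ fun w hw => ?_))
  change (ENNReal.ofReal (ratioDensity k n w)).toReal • F w = ratioDensity k n w * F w
  rw [ENNReal.toReal_ofReal (ratioDensity_pos k n hw).le, smul_eq_mul]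

theorem integral_chiRatio {k n : ℕ} [NeZero k] [NeZero n] (F : ℝ → ℝ) :
    ∫ w, F w ∂(chiRatio k n) = ∫ w in Ioi 0, ratioDensity k n w * F w := by
  rw [chiRatio_eq_withDensity, integral_withDensity_eq_integral_toReal_smul
    (measurable_ratioDensity k n).ennreal_ofReal (by simp)]
  refine setIntegral_congr_fun measurableSet_Ioi fun w hw => ?_
  rw [ENNReal.toReal_ofReal (ratioDensity_pos k n hw).le, smul_eq_mul]

theorem ae_chiRatio_pos (k n : ℕ) [NeZero k] [NeZero n] : ∀ᵐ w ∂(chiRatio k n), 0 < w := by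
  rw [chiRatio_eq_withDensity]
  exact (withDensity_absolutelyContinuous _ _).ae_le (ae_restrict_mem measurableSet_Ioi)

theorem integrable_chiRatio_succ {k n : ℕ} [NeZero k] [NeZero n] {h : ℝ → ℝ} (hm : Measurable h)
    (hi : Integrable h (chiRatio k n)) :
    Integrable h (chiRatio (k + 2) n) ∧ Integrable h (chiRatio k (n + 2)) := by
  have hk : 0 < (k : ℝ) := by have := NeZero.pos k; positivity
  have hn : 0 < (n : ℝ) := by have := NeZero.pos n; positivity
  have i1 : NeZero (k + 2) := ⟨by omega⟩
  have i2 : NeZero (n + 2) := ⟨by omega⟩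
  rw [integrable_chiRatio_iff] at hi
  rw [integrable_chiRatio_iff, integrable_chiRatio_iff]
  constructor
  · refine (hi.const_mul (((k : ℝ) + n) / k)).mono
      ((measurable_ratioDensity _ _).mul hm).aestronglyMeasurable ?_
    filter_upwards [ae_restrict_mem measurableSet_Ioi] with w hw
    have hw : 0 < w := hw
    have e : ratioDensity (k + 2) n w = (k + n) / k * ((w * (1 + w)⁻¹) * ratioDensity k n w) := by
      have := mul_ratioDensity_left k n hw
      field_simp at this ⊢
      linarith
    have h1 : w * (1 + w)⁻¹ ≤ 1 := by
      rw [← div_eq_mul_inv, div_le_one (by positivity)]; linarith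
    have hf := ratioDensity_pos k n hw
    simp only [norm_mul, Real.norm_eq_abs]
    rw [← mul_assoc]
    refine mul_le_mul_of_nonneg_right ?_ (abs_nonneg _)
    rw [e, abs_of_pos (by positivity), abs_of_pos (by positivity), abs_of_pos hf]
    refine mul_le_mul_of_nonneg_left ?_ (by positivity)
    exact mul_le_of_le_one_left hf.le h1
  · refine (hi.const_mul (((k : ℝ) + n) / n)).mono
      ((measurable_ratioDensity _ _).mul hm).aestronglyMeasurable ?_
    filter_upwards [ae_restrict_mem measurableSet_Ioi] with w hw
    have hw : 0 < w := hw
    have e : ratioDensity k (n + 2) w = (k + n) / n * ((1 + w)⁻¹ * ratioDensity k n w) := by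
      have := mul_ratioDensity_right k n hw
      field_simp at this ⊢
      linarith
    have h1 : (1 + w)⁻¹ ≤ 1 := inv_le_one_of_one_le₀ (by linarith)
    have hf := ratioDensity_pos k n hw
    simp only [norm_mul, Real.norm_eq_abs]
    rw [← mul_assoc]
    refine mul_le_mul_of_nonneg_right ?_ (abs_nonneg _)
    rw [e, abs_of_pos (by positivity), abs_of_pos (by positivity), abs_of_pos hf]
    refine mul_le_mul_of_nonneg_left ?_ (by positivity)
    exact mul_le_of_le_one_left hf.le h1

/-- The ratio is independent of the sum of the two chi-square variables. -/
theorem integral_chiRatio_add {k n : ℕ} [NeZero k] [NeZero n] {h : ℝ → ℝ} (hm : Measurable h)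
    (hi : Integrable h (chiRatio k n)) :
    k * ∫ w, h w ∂(chiRatio (k + 2) n) + n * ∫ w, h w ∂(chiRatio k (n + 2)) =
      (k + n) * ∫ w, h w ∂(chiRatio k n) := by
  have i1 : NeZero (k + 2) := ⟨by omega⟩
  have i2 : NeZero (n + 2) := ⟨by omega⟩
  obtain ⟨h1, h2⟩ := integrable_chiRatio_succ hm hi
  rw [integrable_chiRatio_iff] at h1 h2 hi
  rw [integral_chiRatio, integral_chiRatio, integral_chiRatio, ← integral_const_mul,
    ← integral_const_mul, ← integral_const_mul, ← integral_add (h1.const_mul _) (h2.const_mul _)]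
  refine setIntegral_congr_fun measurableSet_Ioi fun w hw => ?_
  have hw : 0 < w := hw
  have e1 := mul_ratioDensity_left k n hw
  have e2 := mul_ratioDensity_right k n hw
  rw [← mul_assoc, ← mul_assoc, e1, e2]
  field_simp
  ring

/-- The function `(w / (1 + w)) ^ ((k + n)/2)` is, up to a constant, an antiderivative that vanishes
at `0`. This evaluates the inner integral when the tail transform is moved onto the density. -/
theorem setIntegral_ratioDensity_mul_rpow {k n : ℕ} [NeZero k] [NeZero n] {t : ℝ} (ht : 0 < t) :
    IntegrableOn (fun w => ratioDensity k (n + 2) w * w ^ ((n : ℝ) / 2)) (Ioo 0 t) ∧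
    ∫ w in Ioo 0 t, ratioDensity k (n + 2) w * w ^ ((n : ℝ) / 2) =
      2 / n * (ratioDensity k n t * t ^ ((n : ℝ) / 2 + 1)) := by
  have hk : 0 < (k : ℝ) := by have := NeZero.pos k; positivity
  have hn : 0 < (n : ℝ) := by have := NeZero.pos n; positivity
  have i2 : NeZero (n + 2) := ⟨by omega⟩
  set c := Real.Gamma (((k : ℝ) + n) / 2) / (Real.Gamma ((k : ℝ) / 2) * Real.Gamma ((n : ℝ) / 2)) with hc
  set m := ((k : ℝ) + n) / 2 with hmdef
  have hmpos : 0 < m := by positivity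
  have hf : ∀ w, 0 < w → ratioDensity k n w * w ^ ((n : ℝ) / 2 + 1) = c * (w / (1 + w)) ^ m := by
    intro w hw
    rw [ratioDensity, ← hc, ← hmdef, Real.div_rpow hw.le (by positivity), Real.rpow_neg (by positivity)]
    have : w ^ m = w ^ ((k : ℝ) / 2 - 1) * w ^ ((n : ℝ) / 2 + 1) := by
      rw [← Real.rpow_add hw]; congr 1; rw [hmdef]; ring
    rw [this]
    field_simp
  set Φ : ℝ → ℝ := fun w => 2 / n * (c * (w / (1 + w)) ^ m) with hΦ
  have hderiv : ∀ w, 0 < w → HasDerivAt Φ (ratioDensity k (n + 2) w * w ^ ((n : ℝ) / 2)) w := by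
    intro w hw
    have h1 : HasDerivAt (fun w : ℝ => w / (1 + w)) ((1 * (1 + w) - w * 1) / (1 + w) ^ 2) w :=
      (hasDerivAt_id w).div ((hasDerivAt_id w).const_add 1) (by positivity)
    have h2 := ((h1.rpow_const (p := m) (Or.inl (by positivity))).const_mul c).const_mul (2 / (n : ℝ))
    refine h2.congr_deriv (Eq.symm ?_)
    have e2 := mul_ratioDensity_right k n hw
    have e3 : ratioDensity k (n + 2) w = (k + n) / n * (1 + w)⁻¹ * ratioDensity k n w := by
      field_simp at e2 ⊢; linarith
    have e4 : ratioDensity k n w * w ^ ((n : ℝ) / 2) = c * (w / (1 + w)) ^ m / w := by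
      rw [← hf w hw, Real.rpow_add hw, Real.rpow_one]; field_simp
    rw [e3, mul_assoc, e4, Real.rpow_sub_one (by positivity), hmdef]
    field_simp
    ring
  have hcont : ContinuousOn Φ (Icc 0 t) := by
    intro w hw
    refine ContinuousAt.continuousWithinAt ?_
    have h1 : ContinuousAt (fun w : ℝ => w / (1 + w)) w :=
      continuousAt_id.div (by fun_prop) (by have := hw.1; positivity)
    exact (((h1.rpow_const (Or.inr hmpos.le)).const_mul c).const_mul _)
  have hint : IntegrableOn (fun w => ratioDensity k (n + 2) w * w ^ ((n : ℝ) / 2)) (Ioc 0 t) :=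
    intervalIntegral.integrableOn_deriv_of_nonneg hcont (fun w hw => hderiv w hw.1)
      fun w hw => mul_nonneg (ratioDensity_pos _ _ hw.1).le (Real.rpow_nonneg hw.1.le _)
  refine ⟨hint.mono_set Ioo_subset_Ioc_self, ?_⟩
  rw [← integral_Ioc_eq_integral_Ioo, ← intervalIntegral.integral_of_le ht.le,
    intervalIntegral.integral_eq_sub_of_hasDerivAt_of_le ht.le hcont (fun w hw => hderiv w hw.1)
      ((intervalIntegrable_iff_integrableOn_Ioc_of_le ht.le).mpr hint), hf t ht]
  simp [hΦ, hmpos.ne']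

theorem measurable_tailTransform (n : ℕ) {h : ℝ → ℝ} (hm : Measurable h) :
    Measurable (tailTransform n h) := by
  have h1 : StronglyMeasurable fun z : ℝ × ℝ =>
      {z : ℝ × ℝ | z.1 < z.2}.indicator (fun z => z.2 ^ (-((n : ℝ) / 2)) * (h z.2 / z.2)) z := by
    refine Measurable.stronglyMeasurable (Measurable.indicator ?_
      (measurableSet_lt measurable_fst measurable_snd))
    have : Measurable fun z : ℝ × ℝ => h z.2 := hm.comp measurable_snd
    fun_prop
  have h2 := h1.integral_prod_right' (ν := volume)
  have e : tailTransform n h = fun w => w ^ ((n : ℝ) / 2) * ∫ t,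
      {z : ℝ × ℝ | z.1 < z.2}.indicator (fun z => z.2 ^ (-((n : ℝ) / 2)) * (h z.2 / z.2)) (w, t) := by
    funext w
    rw [tailTransform, ← integral_indicator measurableSet_Ioi]
    rfl
  rw [e]
  exact Measurable.mul (by fun_prop) h2.measurable

/-- The tail transform turns expectations under `(k, n + 2)` degrees of freedom into
expectations under `(k, n)` degrees of freedom. -/
theorem integral_tailTransform {k n : ℕ} [NeZero k] [NeZero n] {h : ℝ → ℝ} (hm : Measurable h)
    (hi : Integrable h (chiRatio k n)) :
    Integrable (tailTransform n h) (chiRatio k (n + 2)) ∧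
      n * ∫ w, tailTransform n h w ∂(chiRatio k (n + 2)) = 2 * ∫ w, h w ∂(chiRatio k n) := by
  have hn : 0 < (n : ℝ) := by have := NeZero.pos n; positivity
  have i2 : NeZero (n + 2) := ⟨by omega⟩
  set μ := volume.restrict (Ioi (0 : ℝ)) with hμ
  set L : ℝ → ℝ := fun t => t ^ (-((n : ℝ) / 2)) * (h t / t) with hL
  set f₂ : ℝ → ℝ := fun w => ratioDensity k (n + 2) w * w ^ ((n : ℝ) / 2) with hf₂
  have hLm : Measurable L := by fun_prop
  have hf₂m : Measurable f₂ := (measurable_ratioDensity k (n + 2)).mul (by fun_prop)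
  -- Fubini on the region `w < t`: the rows of `K` integrate to the tail transform against the `(k,
  -- n + 2)` density, the columns to `(2/n) h` against the `(k, n)` density.
  set K : ℝ × ℝ → ℝ := {z : ℝ × ℝ | z.1 < z.2}.indicator fun z => f₂ z.1 * L z.2 with hK
  have hKm : Measurable K :=
    ((hf₂m.comp measurable_fst).mul (hLm.comp measurable_snd)).indicator
      (measurableSet_lt measurable_fst measurable_snd)
  have rowe : ∀ w, 0 < w → ∫ t, K (w, t) ∂μ = ratioDensity k (n + 2) w * tailTransform n h w := by
    intro w hw
    have : (fun t => K (w, t)) = (Ioi w).indicator fun t => f₂ w * L t := rfl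
    rw [this, integral_indicator measurableSet_Ioi, hμ, Measure.restrict_restrict measurableSet_Ioi,
      inter_eq_self_of_subset_left (Ioi_subset_Ioi hw.le), integral_const_mul, tailTransform,
      ← mul_assoc]
  have col : ∀ t, 0 < t → ∀ g : ℝ → ℝ, ∫ w, (Iio t).indicator g w ∂μ = ∫ w in Ioo 0 t, g w := by
    intro t ht g
    rw [integral_indicator measurableSet_Iio, hμ, Measure.restrict_restrict measurableSet_Iio]
    congr 2
    ext; simp [and_comm]
  have colc : ∀ t, (fun w => K (w, t)) = (Iio t).indicator fun w => f₂ w * L t := fun t => rfl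
  have colval : ∀ t, 0 < t → 2 / n * (ratioDensity k n t * t ^ ((n : ℝ) / 2 + 1)) * L t =
      2 / n * (ratioDensity k n t * h t) := by
    intro t ht
    simp only [hL]
    rw [Real.rpow_add ht, Real.rpow_one, Real.rpow_neg ht.le]
    field_simp
  have hK1 : Integrable K (μ.prod μ) := by
    rw [integrable_prod_iff' hKm.aestronglyMeasurable]
    constructor
    · filter_upwards [ae_restrict_mem measurableSet_Ioi] with t ht
      rw [colc, integrable_indicator_iff measurableSet_Iio, IntegrableOn, hμ,
        Measure.restrict_restrict measurableSet_Iio]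
      have : Iio t ∩ Ioi 0 = Ioo 0 t := by ext; simp [and_comm]
      rw [this]
      exact (setIntegral_ratioDensity_mul_rpow ht).1.mul_const _
    · rw [integrable_chiRatio_iff] at hi
      refine (hi.norm.const_mul (2 / n)).congr ?_
      filter_upwards [ae_restrict_mem measurableSet_Ioi] with t ht
      have ht : 0 < t := ht
      have e1 : (fun w => ‖K (w, t)‖) = (Iio t).indicator fun w => ‖f₂ w‖ * ‖L t‖ := by
        funext w
        change ‖(Iio t).indicator (fun w => f₂ w * L t) w‖ = _
        rw [norm_indicator_eq_indicator_norm]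
        simp only [norm_mul]
      rw [e1, col t ht, integral_mul_const]
      have e2 : ∫ w in Ioo 0 t, ‖f₂ w‖ = ∫ w in Ioo 0 t, f₂ w := by
        refine setIntegral_congr_fun measurableSet_Ioo fun w hw => ?_
        exact Real.norm_of_nonneg (mul_nonneg (ratioDensity_pos _ _ hw.1).le
          (Real.rpow_nonneg hw.1.le _))
      have hp := ratioDensity_pos k n ht
      have e3 := congrArg (fun x => ‖x‖) (colval t ht)
      simp only [norm_mul] at e3 ⊢
      rw [e2, hf₂, (setIntegral_ratioDensity_mul_rpow (k := k) (n := n) ht).2]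
      rw [Real.norm_of_nonneg (by positivity : 0 ≤ 2 / (n : ℝ))] at e3
      rw [← e3, Real.norm_of_nonneg hp.le, Real.norm_of_nonneg (by positivity)]
  have hrow := hK1.integral_prod_left
  have hcongr : (fun w => ∫ t, K (w, t) ∂μ) =ᵐ[μ]
      fun w => ratioDensity k (n + 2) w * tailTransform n h w := by
    filter_upwards [ae_restrict_mem measurableSet_Ioi] with w hw using rowe w hw
  refine ⟨?_, ?_⟩
  · rw [integrable_chiRatio_iff]
    exact hrow.congr hcongr
  · rw [integral_chiRatio, integral_chiRatio, ← integral_congr_ae hcongr]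
    have hsw := integral_integral_swap (f := fun w t => K (w, t)) hK1
    rw [hsw]
    have : ∀ t ∈ Ioi (0 : ℝ), ∫ w, K (w, t) ∂μ = 2 / n * (ratioDensity k n t * h t) := by
      intro t ht
      rw [colc, col t ht, integral_mul_const, (setIntegral_ratioDensity_mul_rpow ht).2, colval t ht]
    rw [setIntegral_congr_fun measurableSet_Ioi this, integral_const_mul]
    field_simp

/-! ### Pairs of chi-square variables, their Poisson mixtures and the Stein identity. -/

theorem ae_chiSq_pos (k : ℕ) [NeZero k] : ∀ᵐ y ∂(chiSq k), 0 < y := by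
  have hk : 0 < (k : ℝ) / 2 := by have := NeZero.pos k; positivity
  have h := lintegral_gammaMeasure hk (r := 1 / 2) (by norm_num) (F := (Iic (0 : ℝ)).indicator 1)
    (measurable_one.indicator measurableSet_Iic)
  rw [lintegral_indicator_one measurableSet_Iic] at h
  rw [ae_iff]
  have e : {a : ℝ | ¬ 0 < a} = Iic 0 := by ext; simp
  rw [e, chiSq, h]
  rw [setLIntegral_congr_fun (g := fun _ => 0) measurableSet_Ioi]
  · simp
  · intro y hy
    simp only
    rw [indicator_of_notMem (by simpa using hy), mul_zero]

theorem ae_prod_chiSq_pos (k n : ℕ) [NeZero k] [NeZero n] :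
    ∀ᵐ z ∂((chiSq k).prod (chiSq n)), 0 < z.1 ∧ 0 < z.2 :=
  (Measure.quasiMeasurePreserving_fst.ae (ae_chiSq_pos k)).and
    (Measure.quasiMeasurePreserving_snd.ae (ae_chiSq_pos n))

theorem prod_chiSq_withDensity_fst (k n : ℕ) [NeZero k] [NeZero n] :
    ((chiSq k).prod (chiSq n)).withDensity (fun z => ENNReal.ofReal z.1) =
      ENNReal.ofReal k • (chiSq (k + 2)).prod (chiSq n) := by
  rw [← prod_withDensity_left (by fun_prop : Measurable fun y : ℝ => ENNReal.ofReal y),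
    chiSq_withDensity, Measure.prod_smul_left]

theorem prod_chiSq_withDensity_snd (k n : ℕ) [NeZero k] [NeZero n] :
    ((chiSq k).prod (chiSq n)).withDensity (fun z => ENNReal.ofReal z.2) =
      ENNReal.ofReal n • (chiSq k).prod (chiSq (n + 2)) := by
  have : NeZero (n + 2) := ⟨by omega⟩
  rw [← prod_withDensity_right (by fun_prop : Measurable fun y : ℝ => ENNReal.ofReal y),
    chiSq_withDensity, Measure.prod_smul_right]

theorem integral_fst_mul {k n : ℕ} [NeZero k] [NeZero n] (G : ℝ × ℝ → ℝ) :
    (Integrable (fun z => z.1 * G z) ((chiSq k).prod (chiSq n)) ↔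
      Integrable G ((chiSq (k + 2)).prod (chiSq n))) ∧
    ∫ z, z.1 * G z ∂((chiSq k).prod (chiSq n)) =
      k * ∫ z, G z ∂((chiSq (k + 2)).prod (chiSq n)) := by
  have hk : 0 < (k : ℝ) := by have := NeZero.pos k; positivity
  have hd : Measurable fun z : ℝ × ℝ => ENNReal.ofReal z.1 := by fun_prop
  have hae : (fun z : ℝ × ℝ => (ENNReal.ofReal z.1).toReal • G z) =ᵐ[(chiSq k).prod (chiSq n)]
      fun z => z.1 * G z := by
    filter_upwards [ae_prod_chiSq_pos k n] with z hz
    rw [ENNReal.toReal_ofReal hz.1.le, smul_eq_mul]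
  constructor
  · rw [← integrable_congr hae, ← integrable_withDensity_iff_integrable_smul' hd (by simp),
      prod_chiSq_withDensity_fst, integrable_smul_measure (by simpa using NeZero.ne k) ENNReal.ofReal_ne_top]
  · rw [← integral_congr_ae hae, ← integral_withDensity_eq_integral_toReal_smul hd (by simp),
      prod_chiSq_withDensity_fst, integral_smul_measure, ENNReal.toReal_ofReal hk.le, smul_eq_mul]

theorem integral_snd_mul {k n : ℕ} [NeZero k] [NeZero n] (G : ℝ × ℝ → ℝ) :
    (Integrable (fun z => z.2 * G z) ((chiSq k).prod (chiSq n)) ↔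
      Integrable G ((chiSq k).prod (chiSq (n + 2)))) ∧
    ∫ z, z.2 * G z ∂((chiSq k).prod (chiSq n)) =
      n * ∫ z, G z ∂((chiSq k).prod (chiSq (n + 2))) := by
  have hn : 0 < (n : ℝ) := by have := NeZero.pos n; positivity
  have hd : Measurable fun z : ℝ × ℝ => ENNReal.ofReal z.2 := by fun_prop
  have hae : (fun z : ℝ × ℝ => (ENNReal.ofReal z.2).toReal • G z) =ᵐ[(chiSq k).prod (chiSq n)]
      fun z => z.2 * G z := by
    filter_upwards [ae_prod_chiSq_pos k n] with z hz
    rw [ENNReal.toReal_ofReal hz.2.le, smul_eq_mul]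
  constructor
  · rw [← integrable_congr hae, ← integrable_withDensity_iff_integrable_smul' hd (by simp),
      prod_chiSq_withDensity_snd, integrable_smul_measure (by simpa using NeZero.ne n) ENNReal.ofReal_ne_top]
  · rw [← integral_congr_ae hae, ← integral_withDensity_eq_integral_toReal_smul hd (by simp),
      prod_chiSq_withDensity_snd, integral_smul_measure, ENNReal.toReal_ofReal hn.le, smul_eq_mul]

theorem integral_comp_ratio {k n : ℕ} {F : ℝ → ℝ} (hF : Measurable F) :
    (Integrable (fun z => F (z.1 / z.2)) ((chiSq k).prod (chiSq n)) ↔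
      Integrable F (chiRatio k n)) ∧
    ∫ z, F (z.1 / z.2) ∂((chiSq k).prod (chiSq n)) = ∫ w, F w ∂(chiRatio k n) :=
  ⟨(integrable_map_measure hF.aestronglyMeasurable (by fun_prop)).symm,
    (integral_map (by fun_prop) hF.aestronglyMeasurable).symm⟩

theorem integral_snd_mul_comp_ratio {k n : ℕ} [NeZero k] [NeZero n] {F : ℝ → ℝ} (hF : Measurable F) :
    (Integrable (fun z => z.2 * F (z.1 / z.2)) ((chiSq k).prod (chiSq n)) ↔
      Integrable F (chiRatio k (n + 2))) ∧
    ∫ z, z.2 * F (z.1 / z.2) ∂((chiSq k).prod (chiSq n)) = n * ∫ w, F w ∂(chiRatio k (n + 2)) := by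
  have h1 := integral_snd_mul (k := k) (n := n) fun z => F (z.1 / z.2)
  have h2 := integral_comp_ratio (k := k) (n := n + 2) hF
  exact ⟨h1.1.trans h2.1, by rw [h1.2, h2.2]⟩

/-- Dividing by the numerator undoes its size bias, from `k + 2` back to `k`; multiplying by the
denominator size-biases the latter, from `n` to `n + 2`. -/
theorem integral_div_mul_comp_ratio {k n : ℕ} [NeZero k] [NeZero n] {F : ℝ → ℝ} (hF : Measurable F) :
    (Integrable (fun z => z.2 / z.1 * F (z.1 / z.2)) ((chiSq (k + 2)).prod (chiSq n)) ↔
      Integrable F (chiRatio k (n + 2))) ∧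
    k * ∫ z, z.2 / z.1 * F (z.1 / z.2) ∂((chiSq (k + 2)).prod (chiSq n)) =
      n * ∫ w, F w ∂(chiRatio k (n + 2)) := by
  have h1 := integral_fst_mul (k := k) (n := n) fun z => z.2 / z.1 * F (z.1 / z.2)
  have h2 := integral_snd_mul_comp_ratio (k := k) (n := n) hF
  have hae : (fun z : ℝ × ℝ => z.1 * (z.2 / z.1 * F (z.1 / z.2))) =ᵐ[(chiSq k).prod (chiSq n)]
      fun z => z.2 * F (z.1 / z.2) := by
    filter_upwards [ae_prod_chiSq_pos k n] with z hz
    have := hz.1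
    field_simp
  rw [← h1.1, ← h1.2, integral_congr_ae hae, integrable_congr hae]
  exact h2

theorem mixLaw_eq_sum (d n : ℕ) [NeZero d] [NeZero n] (lam : ℝ) :
    mixLaw d n lam = Measure.sum fun j =>
      ENNReal.ofReal (poissonWeight lam j) • (chiSq (d + 2 * j)).prod (chiSq n) := by
  rw [mixLaw, noncentralChiSq, Measure.prod_sum_left]
  simp only [Measure.prod_smul_left]

theorem integrable_mixLaw_iff {d n : ℕ} [NeZero d] [NeZero n] {lam : ℝ} (hl : 0 ≤ lam)
    {A : ℝ × ℝ → ℝ} (hA : ∀ j, Integrable A ((chiSq (d + 2 * j)).prod (chiSq n))) :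
    Integrable A (mixLaw d n lam) ↔
      Summable fun j => poissonWeight lam j * ∫ z, ‖A z‖ ∂((chiSq (d + 2 * j)).prod (chiSq n)) := by
  rw [mixLaw_eq_sum, integrable_sum_measure_iff]
  simp only [integral_smul_measure, ENNReal.toReal_ofReal (poissonWeight_nonneg hl _), smul_eq_mul,
    and_iff_right_iff_imp]
  exact fun _ j => (hA j).smul_measure ENNReal.ofReal_ne_top

theorem hasSum_integral_mixLaw {d n : ℕ} [NeZero d] [NeZero n] {lam : ℝ} (hl : 0 ≤ lam)
    {A : ℝ × ℝ → ℝ} (hA : Integrable A (mixLaw d n lam)) :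
    HasSum (fun j => poissonWeight lam j * ∫ z, A z ∂((chiSq (d + 2 * j)).prod (chiSq n)))
      (∫ z, A z ∂(mixLaw d n lam)) := by
  rw [mixLaw_eq_sum] at hA ⊢
  have := hasSum_integral_measure hA
  simpa only [integral_smul_measure, ENNReal.toReal_ofReal (poissonWeight_nonneg hl _), smul_eq_mul]
    using this

/-- Both mixtures carry the same Poisson weights, so a bound on the components whose constant does
not depend on `j` passes to the sums. -/
theorem integrable_mixLaw_of_le {d d' n : ℕ} [NeZero d] [NeZero d'] [NeZero n] {lam : ℝ}
    (hl : 0 ≤ lam) {A B : ℝ × ℝ → ℝ} {C : ℝ}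
    (hA : ∀ j, Integrable A ((chiSq (d' + 2 * j)).prod (chiSq n)))
    (hB : ∀ j, Integrable B ((chiSq (d + 2 * j)).prod (chiSq n)))
    (hle : ∀ j, ∫ z, ‖A z‖ ∂((chiSq (d' + 2 * j)).prod (chiSq n)) ≤
      C * ∫ z, ‖B z‖ ∂((chiSq (d + 2 * j)).prod (chiSq n)))
    (h : Integrable B (mixLaw d n lam)) : Integrable A (mixLaw d' n lam) := by
  rw [integrable_mixLaw_iff hl hA]
  rw [integrable_mixLaw_iff hl hB] at h
  refine Summable.of_nonneg_of_le (fun j => mul_nonneg (poissonWeight_nonneg hl j)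
    (integral_nonneg fun z => norm_nonneg _)) (fun j => ?_) (h.mul_left C)
  rw [mul_left_comm]
  exact mul_le_mul_of_nonneg_left (hle j) (poissonWeight_nonneg hl j)

theorem integral_mixLaw_congr {d d' n : ℕ} [NeZero d] [NeZero d'] [NeZero n] {lam : ℝ}
    (hl : 0 ≤ lam) {A B : ℝ × ℝ → ℝ} (hA : Integrable A (mixLaw d' n lam))
    (hB : Integrable B (mixLaw d n lam))
    (h : ∀ j, ∫ z, A z ∂((chiSq (d' + 2 * j)).prod (chiSq n)) =
      ∫ z, B z ∂((chiSq (d + 2 * j)).prod (chiSq n))) :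
    ∫ z, A z ∂(mixLaw d' n lam) = ∫ z, B z ∂(mixLaw d n lam) := by
  refine (hasSum_integral_mixLaw hl hA).unique ?_
  simp only [h]
  exact hasSum_integral_mixLaw hl hB

theorem abs_tailTransform_le (n : ℕ) (h : ℝ → ℝ) {w : ℝ} (hw : 0 < w) :
    |tailTransform n h w| ≤ tailTransform n (fun t => |h t|) w := by
  rw [tailTransform, tailTransform, abs_mul, abs_of_nonneg (by positivity)]
  refine mul_le_mul_of_nonneg_left ?_ (by positivity)
  refine (abs_integral_le_integral_abs).trans_eq ?_
  refine setIntegral_congr_fun measurableSet_Ioi fun t ht => ?_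
  have : 0 < t := hw.trans ht
  rw [abs_mul, abs_div, abs_of_pos this, abs_of_nonneg (by positivity)]

section tail

variable {d n : ℕ} [NeZero d] [NeZero n] {lam : ℝ} {h : ℝ → ℝ}

/-- The constants must be uniform in `k` to survive the Poisson summation. They come from the
recurrence `integral_chiRatio_add` and from `k + n ≤ k (1 + n)` for `k ≥ 1`. -/
theorem integral_norm_chiRatio_le {k : ℕ} [NeZero k] (hm : Measurable h)
    (hi : Integrable h (chiRatio k n)) :
    ∫ w, ‖h w‖ ∂(chiRatio (k + 2) n) ≤ (1 + n) * ∫ w, ‖h w‖ ∂(chiRatio k n) ∧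
    n * ∫ w, ‖h w‖ ∂(chiRatio k (n + 2)) ≤ k * ((1 + n) * ∫ w, ‖h w‖ ∂(chiRatio k n)) ∧
    n * ∫ w, ‖tailTransform n h w‖ ∂(chiRatio k (n + 2)) ≤ 2 * ∫ w, ‖h w‖ ∂(chiRatio k n) := by
  have hk : 1 ≤ (k : ℝ) := by exact_mod_cast NeZero.one_le
  have hn : 0 < (n : ℝ) := by have := NeZero.pos n; positivity
  have i2 : NeZero (n + 2) := ⟨by omega⟩
  have e := integral_chiRatio_add hm.norm hi.norm
  have p0 : 0 ≤ ∫ w, ‖h w‖ ∂(chiRatio k n) := integral_nonneg fun _ => norm_nonneg _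
  have p1 : 0 ≤ ∫ w, ‖h w‖ ∂(chiRatio (k + 2) n) := integral_nonneg fun _ => norm_nonneg _
  have p2 : 0 ≤ n * ∫ w, ‖h w‖ ∂(chiRatio k (n + 2)) :=
    mul_nonneg hn.le (integral_nonneg fun _ => norm_nonneg _)
  have hkn : ((k : ℝ) + n) ≤ k * (1 + n) := by nlinarith
  have hb := mul_le_mul_of_nonneg_right hkn p0
  refine ⟨?_, ?_, ?_⟩
  · refine le_of_mul_le_mul_left (a := (k : ℝ)) ?_ (by linarith)
    linarith
  · nlinarith
  · have t1 := integral_tailTransform hm hi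
    have t2 := integral_tailTransform (h := fun t => ‖h t‖) hm.norm hi.norm
    rw [← t2.2]
    refine mul_le_mul_of_nonneg_left ?_ hn.le
    refine integral_mono_ae t1.1.norm t2.1 ?_
    filter_upwards [ae_chiRatio_pos k (n + 2)] with w hw
    exact abs_tailTransform_le n h hw

theorem ratio_mixLaw_integrable (hl : 0 ≤ lam) (hm : Measurable h)
    (hc : ∀ j, Integrable h (chiRatio (d + 2 * j) n))
    (hi : Integrable (fun z => h (z.1 / z.2)) (mixLaw d n lam)) :
    Integrable (fun z => h (z.1 / z.2)) (mixLaw (d + 2) n lam) ∧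
    Integrable (fun z => z.2 / z.1 * h (z.1 / z.2)) (mixLaw (d + 2) n lam) ∧
    Integrable (fun z => z.2 * tailTransform n h (z.1 / z.2)) (mixLaw d n lam) ∧
    Integrable (fun z => z.2 / z.1 * tailTransform n h (z.1 / z.2)) (mixLaw (d + 2) n lam) := by
  have i2 : NeZero (n + 2) := ⟨by omega⟩
  have i3 : NeZero (d + 2) := ⟨by omega⟩
  have i4 : ∀ j, NeZero (d + 2 * j) := fun j => ⟨by have := NeZero.ne d; omega⟩
  have i5 : ∀ j, 1 ≤ ((d + 2 * j : ℕ) : ℝ) := fun j => by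
    have := NeZero.pos d
    exact_mod_cast (by omega : 1 ≤ d + 2 * j)
  have hTm := measurable_tailTransform n hm
  have hd : ∀ j, d + 2 + 2 * j = d + 2 * j + 2 := fun j => by ring
  have hB : ∀ j, Integrable (fun z => h (z.1 / z.2)) ((chiSq (d + 2 * j)).prod (chiSq n)) :=
    fun j => (integral_comp_ratio hm).1.mpr (hc j)
  have eB : ∀ j, ∫ z, ‖h (z.1 / z.2)‖ ∂((chiSq (d + 2 * j)).prod (chiSq n)) =
      ∫ w, ‖h w‖ ∂(chiRatio (d + 2 * j) n) := fun j => (integral_comp_ratio hm.norm).2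
  have nn : ∀ j, 0 ≤ ∫ w, ‖h w‖ ∂(chiRatio (d + 2 * j) n) :=
    fun j => integral_nonneg fun _ => norm_nonneg _
  have normdiv : ∀ (F : ℝ → ℝ) (k : ℕ) [NeZero k], Measurable F →
      k * ∫ z, ‖z.2 / z.1 * F (z.1 / z.2)‖ ∂((chiSq (k + 2)).prod (chiSq n)) =
        n * ∫ w, ‖F w‖ ∂(chiRatio k (n + 2)) := by
    intro F k _ hF
    have ik : NeZero (k + 2) := ⟨by omega⟩
    rw [← (integral_div_mul_comp_ratio (k := k) (n := n) hF.norm).2]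
    congr 1
    refine integral_congr_ae ?_
    filter_upwards [ae_prod_chiSq_pos (k + 2) n] with z hz
    rw [norm_mul, Real.norm_of_nonneg (div_nonneg hz.2.le hz.1.le)]
  refine ⟨?_, ?_, ?_, ?_⟩
  · refine integrable_mixLaw_of_le (C := 1 + n) hl (fun j => ?_) hB (fun j => ?_) hi
    · rw [hd]
      exact (integral_comp_ratio hm).1.mpr (integrable_chiRatio_succ hm (hc j)).1
    · rw [hd, (integral_comp_ratio hm.norm).2, eB]
      exact (integral_norm_chiRatio_le hm (hc j)).1
  · refine integrable_mixLaw_of_le (C := 1 + n) hl (fun j => ?_) hB (fun j => ?_) hi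
    · rw [hd]
      exact (integral_div_mul_comp_ratio hm).1.mpr (integrable_chiRatio_succ hm (hc j)).2
    · rw [hd, eB]
      refine le_of_mul_le_mul_left (a := ((d + 2 * j : ℕ) : ℝ)) ?_ (by linarith [i5 j])
      rw [normdiv h _ hm]
      exact (integral_norm_chiRatio_le hm (hc j)).2.1
  · refine integrable_mixLaw_of_le (C := 2) hl (fun j => ?_) hB (fun j => ?_) hi
    · exact (integral_snd_mul_comp_ratio hTm).1.mpr (integral_tailTransform hm (hc j)).1
    · rw [eB]
      refine le_trans (le_of_eq ?_) (integral_norm_chiRatio_le hm (hc j)).2.2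
      rw [← (integral_snd_mul_comp_ratio hTm.norm).2]
      refine integral_congr_ae ?_
      filter_upwards [ae_prod_chiSq_pos (d + 2 * j) n] with z hz
      rw [norm_mul, Real.norm_of_nonneg hz.2.le]
  · refine integrable_mixLaw_of_le (C := 2) hl (fun j => ?_) hB (fun j => ?_) hi
    · rw [hd]
      exact (integral_div_mul_comp_ratio hTm).1.mpr (integral_tailTransform hm (hc j)).1
    · rw [hd, eB]
      refine le_of_mul_le_mul_left (a := ((d + 2 * j : ℕ) : ℝ)) ?_ (by linarith [i5 j])
      rw [normdiv _ _ hTm]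
      have := (integral_norm_chiRatio_le hm (hc j)).2.2
      nlinarith [nn j, i5 j]

theorem integral_snd_mul_tailTransform_mixLaw (hl : 0 ≤ lam) (hm : Measurable h)
    (hc : ∀ j, Integrable h (chiRatio (d + 2 * j) n))
    (hi : Integrable (fun z => h (z.1 / z.2)) (mixLaw d n lam)) :
    ∫ z, z.2 * tailTransform n h (z.1 / z.2) ∂(mixLaw d n lam) =
      2 * ∫ z, h (z.1 / z.2) ∂(mixLaw d n lam) := by
  have i4 : ∀ j, NeZero (d + 2 * j) := fun j => ⟨by have := NeZero.ne d; omega⟩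
  have hTm := measurable_tailTransform n hm
  rw [← integral_const_mul]
  refine integral_mixLaw_congr hl (ratio_mixLaw_integrable hl hm hc hi).2.2.1 (hi.const_mul 2)
    fun j => ?_
  rw [(integral_snd_mul_comp_ratio hTm).2, (integral_tailTransform hm (hc j)).2, integral_const_mul,
    (integral_comp_ratio hm).2]

/-- In the component with `k = d + 2j`, the left side is `2 E_{k+2,n}[h] + (2n/k) E_{k,n+2}[h]`
minus `(n²/k)` times the mean of the tail transform under `(k, n + 2)`. The last term equals `(2n/k)
E_{k,n}[h]`, and by the recurrence the first two add up to `(2/k)(k + n) E_{k,n}[h]`. No derivative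
of `h` is involved. -/
theorem integral_stein_mixLaw (hl : 0 ≤ lam) (hm : Measurable h)
    (hc : ∀ j, Integrable h (chiRatio (d + 2 * j) n))
    (hi : Integrable (fun z => h (z.1 / z.2)) (mixLaw d n lam)) :
    ∫ z, (2 * h (z.1 / z.2) + z.2 / z.1 * (2 * h (z.1 / z.2) - n * tailTransform n h (z.1 / z.2)))
        ∂(mixLaw (d + 2) n lam) = 2 * ∫ z, h (z.1 / z.2) ∂(mixLaw d n lam) := by
  have i2 : NeZero (n + 2) := ⟨by omega⟩
  have i3 : NeZero (d + 2) := ⟨by omega⟩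
  have i4 : ∀ j, NeZero (d + 2 * j) := fun j => ⟨by have := NeZero.ne d; omega⟩
  have hTm := measurable_tailTransform n hm
  have hd : ∀ j, d + 2 + 2 * j = d + 2 * j + 2 := fun j => by ring
  obtain ⟨m1, m2, -, m4⟩ := ratio_mixLaw_integrable hl hm hc hi
  have e : ∀ z : ℝ × ℝ, 2 * h (z.1 / z.2) +
      z.2 / z.1 * (2 * h (z.1 / z.2) - n * tailTransform n h (z.1 / z.2)) =
      2 * h (z.1 / z.2) + 2 * (z.2 / z.1 * h (z.1 / z.2)) -
        n * (z.2 / z.1 * tailTransform n h (z.1 / z.2)) := fun z => by ring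
  simp only [e]
  rw [← integral_const_mul]
  refine integral_mixLaw_congr hl (((m1.const_mul 2).add (m2.const_mul 2)).sub (m4.const_mul _))
    (hi.const_mul 2) fun j => ?_
  rw [hd]
  set k := d + 2 * j
  have hk : (k : ℝ) ≠ 0 := Nat.cast_ne_zero.mpr (NeZero.ne k)
  have j1 : Integrable (fun z => h (z.1 / z.2)) ((chiSq (k + 2)).prod (chiSq n)) :=
    (integral_comp_ratio hm).1.mpr (integrable_chiRatio_succ hm (hc j)).1
  have j2 : Integrable (fun z => z.2 / z.1 * h (z.1 / z.2)) ((chiSq (k + 2)).prod (chiSq n)) :=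
    (integral_div_mul_comp_ratio hm).1.mpr (integrable_chiRatio_succ hm (hc j)).2
  have j4 : Integrable (fun z => z.2 / z.1 * tailTransform n h (z.1 / z.2))
      ((chiSq (k + 2)).prod (chiSq n)) :=
    (integral_div_mul_comp_ratio hTm).1.mpr (integral_tailTransform hm (hc j)).1
  have s1 : ∫ z : ℝ × ℝ, (2 * h (z.1 / z.2) + 2 * (z.2 / z.1 * h (z.1 / z.2)) -
        n * (z.2 / z.1 * tailTransform n h (z.1 / z.2))) ∂((chiSq (k + 2)).prod (chiSq n)) =
      2 * ∫ z : ℝ × ℝ, h (z.1 / z.2) ∂((chiSq (k + 2)).prod (chiSq n)) +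
      2 * ∫ z : ℝ × ℝ, z.2 / z.1 * h (z.1 / z.2) ∂((chiSq (k + 2)).prod (chiSq n)) -
      n * ∫ z : ℝ × ℝ, z.2 / z.1 * tailTransform n h (z.1 / z.2)
        ∂((chiSq (k + 2)).prod (chiSq n)) := by
    have a1 : Integrable (fun z : ℝ × ℝ => 2 * h (z.1 / z.2) + 2 * (z.2 / z.1 * h (z.1 / z.2)))
      ((chiSq (k + 2)).prod (chiSq n)) := (j1.const_mul 2).add (j2.const_mul 2)
    rw [integral_sub a1 (j4.const_mul _), integral_add (j1.const_mul 2) (j2.const_mul 2),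
      integral_const_mul, integral_const_mul, integral_const_mul]
  rw [s1, integral_const_mul, (integral_comp_ratio hm).2, (integral_comp_ratio hm).2]
  have e2 := (integral_div_mul_comp_ratio (k := k) (n := n) hm).2
  have e3 := (integral_div_mul_comp_ratio (k := k) (n := n) hTm).2
  have e4 := (integral_tailTransform hm (hc j)).2
  have e5 := integral_chiRatio_add hm (hc j)
  refine mul_left_cancel₀ hk ?_
  rw [e4] at e3
  linear_combination 2 * e2 - n * e3 + 2 * e5

end tail

instance (d : ℕ) [NeZero d] (lam : ℝ≥0) : IsProbabilityMeasure (noncentralChiSq d lam) := by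
  refine ⟨?_⟩
  have h := lintegral_exp_noncentralChiSq d lam.2 (t := 0) (by norm_num)
  simpa using h

theorem isProbabilityMeasure_mixLaw {d n : ℕ} [NeZero d] [NeZero n] {lam : ℝ} (hl : 0 ≤ lam) :
    IsProbabilityMeasure (mixLaw d n lam) := by
  lift lam to ℝ≥0 using hl
  unfold mixLaw
  infer_instance

/-- Writing the degrees of freedom as `k + 2` with `k ≥ 1`, removal of the size bias gives `E[1/u] =
1/k ≤ 1`, uniformly over the mixture components. -/
theorem integrable_inv_fst_mixLaw {d n : ℕ} [NeZero n] (hd : 3 ≤ d) {lam : ℝ} (hl : 0 ≤ lam) :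
    Integrable (fun z => z.1⁻¹) (mixLaw d n lam) := by
  obtain ⟨d, rfl⟩ : ∃ d', d = d' + 2 := ⟨d - 2, by omega⟩
  have i1 : ∀ j, NeZero (d + 2 * j) := fun j => ⟨by omega⟩
  have i2 : NeZero (d + 2) := ⟨by omega⟩
  have hd2 : ∀ j, d + 2 + 2 * j = d + 2 * j + 2 := fun j => by ring
  have i3 : ∀ j, NeZero (d + 2 + 2 * j) := fun j => ⟨by omega⟩
  have key : ∀ j, Integrable (fun z : ℝ × ℝ => z.1⁻¹) ((chiSq (d + 2 + 2 * j)).prod (chiSq n)) ∧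
      ∫ z : ℝ × ℝ, ‖z.1⁻¹‖ ∂((chiSq (d + 2 + 2 * j)).prod (chiSq n)) ≤ 1 := by
    intro j
    have hae : (fun z : ℝ × ℝ => z.1 * z.1⁻¹) =ᵐ[(chiSq (d + 2 * j)).prod (chiSq n)]
        fun _ => (1 : ℝ) := by
      filter_upwards [ae_prod_chiSq_pos (d + 2 * j) n] with z hz
      exact mul_inv_cancel₀ hz.1.ne'
    have h := integral_fst_mul (k := d + 2 * j) (n := n) fun z => z.1⁻¹
    rw [integrable_congr hae, integral_congr_ae hae] at h
    have e : ∫ z : ℝ × ℝ, ‖z.1⁻¹‖ ∂((chiSq (d + 2 + 2 * j)).prod (chiSq n)) =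
        ∫ z : ℝ × ℝ, z.1⁻¹ ∂((chiSq (d + 2 + 2 * j)).prod (chiSq n)) := by
      refine integral_congr_ae ?_
      filter_upwards [ae_prod_chiSq_pos (d + 2 + 2 * j) n] with z hz
      exact Real.norm_of_nonneg (inv_nonneg.mpr hz.1.le)
    rw [e, hd2]
    refine ⟨h.1.mp (integrable_const _), ?_⟩
    have h2 := h.2
    simp only [integral_const, probReal_univ, smul_eq_mul, mul_one] at h2
    have h3 : 1 ≤ ((d + 2 * j : ℕ) : ℝ) := by exact_mod_cast (by omega : 1 ≤ d + 2 * j)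
    have h4 : 0 ≤ ∫ z : ℝ × ℝ, z.1⁻¹ ∂((chiSq (d + 2 * j + 2)).prod (chiSq n)) := by
      by_contra! hneg
      nlinarith
    nlinarith
  rw [integrable_mixLaw_iff hl fun j => (key j).1]
  refine Summable.of_nonneg_of_le (fun j => mul_nonneg (poissonWeight_nonneg hl j)
    (integral_nonneg fun z => norm_nonneg _)) (fun j => ?_) (hasSum_poissonWeight lam).summable
  exact mul_le_of_le_one_right (poissonWeight_nonneg hl j) (key j).2

/-! ### Moments under the sampling model and the unbiasedness identity. -/

section sample

variable {p n : ℕ} [NeZero p] [NeZero n] {θ : Fin p → ℝ} {v : ℝ≥0}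

theorem integrable_scaledStat_iff (hv : 0 < v) {G : ℝ × ℝ → ℝ} (hG : Measurable G) :
    Integrable (fun z => G (scaledStat v z)) (sampleLaw p n θ v) ↔
      Integrable G (mixLaw p n (θ ⬝ᵥ θ / (2 * v))) := by
  rw [← map_scaledStat θ hv, integrable_map_measure hG.aestronglyMeasurable
    (measurable_scaledStat v).aemeasurable]
  rfl

theorem integral_scaledStat (hv : 0 < v) {G : ℝ × ℝ → ℝ} (hG : Measurable G) :
    ∫ z, G (scaledStat v z) ∂(sampleLaw p n θ v) =
      ∫ y, G y ∂(mixLaw p n (θ ⬝ᵥ θ / (2 * v))) := by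
  rw [← map_scaledStat θ hv, integral_map (measurable_scaledStat v).aemeasurable
    hG.aestronglyMeasurable]

/-- Sum over the coordinates: each `xᵢ²` is the square of a linear form, taken with the sign that
makes its value at `θ` nonnegative. -/
theorem integrable_normSq_mul_scaledStat (hv : 0 < v) {G : ℝ × ℝ → ℝ} (hG : Measurable G)
    (h2 : Integrable G (mixLaw (p + 2) n (θ ⬝ᵥ θ / (2 * v))))
    (h4 : Integrable G (mixLaw (p + 4) n (θ ⬝ᵥ θ / (2 * v)))) :
    Integrable (fun z => (z.1 ⬝ᵥ z.1) * G (scaledStat v z)) (sampleLaw p n θ v) := by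
  have key : ∀ e : Fin p → ℝ, 0 ≤ e ⬝ᵥ θ →
      Integrable (fun z => (e ⬝ᵥ z.1) ^ 2 * G (scaledStat v z)) (sampleLaw p n θ v) := by
    intro e he
    have hm1 : Measurable fun z : (Fin p → ℝ) × ℝ => ENNReal.ofReal ((0 + e ⬝ᵥ z.1) ^ 2) := by
      simp only [dotProduct]; fun_prop
    have hmap := map_sampleLaw_withDensity_sq (n := n) θ hv e (le_refl 0) he
    have hi : Integrable G (((sampleLaw p n θ v).withDensity
        fun z => ENNReal.ofReal ((0 + e ⬝ᵥ z.1) ^ 2)).map (scaledStat v)) := by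
      rw [hmap]
      simp only [ne_eq, OfNat.ofNat_ne_zero, not_false_eq_true, zero_pow, ENNReal.ofReal_zero,
        zero_smul, zero_add]
      exact (h2.smul_measure ENNReal.ofReal_ne_top).add_measure
        (h4.smul_measure ENNReal.ofReal_ne_top)
    have hi2 := (integrable_map_measure hG.aestronglyMeasurable
      (measurable_scaledStat v).aemeasurable).mp hi
    rw [integrable_withDensity_iff_integrable_smul' hm1 (by simp)] at hi2
    simpa [ENNReal.toReal_ofReal, sq_nonneg] using hi2
  have key2 : ∀ i, Integrable (fun z => z.1 i * z.1 i * G (scaledStat v z)) (sampleLaw p n θ v) := by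
    intro i
    rcases le_total 0 (θ i) with h | h
    · simpa [sq] using key (Pi.single i 1) (by simpa using h)
    · simpa [sq] using key (-Pi.single i 1) (by simpa using h)
  have := integrable_finsetSum Finset.univ fun i _ => key2 i
  simpa only [dotProduct, Finset.sum_mul] using this

theorem ae_sampleLaw_pos (hv : 0 < v) :
    ∀ᵐ z ∂(sampleLaw p n θ v), 0 < z.1 ⬝ᵥ z.1 ∧ 0 < z.2 := by
  have h0v : (0 : ℝ) < v := hv
  have i1 : ∀ j, NeZero (p + 2 * j) := fun j => ⟨by have := NeZero.ne p; omega⟩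
  have h : ∀ᵐ y ∂(mixLaw p n (θ ⬝ᵥ θ / (2 * v))), 0 < y.1 ∧ 0 < y.2 := by
    rw [mixLaw_eq_sum, Measure.ae_sum_iff]
    exact fun j => (Measure.smul_absolutelyContinuous).ae_le (ae_prod_chiSq_pos (p + 2 * j) n)
  rw [← map_scaledStat θ hv] at h
  filter_upwards [ae_of_ae_map (measurable_scaledStat v).aemeasurable h] with z hz
  simp only [scaledStat] at hz
  constructor
  · exact (mul_pos_iff_of_pos_left (by positivity)).mp hz.1
  · exact (mul_pos_iff_of_pos_left (by positivity)).mp hz.2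

theorem scaledStat_div (hv : 0 < v) (z : (Fin p → ℝ) × ℝ) :
    (scaledStat v z).1 / (scaledStat v z).2 = statW z := by
  have h0v : (v : ℝ)⁻¹ ≠ 0 := inv_ne_zero (by exact_mod_cast hv.ne')
  simp only [scaledStat, statW, mul_div_mul_left _ _ h0v]

theorem scaledStat_div' (hv : 0 < v) (z : (Fin p → ℝ) × ℝ) :
    (scaledStat v z).2 / (scaledStat v z).1 = z.2 / (z.1 ⬝ᵥ z.1) := by
  have h0v : (v : ℝ)⁻¹ ≠ 0 := inv_ne_zero (by exact_mod_cast hv.ne')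
  simp only [scaledStat, mul_div_mul_left _ _ h0v]

/-- The function of `(‖X‖², S)` multiplying `X X'` in the unbiased estimator. -/
def rankOneCoeff (n : ℕ) (h : ℝ → ℝ) (z : ℝ × ℝ) : ℝ :=
  z.2 / z.1 * (2 * h (z.1 / z.2) - n * tailTransform n h (z.1 / z.2)) + h (z.1 / z.2) ^ 2

/-- The unbiased estimator of the risk reduction matrix, written with `h(w) = φ(w) / w`. -/
def unbiasedRed (n : ℕ) (h : ℝ → ℝ) (z : (Fin p → ℝ) × ℝ) : Matrix (Fin p) (Fin p) ℝ :=
  (z.2 * tailTransform n h (statW z)) • (1 : Matrix (Fin p) (Fin p) ℝ) -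
    rankOneCoeff n h (z.1 ⬝ᵥ z.1, z.2) • Matrix.vecMulVec z.1 z.1

theorem measurable_rankOneCoeff {h : ℝ → ℝ} (hm : Measurable h) : Measurable (rankOneCoeff n h) := by
  have h1 : Measurable fun z : ℝ × ℝ => h (z.1 / z.2) := hm.comp (by fun_prop)
  have h2 : Measurable fun z : ℝ × ℝ => tailTransform n h (z.1 / z.2) :=
    (measurable_tailTransform n hm).comp (by fun_prop)
  unfold rankOneCoeff
  fun_prop

theorem rankOneCoeff_scaledStat (hv : 0 < v) (h : ℝ → ℝ) (z : (Fin p → ℝ) × ℝ) :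
    rankOneCoeff n h (scaledStat v z) = rankOneCoeff n h (z.1 ⬝ᵥ z.1, z.2) := by
  simp only [rankOneCoeff, scaledStat_div hv, scaledStat_div' hv, statW]

/-- The integrability facts about `h(W)` that follow from finiteness of the risk. -/
structure StatIntegrable (p n : ℕ) (h : ℝ → ℝ) (θ : Fin p → ℝ) (v : ℝ≥0) : Prop where
  measurable : Measurable h
  ratio : ∀ j, Integrable h (chiRatio (p + 2 * j) n)
  sq : Integrable (fun z => (z.1 ⬝ᵥ z.1) * h (statW z) ^ 2) (sampleLaw p n θ v)

theorem noncentrality_nonneg (θ : Fin p → ℝ) (v : ℝ≥0) : 0 ≤ θ ⬝ᵥ θ / (2 * v) :=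
  div_nonneg (Finset.sum_nonneg fun i _ => mul_self_nonneg _) (by positivity)

namespace StatIntegrable

variable {h : ℝ → ℝ}

theorem measurable_ratio (hs : StatIntegrable p n h θ v) :
    Measurable fun z : ℝ × ℝ => h (z.1 / z.2) := hs.measurable.comp (by fun_prop)

theorem measurable_tail (hs : StatIntegrable p n h θ v) :
    Measurable fun z : ℝ × ℝ => tailTransform n h (z.1 / z.2) :=
  (measurable_tailTransform n hs.measurable).comp (by fun_prop)

theorem measurable_snd_mul_tail (hs : StatIntegrable p n h θ v) :
    Measurable fun z : ℝ × ℝ => z.2 * tailTransform n h (z.1 / z.2) :=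
  measurable_snd.mul hs.measurable_tail

/-- Finite risk controls only `‖X‖² h²`. The first moment of `h` follows from `|h| ≤ 1/u + u h²`,
and the inverse moment of `u` is finite because `p ≥ 3`. -/
theorem mix (hs : StatIntegrable p n h θ v) (hp : 3 ≤ p) (hv : 0 < v) :
    Integrable (fun z => h (z.1 / z.2)) (mixLaw p n (θ ⬝ᵥ θ / (2 * v))) := by
  have h0v : (0 : ℝ) < v := hv
  have hm := hs.measurable_ratio
  have h1 : Integrable (fun z : ℝ × ℝ => z.1 * h (z.1 / z.2) ^ 2)
      (mixLaw p n (θ ⬝ᵥ θ / (2 * v))) := by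
    have hm1 : Measurable fun z : ℝ × ℝ => z.1 * h (z.1 / z.2) ^ 2 :=
      measurable_fst.mul (hm.pow_const 2)
    rw [← integrable_scaledStat_iff hv hm1]
    refine (hs.sq.const_mul (v : ℝ)⁻¹).congr (ae_of_all _ fun z => ?_)
    simp only [scaledStat_div hv]
    simp only [scaledStat]
    ring
  have h2 := integrable_inv_fst_mixLaw (n := n) hp (noncentrality_nonneg θ v)
  have hpos : ∀ᵐ y ∂(mixLaw p n (θ ⬝ᵥ θ / (2 * v))), 0 < y.1 := by
    have i1 : ∀ j, NeZero (p + 2 * j) := fun j => ⟨by omega⟩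
    rw [mixLaw_eq_sum, Measure.ae_sum_iff]
    exact fun j => (Measure.smul_absolutelyContinuous).ae_le
      ((ae_prod_chiSq_pos (p + 2 * j) n).mono fun z hz => hz.1)
  refine (h2.add h1).mono hm.aestronglyMeasurable ?_
  filter_upwards [hpos] with z hz
  simp only [Pi.add_apply, Real.norm_eq_abs]
  refine le_trans ?_ (le_abs_self _)
  set a := h (z.1 / z.2)
  have : |a| * z.1 ≤ 1 + (z.1 * a) ^ 2 := by
    have h3 := sq_nonneg (|a| * z.1 - 1)
    have h4 : (|a| * z.1) ^ 2 = (z.1 * a) ^ 2 := by rw [mul_pow, sq_abs]; ring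
    nlinarith [abs_nonneg a]
  have h5 : z.1⁻¹ + z.1 * a ^ 2 = (1 + (z.1 * a) ^ 2) / z.1 := by field_simp
  rw [h5, le_div_iff₀ hz]
  exact this

theorem ratio_succ (hs : StatIntegrable p n h θ v) (j : ℕ) :
    Integrable h (chiRatio (p + 2 + 2 * j) n) := by
  have := hs.ratio (j + 1)
  rwa [show p + 2 * (j + 1) = p + 2 + 2 * j by ring] at this

end StatIntegrable

end sample

section sample

variable {p n : ℕ} [NeZero p] [NeZero n] {θ : Fin p → ℝ} {v : ℝ≥0}

/-- The measure weighted by `(e·x)²` dominates its component with `p + 2` degrees of freedom, whose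
weight `v ‖e‖²` is positive. The component with `p + 4` degrees of freedom cannot be reached in this
way when `θ = 0`. -/
theorem integrable_mixLaw_of_normSq (hv : 0 < v) {G : ℝ × ℝ → ℝ} (hG : Measurable G)
    (hi : Integrable (fun z => (z.1 ⬝ᵥ z.1) * G (scaledStat v z)) (sampleLaw p n θ v)) :
    Integrable G (mixLaw (p + 2) n (θ ⬝ᵥ θ / (2 * v))) := by
  have h0v : (0 : ℝ) < v := hv
  obtain ⟨e, he, hee⟩ : ∃ e : Fin p → ℝ, 0 ≤ e ⬝ᵥ θ ∧ 0 < e ⬝ᵥ e := by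
    rcases le_total 0 (θ 0) with h | h
    · exact ⟨Pi.single 0 1, by simpa using h, by simp⟩
    · exact ⟨-Pi.single 0 1, by simpa using h, by simp⟩
  have hm1 : Measurable fun z : (Fin p → ℝ) × ℝ => ENNReal.ofReal ((0 + e ⬝ᵥ z.1) ^ 2) := by
    simp only [dotProduct]; fun_prop
  have hmap := map_sampleLaw_withDensity_sq (n := n) θ hv e (le_refl 0) he
  have h1 := integrable_sq_mul (hG.comp (measurable_scaledStat v)).aestronglyMeasurable hi e
  have hi2 : Integrable G (((sampleLaw p n θ v).withDensity
      fun z => ENNReal.ofReal ((0 + e ⬝ᵥ z.1) ^ 2)).map (scaledStat v)) := by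
    rw [integrable_map_measure hG.aestronglyMeasurable (measurable_scaledStat v).aemeasurable,
      integrable_withDensity_iff_integrable_smul' hm1 (by simp)]
    simpa [ENNReal.toReal_ofReal, sq_nonneg] using h1
  rw [hmap] at hi2
  have h3 := (integrable_add_measure.mp (integrable_add_measure.mp hi2).1).2
  refine (integrable_smul_measure ?_ ENNReal.ofReal_ne_top).mp h3
  simp only [mul_zero, zero_mul, zero_add, ne_eq, ENNReal.ofReal_eq_zero, not_le]
  positivity

theorem integrable_normSq (hv : 0 < v) :
    Integrable (fun z => z.1 ⬝ᵥ z.1) (sampleLaw p n θ v) := by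
  have hl := noncentrality_nonneg θ v
  have i2 : NeZero (p + 2) := ⟨by omega⟩
  have i4 : NeZero (p + 4) := ⟨by omega⟩
  have := isProbabilityMeasure_mixLaw (d := p + 2) (n := n) hl
  have := isProbabilityMeasure_mixLaw (d := p + 4) (n := n) hl
  simpa using integrable_normSq_mul_scaledStat (n := n) (θ := θ) hv (G := fun _ => 1)
    measurable_const (integrable_const _) (integrable_const _)

theorem integral_coord (hv : 0 < v) (i : Fin p) :
    Integrable (fun z => z.1 i) (sampleLaw p n θ v) ∧ ∫ z, z.1 i ∂(sampleLaw p n θ v) = θ i := by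
  have hl := noncentrality_nonneg θ v
  have i2 : NeZero (p + 2) := ⟨by omega⟩
  have := isProbabilityMeasure_mixLaw (d := p + 2) (n := n) hl
  simpa using integral_coord_mul (n := n) θ hv (G := fun _ => 1) measurable_const
    (integrable_const _) (by simpa using integrable_normSq hv) i

theorem integral_coord_mul_coord (hv : 0 < v) (i k : Fin p) :
    Integrable (fun z => z.1 i * z.1 k) (sampleLaw p n θ v) ∧
    ∫ z, z.1 i * z.1 k ∂(sampleLaw p n θ v) =
      v * (1 : Matrix (Fin p) (Fin p) ℝ) i k + θ i * θ k := by
  have hl := noncentrality_nonneg θ v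
  have i2 : NeZero (p + 2) := ⟨by omega⟩
  have i4 : NeZero (p + 4) := ⟨by omega⟩
  have := isProbabilityMeasure_mixLaw (d := p + 2) (n := n) hl
  have := isProbabilityMeasure_mixLaw (d := p + 4) (n := n) hl
  constructor
  · simpa using integrable_coord_mul_coord_mul (H := fun _ => 1) aestronglyMeasurable_const
      (by simpa using integrable_normSq (n := n) hv) i k
  · simpa using integral_coord_mul_coord_mul (n := n) θ hv (G := fun _ => 1) measurable_const
      (by simpa using integrable_normSq hv) i k

namespace StatIntegrable

variable {h : ℝ → ℝ}

theorem integrable_h (hs : StatIntegrable p n h θ v) (hp : 3 ≤ p) (hv : 0 < v) :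
    Integrable (fun z => h (statW z)) (sampleLaw p n θ v) := by
  simpa only [scaledStat_div hv] using (integrable_scaledStat_iff hv hs.measurable_ratio).mpr
    (hs.mix hp hv)

theorem integrable_S_tail (hs : StatIntegrable p n h θ v) (hp : 3 ≤ p) (hv : 0 < v) :
    Integrable (fun z => z.2 * tailTransform n h (statW z)) (sampleLaw p n θ v) := by
  have h0v : (v : ℝ) ≠ 0 := by exact_mod_cast hv.ne'
  have h1 := (integrable_scaledStat_iff hv hs.measurable_snd_mul_tail).mpr
    (ratio_mixLaw_integrable (noncentrality_nonneg θ v) hs.measurable hs.ratio (hs.mix hp hv)).2.2.1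
  simp only [scaledStat_div hv] at h1
  refine (h1.const_mul (v : ℝ)).congr (ae_of_all _ fun z => ?_)
  simp only [scaledStat]
  field_simp

theorem mix_succ (hs : StatIntegrable p n h θ v) (hp : 3 ≤ p) (hv : 0 < v) :
    Integrable (fun z => h (z.1 / z.2)) (mixLaw (p + 2) n (θ ⬝ᵥ θ / (2 * v))) :=
  (ratio_mixLaw_integrable (noncentrality_nonneg θ v) hs.measurable hs.ratio (hs.mix hp hv)).1

theorem integrable_normSq_h (hs : StatIntegrable p n h θ v) (hp : 3 ≤ p) (hv : 0 < v) :
    Integrable (fun z => (z.1 ⬝ᵥ z.1) * h (statW z)) (sampleLaw p n θ v) := by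
  have hl := noncentrality_nonneg θ v
  have i2 : NeZero (p + 2) := ⟨by omega⟩
  have m2 := hs.mix_succ hp hv
  have m4 := (ratio_mixLaw_integrable hl hs.measurable hs.ratio_succ m2).1
  simpa only [scaledStat_div hv] using
    integrable_normSq_mul_scaledStat hv hs.measurable_ratio m2 m4

/-- The part of `rankOneCoeff` that is linear in `h`. -/
theorem integrable_normSq_linear (hs : StatIntegrable p n h θ v) (hp : 3 ≤ p) (hv : 0 < v) :
    Integrable (fun z => (z.1 ⬝ᵥ z.1) * (z.2 / (z.1 ⬝ᵥ z.1) *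
      (2 * h (statW z) - n * tailTransform n h (statW z)))) (sampleLaw p n θ v) := by
  have hl := noncentrality_nonneg θ v
  have i2 : NeZero (p + 2) := ⟨by omega⟩
  have r2 := ratio_mixLaw_integrable hl hs.measurable hs.ratio (hs.mix hp hv)
  have r4 := ratio_mixLaw_integrable hl hs.measurable hs.ratio_succ (hs.mix_succ hp hv)
  have e : ∀ z : ℝ × ℝ, z.2 / z.1 * (2 * h (z.1 / z.2) - n * tailTransform n h (z.1 / z.2)) =
      2 * (z.2 / z.1 * h (z.1 / z.2)) - n * (z.2 / z.1 * tailTransform n h (z.1 / z.2)) := by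
    intro z; ring
  have hm : Measurable fun z : ℝ × ℝ =>
      z.2 / z.1 * (2 * h (z.1 / z.2) - n * tailTransform n h (z.1 / z.2)) :=
    (measurable_snd.div measurable_fst).mul
      ((hs.measurable_ratio.const_mul 2).sub (hs.measurable_tail.const_mul _))
  have key := integrable_normSq_mul_scaledStat (θ := θ) hv hm
    (by simp only [e]; exact (r2.2.1.const_mul 2).sub (r2.2.2.2.const_mul _))
    (by simp only [e]; exact (r4.2.1.const_mul 2).sub (r4.2.2.2.const_mul _))
  simpa only [scaledStat_div hv, scaledStat_div' hv] using key

theorem integrable_normSq_rankOneCoeff (hs : StatIntegrable p n h θ v) (hp : 3 ≤ p) (hv : 0 < v) :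
    Integrable (fun z => (z.1 ⬝ᵥ z.1) * rankOneCoeff n h (scaledStat v z)) (sampleLaw p n θ v) := by
  refine ((hs.integrable_normSq_linear hp hv).add hs.sq).congr (ae_of_all _ fun z => ?_)
  simp only [Pi.add_apply]
  rw [rankOneCoeff_scaledStat hv]
  simp only [rankOneCoeff, statW]
  ring

theorem integrable_unbiasedRed (hs : StatIntegrable p n h θ v) (hp : 3 ≤ p) (hv : 0 < v)
    (i k : Fin p) : Integrable (fun z => unbiasedRed n h z i k) (sampleLaw p n θ v) := by
  have h1 := (hs.integrable_S_tail hp hv).mul_const ((1 : Matrix (Fin p) (Fin p) ℝ) i k)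
  have h2 := integrable_coord_mul_coord_mul ((measurable_rankOneCoeff hs.measurable).comp
    (measurable_scaledStat v)).aestronglyMeasurable (hs.integrable_normSq_rankOneCoeff hp hv) i k
  refine (h1.sub h2).congr (ae_of_all _ fun z => ?_)
  simp only [Function.comp, rankOneCoeff_scaledStat hv, unbiasedRed, Matrix.sub_apply,
    Matrix.smul_apply, smul_eq_mul, Matrix.vecMulVec_apply, Pi.sub_apply]
  ring

theorem integral_unbiasedRed (hs : StatIntegrable p n h θ v) (hp : 3 ≤ p) (hv : 0 < v)
    (i k : Fin p) :
    ∫ z, unbiasedRed n h z i k ∂(sampleLaw p n θ v) =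
      (1 : Matrix (Fin p) (Fin p) ℝ) i k *
        (v * ∫ z, z.2 * tailTransform n h (z.1 / z.2) ∂(mixLaw p n (θ ⬝ᵥ θ / (2 * v))) -
          v * ∫ z, rankOneCoeff n h z ∂(mixLaw (p + 2) n (θ ⬝ᵥ θ / (2 * v)))) -
      θ i * θ k * ∫ z, rankOneCoeff n h z ∂(mixLaw (p + 4) n (θ ⬝ᵥ θ / (2 * v))) := by
  have h0v : (v : ℝ) ≠ 0 := by exact_mod_cast hv.ne'
  have h1 := (hs.integrable_S_tail hp hv).mul_const ((1 : Matrix (Fin p) (Fin p) ℝ) i k)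
  have hrm := measurable_rankOneCoeff (n := n) hs.measurable
  have hu := hs.integrable_normSq_rankOneCoeff hp hv
  have h2 := integrable_coord_mul_coord_mul (hrm.comp
    (measurable_scaledStat v)).aestronglyMeasurable hu i k
  have e : ∀ z : (Fin p → ℝ) × ℝ, unbiasedRed n h z i k =
      z.2 * tailTransform n h (statW z) * (1 : Matrix (Fin p) (Fin p) ℝ) i k -
        z.1 i * z.1 k * (rankOneCoeff n h ∘ scaledStat v) z := by
    intro z
    simp only [Function.comp, rankOneCoeff_scaledStat hv, unbiasedRed, Matrix.sub_apply,
      Matrix.smul_apply, smul_eq_mul, Matrix.vecMulVec_apply]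
    ring
  have h3 : ∫ z, z.2 * tailTransform n h (statW z) ∂(sampleLaw p n θ v) =
      v * ∫ z, z.2 * tailTransform n h (z.1 / z.2) ∂(mixLaw p n (θ ⬝ᵥ θ / (2 * v))) := by
    rw [← integral_scaledStat hv hs.measurable_snd_mul_tail, ← integral_const_mul]
    refine integral_congr_ae (ae_of_all _ fun z => ?_)
    simp only [scaledStat_div hv]
    simp only [scaledStat]
    field_simp
  simp only [e]
  rw [integral_sub h1 h2, integral_mul_const, h3]
  have h4 := integral_coord_mul_coord_mul θ hv hrm hu i k
  simp only [Function.comp]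
  rw [h4]
  ring

/-- Unbiasedness: the identity of Stein type. -/
theorem integral_unbiasedRed_eq (hs : StatIntegrable p n h θ v) (hp : 3 ≤ p) (hv : 0 < v)
    (i k : Fin p) :
    ∫ z, unbiasedRed n h z i k ∂(sampleLaw p n θ v) =
      v * (1 : Matrix (Fin p) (Fin p) ℝ) i k -
        ∫ z, ((1 - h (statW z)) * z.1 i - θ i) * ((1 - h (statW z)) * z.1 k - θ k)
          ∂(sampleLaw p n θ v) := by
  have hl := noncentrality_nonneg θ v
  have h0v : (v : ℝ) ≠ 0 := by exact_mod_cast hv.ne'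
  have i2 : NeZero (p + 2) := ⟨by omega⟩
  have hrm := measurable_rankOneCoeff (n := n) hs.measurable
  have mh : AEStronglyMeasurable (fun z => h (statW z)) (sampleLaw p n θ v) := (hs.integrable_h hp hv).1
  have mh2 : AEStronglyMeasurable (fun z => h (statW z) ^ 2) (sampleLaw p n θ v) := mh.pow 2
  have uh := hs.integrable_normSq_h hp hv
  obtain ⟨ci, ei⟩ := integral_coord (n := n) (θ := θ) hv i
  obtain ⟨ck, ek⟩ := integral_coord (n := n) (θ := θ) hv k
  obtain ⟨cc, ec⟩ := integral_coord_mul_coord (n := n) (θ := θ) hv i k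
  have uh' : Integrable (fun z => (z.1 ⬝ᵥ z.1) *
      (fun y : ℝ × ℝ => h (y.1 / y.2)) (scaledStat v z)) (sampleLaw p n θ v) := by
    simpa only [scaledStat_div hv] using uh
  have h0' : Integrable (fun z => (fun y : ℝ × ℝ => h (y.1 / y.2)) (scaledStat v z)) (sampleLaw p n θ v) := by
    simpa only [scaledStat_div hv] using hs.integrable_h hp hv
  obtain ⟨hi1, hie⟩ := integral_coord_mul θ hv hs.measurable_ratio h0' uh' i
  obtain ⟨hk1, hke⟩ := integral_coord_mul θ hv hs.measurable_ratio h0' uh' k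
  simp only [scaledStat_div hv] at hi1 hie hk1 hke
  have hh := integrable_coord_mul_coord_mul mh uh i k
  have hh2 := integrable_coord_mul_coord_mul mh2 hs.sq i k
  -- the linear part
  set G : ℝ × ℝ → ℝ := fun z => 2 * h (z.1 / z.2) +
    z.2 / z.1 * (2 * h (z.1 / z.2) - n * tailTransform n h (z.1 / z.2)) with hG
  have hGm : Measurable G := (hs.measurable_ratio.const_mul 2).add
    ((measurable_snd.div measurable_fst).mul
      ((hs.measurable_ratio.const_mul 2).sub (hs.measurable_tail.const_mul _)))
  have uG : Integrable (fun z => (z.1 ⬝ᵥ z.1) * G (scaledStat v z)) (sampleLaw p n θ v) := by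
    refine ((uh.const_mul 2).add (hs.integrable_normSq_linear hp hv)).congr (ae_of_all _ fun z => ?_)
    simp only [hG, scaledStat_div hv, scaledStat_div' hv, Pi.add_apply]
    ring
  have gG := integral_coord_mul_coord_mul θ hv hGm uG i k
  have iG := integrable_coord_mul_coord_mul
    (hGm.comp (measurable_scaledStat v)).aestronglyMeasurable uG i k
  -- The function `G` is what remains of the coefficient of `XX'` once the terms `2h - h²` common to
  -- both sides are split off. In its second moments, `s2` cancels the scalar part evaluated by
  -- `s0`, and `s4` matches the cross terms between `θ` and `h X`.
  have s2 := integral_stein_mixLaw hl hs.measurable hs.ratio (hs.mix hp hv)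
  have s4 := integral_stein_mixLaw hl hs.measurable hs.ratio_succ (hs.mix_succ hp hv)
  have s0 := integral_snd_mul_tailTransform_mixLaw hl hs.measurable hs.ratio (hs.mix hp hv)
  have hST := hs.integrable_S_tail hp hv
  have eST : ∫ z, z.2 * tailTransform n h (statW z) ∂(sampleLaw p n θ v) =
      v * ∫ z, z.2 * tailTransform n h (z.1 / z.2) ∂(mixLaw p n (θ ⬝ᵥ θ / (2 * v))) := by
    rw [← integral_scaledStat hv hs.measurable_snd_mul_tail,
      ← integral_const_mul]
    refine integral_congr_ae (ae_of_all _ fun z => ?_)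
    simp only [scaledStat_div hv]
    simp only [scaledStat]
    field_simp
  have lhs : ∀ z : (Fin p → ℝ) × ℝ, unbiasedRed n h z i k =
      (z.2 * tailTransform n h (statW z) * (1 : Matrix (Fin p) (Fin p) ℝ) i k -
        z.1 i * z.1 k * (G ∘ scaledStat v) z) +
      (2 * (z.1 i * z.1 k * h (statW z)) - z.1 i * z.1 k * h (statW z) ^ 2) := by
    intro z
    simp only [hG, Function.comp, scaledStat_div hv, scaledStat_div' hv, unbiasedRed,
      rankOneCoeff, Matrix.sub_apply, Matrix.smul_apply, smul_eq_mul, Matrix.vecMulVec_apply, statW]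
    ring
  have rhs : ∀ z : (Fin p → ℝ) × ℝ,
      ((1 - h (statW z)) * z.1 i - θ i) * ((1 - h (statW z)) * z.1 k - θ k) =
      ((z.1 i * z.1 k - θ k * z.1 i) - (θ i * z.1 k - θ i * θ k)) +
      (θ k * (z.1 i * h (statW z)) + θ i * (z.1 k * h (statW z))) -
      (2 * (z.1 i * z.1 k * h (statW z)) - z.1 i * z.1 k * h (statW z) ^ 2) := by
    intro z; ring
  simp only [lhs, rhs]
  have iA : Integrable (fun z : (Fin p → ℝ) × ℝ =>
      z.2 * tailTransform n h (statW z) * (1 : Matrix (Fin p) (Fin p) ℝ) i k -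
        z.1 i * z.1 k * (G ∘ scaledStat v) z) (sampleLaw p n θ v) := (hST.mul_const _).sub iG
  have iB : Integrable (fun z : (Fin p → ℝ) × ℝ =>
      2 * (z.1 i * z.1 k * h (statW z)) - z.1 i * z.1 k * h (statW z) ^ 2) (sampleLaw p n θ v) :=
    (hh.const_mul 2).sub hh2
  have iC : Integrable (fun z : (Fin p → ℝ) × ℝ => z.1 i * z.1 k - θ k * z.1 i) (sampleLaw p n θ v) :=
    cc.sub (ci.const_mul _)
  have iD : Integrable (fun z : (Fin p → ℝ) × ℝ => θ i * z.1 k - θ i * θ k) (sampleLaw p n θ v) :=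
    (ck.const_mul _).sub (integrable_const _)
  have iE : Integrable (fun z : (Fin p → ℝ) × ℝ =>
      θ k * (z.1 i * h (statW z)) + θ i * (z.1 k * h (statW z))) (sampleLaw p n θ v) :=
    (hi1.const_mul _).add (hk1.const_mul _)
  have iF : Integrable (fun z : (Fin p → ℝ) × ℝ =>
      (z.1 i * z.1 k - θ k * z.1 i) - (θ i * z.1 k - θ i * θ k)) (sampleLaw p n θ v) := iC.sub iD
  have iH : Integrable (fun z : (Fin p → ℝ) × ℝ =>
      ((z.1 i * z.1 k - θ k * z.1 i) - (θ i * z.1 k - θ i * θ k)) +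
      (θ k * (z.1 i * h (statW z)) + θ i * (z.1 k * h (statW z)))) (sampleLaw p n θ v) := iF.add iE
  rw [integral_add iA iB, integral_sub iH iB, integral_add iF iE, integral_sub iC iD,
    integral_sub cc (ci.const_mul _), integral_sub (ck.const_mul _) (integrable_const _),
    integral_add (hi1.const_mul _) (hk1.const_mul _), integral_sub (hST.mul_const _) iG,
    integral_mul_const, integral_const_mul, integral_const_mul, integral_const_mul,
    integral_const_mul, integral_const_mul, eST, s0, ei, ek, ec, hie, hke]
  simp only [Function.comp, integral_const, probReal_univ, one_smul]
  rw [gG, s2, s4]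
  ring

end StatIntegrable

end sample

/-! ### Integration by parts on half-lines and the calculus of `g₁` and `g₂`. -/

/-- A nonzero limit would make `1/t` integrable near infinity. This and its analogue at `0` remove
boundary terms without any growth assumption on `φ`. -/
theorem eq_zero_of_tendsto_atTop_of_integrableOn {F : ℝ → ℝ} {L a : ℝ}
    (hF : Tendsto F atTop (𝓝 L)) (hi : IntegrableOn (fun t => F t / t) (Ioi a)) : L = 0 := by
  by_contra hL
  have hL' : |L| / 2 < |L| := by have := abs_pos.mpr hL; linarith
  have hev := (hF.abs.eventually (lt_mem_nhds hL')).and (eventually_gt_atTop (max a 0))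
  obtain ⟨b, hb⟩ := eventually_atTop.mp hev
  have hab : a ≤ b := (le_max_left _ _).trans (hb b le_rfl).2.le
  refine not_integrableOn_Ioi_inv (a := b) ?_
  refine Integrable.mono' ((hi.mono_set (Ioi_subset_Ioi hab)).norm.const_mul (2 / |L|))
    measurable_inv.aestronglyMeasurable ?_
  refine (ae_restrict_iff' measurableSet_Ioi).mpr (ae_of_all _ fun t ht => ?_)
  obtain ⟨h1, h2⟩ := hb t (le_of_lt ht)
  have ht0 : 0 < t := (le_max_right _ _).trans_lt h2
  rw [Real.norm_eq_abs, Real.norm_eq_abs, abs_inv, abs_div, abs_of_pos ht0]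
  have h3 := abs_pos.mpr hL
  rw [inv_eq_one_div, ← mul_div_assoc]
  gcongr
  rw [div_mul_eq_mul_div, le_div_iff₀ h3]
  linarith

theorem eq_zero_of_tendsto_zero_of_integrableOn {F : ℝ → ℝ} {L : ℝ}
    (hF : Tendsto F (𝓝[>] 0) (𝓝 L)) (hi : IntegrableOn (fun t => F t / t) (Ioi 0)) : L = 0 := by
  by_contra hL
  have hL' : |L| / 2 < |L| := by have := abs_pos.mpr hL; linarith
  have hev := hF.abs.eventually (lt_mem_nhds hL')
  obtain ⟨b, hb0, hb⟩ := (mem_nhdsGT_iff_exists_Ioo_subset).mp hev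
  have hb0 : 0 < b := hb0
  have hni : ¬ IntervalIntegrable (fun x : ℝ => x⁻¹) volume 0 b := by
    rw [intervalIntegrable_inv_iff, uIcc_of_le hb0.le]
    push Not
    exact ⟨hb0.ne, left_mem_Icc.mpr hb0.le⟩
  refine hni ((intervalIntegrable_iff_integrableOn_Ioo_of_le hb0.le).mpr ?_)
  refine Integrable.mono' ((hi.mono_set Ioo_subset_Ioi_self).norm.const_mul (2 / |L|))
    measurable_inv.aestronglyMeasurable ?_
  refine (ae_restrict_iff' measurableSet_Ioo).mpr (ae_of_all _ fun t ht => ?_)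
  have h1 : |L| / 2 < |F t| := hb ht
  have ht0 : 0 < t := ht.1
  rw [Real.norm_eq_abs, Real.norm_eq_abs, abs_inv, abs_div, abs_of_pos ht0]
  have h3 := abs_pos.mpr hL
  rw [inv_eq_one_div, ← mul_div_assoc]
  gcongr
  rw [div_mul_eq_mul_div, le_div_iff₀ h3]
  linarith

/-- The fundamental theorem of calculus on `(a, ∞)`, where the boundary term at infinity vanishes
because `F t / t` is integrable. -/
theorem integral_Ioi_of_hasDerivAt_off_countable {F F' : ℝ → ℝ} {a : ℝ} {D : Set ℝ}
    (hD : D.Countable) (hc : ContinuousOn F (Ici a))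
    (hd : ∀ t, a < t → t ∉ D → HasDerivAt F (F' t) t) (hi' : IntegrableOn F' (Ioi a))
    (hi : IntegrableOn (fun t => F t / t) (Ioi a)) : ∫ t in Ioi a, F' t = -F a := by
  have h1 := intervalIntegral_tendsto_integral_Ioi a hi' tendsto_id
  have h2 : ∀ b, a ≤ b → ∫ t in a..b, F' t = F b - F a := fun b hb =>
    integral_eq_of_hasDerivAt_off_countable_of_le F F' hb hD (hc.mono Icc_subset_Ici_self)
      (fun t ht => hd t ht.1.1 ht.2)
      ((intervalIntegrable_iff_integrableOn_Ioc_of_le hb).mpr (hi'.mono_set Ioc_subset_Ioi_self))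
  have h3 : Tendsto F atTop (𝓝 ((∫ t in Ioi a, F' t) + F a)) := by
    refine (h1.add_const (F a)).congr' ?_
    filter_upwards [eventually_ge_atTop a] with b hb
    simp only [id, h2 b hb]
    ring
  have := eq_zero_of_tendsto_atTop_of_integrableOn h3 hi
  linarith

theorem integral_Ioi_zero_of_hasDerivAt_off_countable {F F' : ℝ → ℝ} {D : Set ℝ}
    (hD : D.Countable) (hc : ContinuousOn F (Ioi 0))
    (hd : ∀ t, 0 < t → t ∉ D → HasDerivAt F (F' t) t) (hi' : IntegrableOn F' (Ioi 0))
    (hi : IntegrableOn (fun t => F t / t) (Ioi 0)) : ∫ t in Ioi 0, F' t = 0 := by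
  have h1 : ∀ a, 0 < a → ∫ t in Ioi a, F' t = -F a := fun a ha =>
    integral_Ioi_of_hasDerivAt_off_countable hD (hc.mono (Ici_subset_Ioi.mpr ha))
      (fun t ht => hd t (ha.trans ht)) (hi'.mono_set (Ioi_subset_Ioi ha.le))
      (hi.mono_set (Ioi_subset_Ioi ha.le))
  have h2 : Tendsto (fun a : ℝ => ∫ t in Ioi a, F' t) (𝓝[>] 0) (𝓝 (∫ t in Ioi 0, F' t)) := by
    have hcov : AECover (volume.restrict (Ioi (0 : ℝ))) (𝓝[>] (0 : ℝ)) fun a => Ioi a :=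
      aecover_Ioi_of_Ioi (tendsto_nhdsWithin_of_tendsto_nhds tendsto_id)
    refine (hcov.integral_tendsto_of_countably_generated hi').congr' ?_
    filter_upwards [self_mem_nhdsWithin] with a ha
    rw [Measure.restrict_restrict measurableSet_Ioi,
      inter_eq_self_of_subset_left (Ioi_subset_Ioi (le_of_lt ha))]
  have h3 : Tendsto F (𝓝[>] 0) (𝓝 (-∫ t in Ioi 0, F' t)) := by
    refine h2.neg.congr' ?_
    filter_upwards [self_mem_nhdsWithin] with a ha
    rw [h1 a ha, neg_neg]
  exact neg_eq_zero.mp (eq_zero_of_tendsto_zero_of_integrableOn h3 hi)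

/-- The weight `t ^ (-n/2 - 1)` divided by the ratio density is a constant times `(1 + 1/t) ^ ((k +
n)/2)`, which is bounded on `(w, ∞)`. -/
theorem integrableOn_rpow_mul_of_chiRatio {k n : ℕ} [NeZero k] [NeZero n] {F : ℝ → ℝ}
    (hi : Integrable F (chiRatio k n)) {w : ℝ} (hw : 0 < w) :
    IntegrableOn (fun t => t ^ (-((n : ℝ) / 2)) * (F t / t)) (Ioi w) := by
  have hk : 0 < (k : ℝ) := by have := NeZero.pos k; positivity
  have hn : 0 < (n : ℝ) := by have := NeZero.pos n; positivity
  rw [integrable_chiRatio_iff] at hi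
  have h1 := Real.Gamma_pos_of_pos (s := ((k : ℝ) + n) / 2) (by positivity)
  have h2 := Real.Gamma_pos_of_pos (s := (k : ℝ) / 2) (by positivity)
  have h3 := Real.Gamma_pos_of_pos (s := (n : ℝ) / 2) (by positivity)
  set c := Real.Gamma (((k : ℝ) + n) / 2) /
    (Real.Gamma ((k : ℝ) / 2) * Real.Gamma ((n : ℝ) / 2)) with hc
  have hc0 : 0 < c := by positivity
  have hi2 := hi.mono_set (Ioi_subset_Ioi hw.le)
  set r : ℝ → ℝ := fun t => t ^ (-((n : ℝ) / 2)) / t / ratioDensity k n t with hr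
  have hrm : Measurable r := by
    have := measurable_ratioDensity k n
    fun_prop
  have e : ∀ t ∈ Ioi w, r t * (ratioDensity k n t * F t) = t ^ (-((n : ℝ) / 2)) * (F t / t) := by
    intro t ht
    have := (ratioDensity_pos k n (hw.trans ht)).ne'
    simp only [hr]
    field_simp
  refine IntegrableOn.congr_fun ?_ e measurableSet_Ioi
  refine Integrable.bdd_mul (c := (1 + w⁻¹) ^ (((k : ℝ) + n) / 2) / c) hi2
    hrm.aestronglyMeasurable ?_
  refine (ae_restrict_iff' measurableSet_Ioi).mpr (ae_of_all _ fun t ht => ?_)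
  have ht' : w < t := ht
  have ht0 : 0 < t := hw.trans ht
  rw [Real.norm_of_nonneg (div_nonneg (by positivity) (ratioDensity_pos k n ht0).le)]
  have e1 : r t = (1 + t⁻¹) ^ (((k : ℝ) + n) / 2) / c := by
    have e2 : (1 : ℝ) + t⁻¹ = (1 + t) / t := by field_simp; ring
    simp only [hr, ratioDensity]
    rw [← hc, e2, Real.div_rpow (by positivity) ht0.le, Real.rpow_neg (by positivity : (0:ℝ) ≤ 1 + t),
      Real.rpow_sub_one ht0.ne', Real.rpow_neg ht0.le, add_div, Real.rpow_add ht0]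
    field_simp
  change r t ≤ _
  rw [e1]
  gcongr

section phi

variable {φ : ℝ → ℝ}

/-- The function `φ(w) / w`, cut off to `(0, ∞)`. -/
def shrinkFactor (φ : ℝ → ℝ) : ℝ → ℝ := (Ioi 0).indicator fun w => φ w / w

theorem shrinkFactor_of_pos {w : ℝ} (hw : 0 < w) : shrinkFactor φ w = φ w / w :=
  indicator_of_mem (show w ∈ Ioi 0 from hw) _

theorem measurable_shrinkFactor (hc : ContinuousOn φ (Ioi 0)) : Measurable (shrinkFactor φ) := by
  have h1 : ContinuousOn (fun w => φ w / w) (Ioi 0) :=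
    hc.div continuousOn_id fun w hw => (ne_of_gt hw)
  classical
  rw [shrinkFactor, ← piecewise_eq_indicator]
  exact h1.measurable_piecewise (g := 0) continuousOn_const measurableSet_Ioi

theorem integrable_shrinkFactor_iff {k n : ℕ} [NeZero k] [NeZero n] :
    Integrable (shrinkFactor φ) (chiRatio k n) ↔ Integrable (fun w => φ w / w) (chiRatio k n) :=
  integrable_congr <| (ae_chiRatio_pos k n).mono fun _ hw => shrinkFactor_of_pos hw

theorem tailTransform_congr {n : ℕ} {h h' : ℝ → ℝ} (he : ∀ t, 0 < t → h t = h' t) {w : ℝ}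
    (hw : 0 < w) : tailTransform n h w = tailTransform n h' w := by
  simp only [tailTransform]
  congr 1
  refine setIntegral_congr_fun measurableSet_Ioi fun t ht => ?_
  simp only [he t (hw.trans ht)]

theorem g₁_eq {n : ℕ} {w : ℝ} (hw : 0 < w) : g₁ n φ w = tailTransform n (shrinkFactor φ) w :=
  tailTransform_congr (fun _ ht => (shrinkFactor_of_pos ht).symm) hw

section calculus

variable {k n : ℕ} [NeZero k] [NeZero n] {D : Set ℝ}

/-- Integrate the derivative of `t ^ (-n/2) φ(t) / t` over `(w, ∞)`; the boundary term at infinity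
vanishes. This eliminates `deriv φ` from the estimator. -/
theorem g₂_eq (hc : ContinuousOn φ (Ioi 0)) (hD : D.Countable)
    (hd : ∀ w, 0 < w → w ∉ D → DifferentiableAt ℝ φ w)
    (h1 : Integrable (fun w => φ w / w) (chiRatio k n)) (h3 : Integrable (deriv φ) (chiRatio k n))
    {w : ℝ} (hw : 0 < w) : g₂ n φ w = 2 * (φ w / w) - n * g₁ n φ w := by
  set m := (n : ℝ) / 2 with hm
  have i1 := integrableOn_rpow_mul_of_chiRatio h1 hw
  have i3 := integrableOn_rpow_mul_of_chiRatio h3 hw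
  rw [← hm] at i1 i3
  have key := integral_Ioi_of_hasDerivAt_off_countable (F := fun t => t ^ (-m) * (φ t / t))
    (F' := fun t => t ^ (-m) * (deriv φ t / t) - (m + 1) * (t ^ (-m) * (φ t / t / t)))
    (a := w) hD
    ((continuousOn_id.rpow_const fun t ht => Or.inl (hw.trans_le ht).ne').mul
      ((hc.mono (Ici_subset_Ioi.mpr hw)).div continuousOn_id fun t ht => (hw.trans_le ht).ne'))
    (fun t ht htD => by
      have ht0 : 0 < t := hw.trans ht
      have d1 := (hd t ht0 htD).hasDerivAt
      have d2 := Real.hasDerivAt_rpow_const (x := t) (p := -m) (Or.inl ht0.ne')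
      refine (d2.mul (d1.div (hasDerivAt_id t) ht0.ne')).congr_deriv ?_
      rw [Real.rpow_sub_one ht0.ne']
      simp only [id, Pi.div_apply]
      field_simp
      ring)
    (i3.sub (i1.const_mul _))
    (i1.congr_fun (fun t ht => by ring) measurableSet_Ioi)
  rw [integral_sub i3 (i1.const_mul _), integral_const_mul] at key
  have e2 : ∫ t in Ioi w, t ^ (-m) * (2 * (φ t / t - deriv φ t) / t) =
      2 * (∫ t in Ioi w, t ^ (-m) * (φ t / t / t)) - 2 * ∫ t in Ioi w, t ^ (-m) * (deriv φ t / t) := by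
    rw [← integral_const_mul, ← integral_const_mul,
      ← integral_sub (i1.const_mul 2) (i3.const_mul 2)]
    refine integral_congr_ae (ae_of_all _ fun t => ?_)
    simp only
    ring
  have hww : w ^ m * w ^ (-m) = 1 := by rw [← Real.rpow_add hw]; simp
  have hn2 : (n : ℝ) = 2 * m := by rw [hm]; ring
  rw [g₂, g₁, tailTransform, tailTransform, ← hm, e2, hn2]
  linear_combination 2 * w ^ m * key * (-1) + 2 * (φ w / w) * hww

/-- By `g₂_eq` the derivative is `-g₂ / (2w)`, so monotonicity of `g₁` is a sign condition on `g₂`.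
-/
theorem hasDerivAt_g₁ (hc : ContinuousOn φ (Ioi 0))
    (h1 : Integrable (fun w => φ w / w) (chiRatio k n)) {w : ℝ} (hw : 0 < w) :
    HasDerivAt (g₁ n φ) ((n * g₁ n φ w - 2 * (φ w / w)) / (2 * w)) w := by
  set m := (n : ℝ) / 2 with hm
  set L : ℝ → ℝ := fun t => t ^ (-m) * (φ t / t / t) with hL
  have hw2 : 0 < w / 2 := half_pos hw
  have i1 : IntegrableOn L (Ioi (w / 2)) := integrableOn_rpow_mul_of_chiRatio h1 hw2
  have hLc : ContinuousOn L (Ioi 0) :=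
    (continuousOn_id.rpow_const fun t ht => Or.inl (ne_of_gt ht)).mul
      ((hc.div continuousOn_id fun t ht => ne_of_gt ht).div continuousOn_id fun t ht => ne_of_gt ht)
  have d1 : HasDerivAt (fun y => ∫ t in (w / 2)..y, L t) (L w) w := by
    refine intervalIntegral.integral_hasDerivAt_right ?_ ?_ (hLc.continuousAt (Ioi_mem_nhds hw))
    · exact (intervalIntegrable_iff_integrableOn_Ioc_of_le (by linarith)).mpr
        (i1.mono_set Ioc_subset_Ioi_self)
    · exact hLc.stronglyMeasurableAtFilter isOpen_Ioi w hw
  have e : ∀ y, w / 2 < y → ∫ t in Ioi y, L t =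
      (∫ t in Ioi (w / 2), L t) - ∫ t in (w / 2)..y, L t := by
    intro y hy
    rw [eq_sub_iff_add_eq, add_comm]
    exact intervalIntegral.integral_interval_add_Ioi' (by
      exact (intervalIntegrable_iff_integrableOn_Ioc_of_le hy.le).mpr
        (i1.mono_set Ioc_subset_Ioi_self)) (i1.mono_set (Ioi_subset_Ioi hy.le))
  have d2 : HasDerivAt (fun y => ∫ t in Ioi y, L t) (-L w) w := by
    refine (d1.const_sub (∫ t in Ioi (w / 2), L t)).congr_of_eventuallyEq ?_
    filter_upwards [Ioi_mem_nhds (half_lt_self hw)] with y hy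
    exact e y hy
  have d3 := Real.hasDerivAt_rpow_const (x := w) (p := m) (Or.inl hw.ne')
  refine (d3.mul d2).congr_deriv ?_
  have hww : w ^ m * w ^ (-m) = 1 := by rw [← Real.rpow_add hw]; simp
  have hn2 : (n : ℝ) = 2 * m := by rw [hm]; ring
  rw [g₁, tailTransform, ← hm, hn2, Real.rpow_sub_one hw.ne']
  simp only [hL]
  field_simp
  linear_combination -(φ w) * hww

theorem g₂_nonneg (hc : ContinuousOn φ (Ioi 0)) (hD : D.Countable)
    (hd : ∀ w, 0 < w → w ∉ D → DifferentiableAt ℝ φ w)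
    (h1 : Integrable (fun w => φ w / w) (chiRatio k n)) (h3 : Integrable (deriv φ) (chiRatio k n))
    (hg : AntitoneOn (g₁ n φ) (Ioi 0)) {w : ℝ} (hw : 0 < w) : 0 ≤ g₂ n φ w := by
  have hder := hasDerivAt_g₁ hc h1 hw
  have hle : derivWithin (g₁ n φ) (Ioi 0) w ≤ 0 := hg.derivWithin_nonpos
  rw [derivWithin_of_mem_nhds (Ioi_mem_nhds hw), hder.deriv, div_le_iff₀ (by positivity)] at hle
  rw [g₂_eq hc hD hd h1 h3 hw]
  linarith

/-- Integration by parts against the density of the ratio law. -/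
theorem integral_sq_div_chiRatio (hc : ContinuousOn φ (Ioi 0)) (hD : D.Countable)
    (hd : ∀ w, 0 < w → w ∉ D → DifferentiableAt ℝ φ w)
    (h2 : Integrable (fun w => φ w ^ 2 / w) (chiRatio k n))
    (h4 : Integrable (fun w => φ w * deriv φ w) (chiRatio k n)) :
    n * ∫ w, φ w ^ 2 / w ∂(chiRatio k (n + 2)) =
      ∫ w, ((n + 2) * (φ w ^ 2 / w) - 4 * (φ w * deriv φ w)) ∂(chiRatio k n) := by
  have hk : 0 < (k : ℝ) := by have := NeZero.pos k; positivity
  have hn : 0 < (n : ℝ) := by have := NeZero.pos n; positivity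
  have i2 : NeZero (n + 2) := ⟨by omega⟩
  have j2 := integrable_chiRatio_iff.mp h2
  have j4 := integrable_chiRatio_iff.mp h4
  set f := ratioDensity k n with hf
  have hfd : ∀ t, 0 < t → HasDerivAt f (f t * (((k : ℝ) / 2 - 1) / t - ((k + n) / 2) / (1 + t))) t := by
    intro t ht
    have ht1 : 0 < 1 + t := by linarith
    have d1 := Real.hasDerivAt_rpow_const (x := t) (p := (k : ℝ) / 2 - 1) (Or.inl ht.ne')
    have d2 := ((hasDerivAt_id t).const_add 1).rpow_const (p := -(((k : ℝ) + n) / 2))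
      (Or.inl ht1.ne')
    refine ((d1.mul d2).const_mul (Real.Gamma (((k : ℝ) + n) / 2) /
      (Real.Gamma ((k : ℝ) / 2) * Real.Gamma ((n : ℝ) / 2)))).congr_deriv ?_
    simp only [id]
    rw [hf, ratioDensity, Real.rpow_sub_one ht.ne' ((k : ℝ) / 2 - 1), Real.rpow_sub_one ht1.ne']
    field_simp
    ring
  have hfc : ContinuousOn f (Ioi 0) := fun t ht => (hfd t ht).continuousAt.continuousWithinAt
  have hprod : ∀ w ∈ Ioi (0 : ℝ), n * (ratioDensity k (n + 2) w * (φ w ^ 2 / w)) =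
      (k + n) * (1 + w)⁻¹ * (f w * (φ w ^ 2 / w)) := by
    intro w hw
    rw [← mul_assoc, mul_ratioDensity_right k n hw]
    ring
  have jA : IntegrableOn (fun w => (k + n) * (1 + w)⁻¹ * (f w * (φ w ^ 2 / w))) (Ioi 0) := by
    refine Integrable.bdd_mul (c := (k : ℝ) + n) j2 (by fun_prop) ?_
    refine (ae_restrict_iff' measurableSet_Ioi).mpr (ae_of_all _ fun t ht => ?_)
    have ht : 0 < t := ht
    rw [Real.norm_of_nonneg (by positivity)]
    refine mul_le_of_le_one_right (by positivity) (inv_le_one_of_one_le₀ (by linarith))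
  have jB : IntegrableOn (fun t => f t * ((n + 2) * (φ t ^ 2 / t) - 4 * (φ t * deriv φ t))) (Ioi 0) :=
    ((j2.const_mul ((n : ℝ) + 2)).sub (j4.const_mul 4)).congr
      (ae_of_all _ fun t => by simp only [Pi.sub_apply]; ring)
  have jC : IntegrableOn (fun t => (1 / 2) * ((k + n) * (1 + t)⁻¹ * (f t * (φ t ^ 2 / t))) -
      (1 / 2) * (f t * ((n + 2) * (φ t ^ 2 / t) - 4 * (φ t * deriv φ t)))) (Ioi 0) :=
    (jA.const_mul (1 / 2)).sub (jB.const_mul (1 / 2))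
  -- Total derivative of `f φ²`, where `f` is the ratio density. Expanding `1 / (t (1 + t))` in
  -- partial fractions puts `f'` in this form, and integrability of `f φ² / t` kills both boundary
  -- terms.
  have key := integral_Ioi_zero_of_hasDerivAt_off_countable (F := fun t => f t * φ t ^ 2)
    (F' := fun t => (1 / 2) * ((k + n) * (1 + t)⁻¹ * (f t * (φ t ^ 2 / t))) -
      (1 / 2) * (f t * ((n + 2) * (φ t ^ 2 / t) - 4 * (φ t * deriv φ t)))) hD
    (hfc.mul (hc.pow 2))
    (fun t ht htD => by
      have ht1 : 1 + t ≠ 0 := by positivity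
      have d1 := (hd t ht htD).hasDerivAt
      refine ((hfd t ht).mul (d1.pow 2)).congr_deriv ?_
      simp only [Nat.cast_ofNat, Nat.add_one_sub_one, pow_one, Pi.pow_apply]
      field_simp
      ring)
    jC
    (j2.congr_fun (fun t ht => by ring) measurableSet_Ioi)
  rw [integral_sub (jA.const_mul _) (jB.const_mul _), integral_const_mul, integral_const_mul] at key
  rw [integral_chiRatio, integral_chiRatio, ← integral_const_mul,
    setIntegral_congr_fun measurableSet_Ioi hprod]
  linarith

end calculus

end phi

instance isProbabilityMeasure_chiRatio (k n : ℕ) [NeZero k] [NeZero n] :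
    IsProbabilityMeasure (chiRatio k n) :=
  Measure.isProbabilityMeasure_map (by fun_prop)

/-! ### Stochastic monotonicity of the ratio laws -/

/-- The difference of the two densities has the sign of `n w - k`. Subtracting the value of `ψ` at
the crossing point `k/n` makes the comparison pointwise, and the constant does not matter because
both laws have mass one. -/
theorem integral_chiRatio_succ_le {k n : ℕ} [NeZero k] [NeZero n] {ψ : ℝ → ℝ}
    (hψ : AntitoneOn ψ (Ioi 0)) (h0 : Integrable ψ (chiRatio k n))
    (h1 : Integrable ψ (chiRatio (k + 2) n)) :
    ∫ w, ψ w ∂(chiRatio (k + 2) n) ≤ ∫ w, ψ w ∂(chiRatio k n) := by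
  have hk : 0 < (k : ℝ) := by have := NeZero.pos k; positivity
  have hn : 0 < (n : ℝ) := by have := NeZero.pos n; positivity
  have i1 : NeZero (k + 2) := ⟨by omega⟩
  set c := ψ (k / n) with hc
  have hcpos : (0 : ℝ) < k / n := by positivity
  have a0 : Integrable (fun w => ψ w - c) (chiRatio k n) := h0.sub (integrable_const _)
  have a1 : Integrable (fun w => ψ w - c) (chiRatio (k + 2) n) := h1.sub (integrable_const _)
  have key : ∫ w, (ψ w - c) ∂(chiRatio (k + 2) n) ≤ ∫ w, (ψ w - c) ∂(chiRatio k n) := by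
    rw [integral_chiRatio, integral_chiRatio]
    refine setIntegral_mono_on (integrable_chiRatio_iff.mp a1) (integrable_chiRatio_iff.mp a0)
      measurableSet_Ioi fun w hw => ?_
    have hw : 0 < w := hw
    have e := mul_ratioDensity_left k n hw
    have hf := ratioDensity_pos k n hw
    have e2 : ratioDensity (k + 2) n w - ratioDensity k n w =
        (n * w - k) * (ratioDensity k n w / (k * (1 + w))) := by
      have h1w : (1 + w) ≠ 0 := by positivity
      rw [← mul_right_inj' hk.ne', mul_sub, e]
      field_simp
      ring
    have hr : 0 ≤ ratioDensity k n w / (k * (1 + w)) := by positivity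
    have e3 : (n * w - k) * (ψ w - c) ≤ 0 := by
      rcases le_total w (k / n) with h | h
      · exact mul_nonpos_of_nonpos_of_nonneg (by rw [le_div_iff₀ hn] at h; linarith)
          (sub_nonneg.mpr (hψ hw hcpos h))
      · exact mul_nonpos_of_nonneg_of_nonpos (by rw [div_le_iff₀ hn] at h; linarith)
          (sub_nonpos.mpr (hψ hcpos hw h))
    have e4 : (ratioDensity (k + 2) n w - ratioDensity k n w) * (ψ w - c) ≤ 0 := by
      rw [e2, mul_right_comm]
      exact mul_nonpos_of_nonpos_of_nonneg e3 hr
    linarith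
  rw [integral_sub h0 (integrable_const _), integral_sub h1 (integrable_const _)] at key
  simpa using key

theorem exists_ratioDensity_add_eq (k n j : ℕ) [NeZero k] [NeZero n] :
    ∃ C, 0 < C ∧ ∀ w, 0 < w →
      ratioDensity (k + 2 * j) n w = C * (w / (1 + w)) ^ j * ratioDensity k n w := by
  induction j with
  | zero => exact ⟨1, one_pos, fun w _ => by simp⟩
  | succ j ih =>
    obtain ⟨C, hC, h⟩ := ih
    have i1 : NeZero (k + 2 * j) := ⟨by have := NeZero.ne k; omega⟩
    have hk : (0 : ℝ) < (k + 2 * j : ℕ) := by have := NeZero.pos (k + 2 * j); positivity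
    refine ⟨((k + 2 * j : ℕ) + n) / (k + 2 * j : ℕ) * C, by positivity, fun w hw => ?_⟩
    have e := mul_ratioDensity_left (k + 2 * j) n hw
    rw [h w hw] at e
    rw [show k + 2 * (j + 1) = k + 2 * j + 2 by ring, ← mul_right_inj' hk.ne', e,
      pow_succ, ← div_eq_mul_inv]
    field_simp

/-- The ratio laws escape to infinity as the numerator degrees of freedom grow. -/
theorem exists_integral_chiRatio_neg {k n : ℕ} [NeZero k] [NeZero n] {ψ : ℝ → ℝ}
    (hψ : AntitoneOn ψ (Ioi 0)) (hi : ∀ j, Integrable ψ (chiRatio (k + 2 * j) n)) {w₀ : ℝ}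
    (hw₀ : 0 < w₀) (hneg : ψ w₀ < 0) : ∃ j, ∫ w, ψ w ∂(chiRatio (k + 2 * j) n) < 0 := by
  have h0 : Integrable ψ (chiRatio k n) := hi 0
  -- The density ratio to the base law is proportional to `(w / (1 + w)) ^ j`. It is at most `ρ₀ ^
  -- j` on `(0, w₀]` and at least `(ρ₀ r) ^ j` beyond `w₁`. The gap between `w₀` and `w₁` gives `r >
  -- 1`, so for large `j` the negative contribution beyond `w₁` outweighs everything else.
  set w₁ := w₀ + 1 with hw₁
  set ρ₀ := w₀ / (1 + w₀) with hρ₀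
  set r := w₁ / (1 + w₁) / ρ₀ with hr
  have hρ₀p : 0 < ρ₀ := by positivity
  have hmono : ∀ a b : ℝ, 0 < a → a ≤ b → a / (1 + a) ≤ b / (1 + b) := fun a b ha hab => by
    rw [div_le_div_iff₀ (by positivity) (by linarith)]
    nlinarith
  have hr1 : 1 < r := by
    rw [hr, lt_div_iff₀ hρ₀p, one_mul, hρ₀, div_lt_div_iff₀ (by positivity) (by positivity), hw₁]
    nlinarith
  set c := (chiRatio k n).real (Ioi w₁) with hc
  have hcpos : 0 < c := by
    have hint : ∫ w, (Ioi w₁).indicator (fun _ => (1 : ℝ)) w ∂(chiRatio k n) = c := by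
      rw [integral_indicator_const _ measurableSet_Ioi, smul_eq_mul, mul_one]
    refine lt_of_le_of_ne measureReal_nonneg fun h => ?_
    have hz : (chiRatio k n) (Ioi w₁) = 0 := by
      rw [hc, eq_comm, measureReal_eq_zero_iff] at h
      exact h
    rw [chiRatio_eq_withDensity, withDensity_apply _ measurableSet_Ioi,
      Measure.restrict_restrict measurableSet_Ioi,
      inter_eq_self_of_subset_left (Ioi_subset_Ioi (by positivity : 0 ≤ w₁)),
      setLIntegral_eq_zero_iff measurableSet_Ioi (measurable_ratioDensity k n).ennreal_ofReal] at hz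
    have : volume (Ioi w₁) = 0 := by
      refine measure_mono_null ?_ hz
      intro w hw
      have hw0 : 0 < w := lt_trans (by positivity) (show w₁ < w from hw)
      simpa using ⟨hw, ratioDensity_pos k n hw0⟩
    simp at this
  obtain ⟨j, hj⟩ := ((tendsto_pow_atTop_atTop_of_one_lt hr1).eventually_gt_atTop
    ((∫ w, |ψ w| ∂(chiRatio k n)) / (-ψ w₀ * c))).exists
  have hj' : (∫ w, |ψ w| ∂(chiRatio k n)) + ψ w₀ * r ^ j * c < 0 := by
    rw [div_lt_iff₀ (by nlinarith)] at hj
    linarith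
  obtain ⟨C, hC, hf⟩ := exists_ratioDensity_add_eq k n j
  have i1 : NeZero (k + 2 * j) := ⟨by have := NeZero.ne k; omega⟩
  refine ⟨j, ?_⟩
  have hb : ∀ w, 0 < w → ψ w * (w / (1 + w)) ^ j ≤
      ρ₀ ^ j * (|ψ w| + ψ w₀ * r ^ j * (Ioi w₁).indicator (fun _ => (1 : ℝ)) w) := by
    intro w hw
    have hpos : 0 < w / (1 + w) := by positivity
    by_cases h1 : w₁ < w
    · have e1 : ρ₀ ^ j * r ^ j ≤ (w / (1 + w)) ^ j := by
        rw [← mul_pow, hr, mul_div_cancel₀ _ hρ₀p.ne']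
        exact pow_le_pow_left₀ (by positivity) (hmono _ _ (by positivity) h1.le) j
      have e2 : ψ w ≤ ψ w₀ := hψ hw₀ hw (by linarith)
      rw [indicator_of_mem (show w ∈ Ioi w₁ from h1)]
      have e3 : 0 ≤ ρ₀ ^ j * |ψ w| := by positivity
      have e4 : 0 < (w / (1 + w)) ^ j := by positivity
      nlinarith
    · rw [indicator_of_notMem (show w ∉ Ioi w₁ from h1), mul_zero, add_zero, mul_comm]
      rcases le_total w w₀ with h | h
      · exact (mul_le_mul_of_nonneg_left (le_abs_self _) (by positivity)).trans
          (mul_le_mul_of_nonneg_right (pow_le_pow_left₀ hpos.le (hmono _ _ hw h) j) (abs_nonneg _))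
      · have e2 : ψ w ≤ ψ w₀ := hψ hw₀ hw h
        exact (mul_nonpos_of_nonneg_of_nonpos (by positivity) (by linarith)).trans (by positivity)
  have hiR : Integrable (fun w => ρ₀ ^ j * (|ψ w| + ψ w₀ * r ^ j *
      (Ioi w₁).indicator (fun _ => (1 : ℝ)) w)) (chiRatio k n) :=
    (h0.abs.add (((integrable_const (1 : ℝ)).indicator measurableSet_Ioi).const_mul _)).const_mul _
  have hR : ∫ w, ρ₀ ^ j * (|ψ w| + ψ w₀ * r ^ j * (Ioi w₁).indicator (fun _ => (1 : ℝ)) w)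
      ∂(chiRatio k n) < 0 := by
    rw [integral_const_mul, integral_add h0.abs
      (((integrable_const (1 : ℝ)).indicator measurableSet_Ioi).const_mul _), integral_const_mul,
      integral_indicator_const _ measurableSet_Ioi, smul_eq_mul, mul_one]
    exact mul_neg_of_pos_of_neg (by positivity) hj'
  rw [integral_chiRatio] at hR ⊢
  have hle : ∫ w in Ioi 0, ratioDensity (k + 2 * j) n w * ψ w ≤
      ∫ w in Ioi 0, C * (ratioDensity k n w * (ρ₀ ^ j * (|ψ w| + ψ w₀ * r ^ j *
        (Ioi w₁).indicator (fun _ => (1 : ℝ)) w))) := by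
    refine setIntegral_mono_on (integrable_chiRatio_iff.mp (hi j))
      ((integrable_chiRatio_iff.mp hiR).const_mul C) measurableSet_Ioi fun w hw => ?_
    rw [hf w hw]
    have := mul_le_mul_of_nonneg_left (hb w hw) (mul_pos hC (ratioDensity_pos k n hw)).le
    linarith
  rw [integral_const_mul] at hle
  exact hle.trans_lt (mul_neg_of_pos_of_neg hC hR)

theorem tendsto_poissonWeight (j : ℕ) : Tendsto (fun lam => poissonWeight lam j) atTop (𝓝 0) := by
  have h := (Real.tendsto_pow_mul_exp_neg_atTop_nhds_zero j).div_const (j.factorial : ℝ)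
  rw [zero_div] at h
  refine h.congr fun x => ?_
  unfold poissonWeight
  ring

/-- An antitone sequence whose Poisson averages are nonnegative is nonnegative. -/
theorem nonneg_of_antitone_of_poisson_average {e : ℕ → ℝ} (he : Antitone e)
    (h : ∀ lam, 0 ≤ lam → ∃ x, 0 ≤ x ∧ HasSum (fun j => poissonWeight lam j * e j) x) (J : ℕ) :
    0 ≤ e J := by
  have hlim : Tendsto (fun lam => e J + ∑ j ∈ Finset.range J, poissonWeight lam j * (e 0 - e J))
      atTop (𝓝 (e J + ∑ j ∈ Finset.range J, 0 * (e 0 - e J))) :=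
    tendsto_const_nhds.add (tendsto_finsetSum _ fun j _ => (tendsto_poissonWeight j).mul_const _)
  simp only [zero_mul, Finset.sum_const_zero, add_zero] at hlim
  refine ge_of_tendsto hlim ?_
  filter_upwards [eventually_ge_atTop 0] with lam hl
  obtain ⟨x, hx, hs⟩ := h lam hl
  have h1 := (hasSum_poissonWeight lam).mul_right (e J)
  -- The sequence is bounded by `e J` plus a correction `e 0 - e J` at the indices below `J`; the
  -- Poisson mass of these finitely many indices tends to zero as `lam` grows.
  have h2 : HasSum (fun j => if j < J then poissonWeight lam j * (e 0 - e J) else 0)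
      (∑ j ∈ Finset.range J, poissonWeight lam j * (e 0 - e J)) := by
    rw [← Finset.sum_congr rfl fun j hj => if_pos (Finset.mem_range.mp hj)]
    exact hasSum_sum_of_ne_finset_zero fun j hj => if_neg (by simpa using hj)
  have h3 := h1.add h2
  rw [one_mul] at h3
  refine hx.trans (hasSum_le (fun j => ?_) hs h3)
  have hp := poissonWeight_nonneg hl j
  split_ifs with hj
  · have := mul_le_mul_of_nonneg_left (he (Nat.zero_le j)) hp
    linarith
  · have := mul_le_mul_of_nonneg_left (he (not_lt.mp hj)) hp
    linarith

/-! ### Expectations of `g₁` and `g₃`, and the numbers whose supremum is `beta₂`. -/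

/-- Regularity of `φ`: continuity, differentiability off a countable set, and existence of the
expectations that enter `beta₂At`. -/
structure RegularShrinker (p n : ℕ) (φ : ℝ → ℝ) : Prop where
  cont : ContinuousOn φ (Ioi 0)
  diff : ∃ D : Set ℝ, D.Countable ∧ ∀ w, 0 < w → w ∉ D → DifferentiableAt ℝ φ w
  int_div : ∀ j, Integrable (fun w => φ w / w) (chiRatio (p + 2 * j) n)
  int_sq_div : ∀ j, Integrable (fun w => φ w ^ 2 / w) (chiRatio (p + 2 * j) n)
  int_deriv : ∀ j, Integrable (deriv φ) (chiRatio (p + 2 * j) n)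
  int_mul_deriv : ∀ j, Integrable (fun w => φ w * deriv φ w) (chiRatio (p + 2 * j) n)

/-- A measurable version of `g₃`. -/
def g₃Ext (n : ℕ) (φ : ℝ → ℝ) (w : ℝ) : ℝ :=
  2 * shrinkFactor φ w - n * tailTransform n (shrinkFactor φ) w + w * shrinkFactor φ w ^ 2

theorem rankOneCoeff_eq_g₃Ext {n : ℕ} {φ : ℝ → ℝ} {z : ℝ × ℝ} (h1 : 0 < z.1) (h2 : 0 < z.2) :
    rankOneCoeff n (shrinkFactor φ) z = z.2 / z.1 * g₃Ext n φ (z.1 / z.2) := by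
  rw [rankOneCoeff, g₃Ext]
  field_simp

namespace RegularShrinker

variable {p n : ℕ} [NeZero p] [NeZero n] {φ : ℝ → ℝ}

theorem neZero_add (p : ℕ) [NeZero p] (j : ℕ) : NeZero (p + j) :=
  ⟨by have := NeZero.ne p; omega⟩

theorem measurable (R : RegularShrinker p n φ) : Measurable (shrinkFactor φ) :=
  measurable_shrinkFactor R.cont

theorem measurable_g₃Ext (R : RegularShrinker p n φ) : Measurable (g₃Ext n φ) :=
  ((R.measurable.const_mul 2).sub ((measurable_tailTransform n R.measurable).const_mul _)).add
    (measurable_id.mul (R.measurable.pow_const 2))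

theorem integrable_shrinkFactor (R : RegularShrinker p n φ) (j : ℕ) :
    Integrable (shrinkFactor φ) (chiRatio (p + 2 * j) n) := by
  have := neZero_add p (2 * j)
  exact integrable_shrinkFactor_iff.mpr (R.int_div j)

theorem g₂_eq (R : RegularShrinker p n φ) {w : ℝ} (hw : 0 < w) :
    g₂ n φ w = 2 * (φ w / w) - n * g₁ n φ w := by
  obtain ⟨D, hD, hd⟩ := R.diff
  have := neZero_add p (2 * 0)
  exact Shrinkage.g₂_eq R.cont hD hd (R.int_div 0) (R.int_deriv 0) hw

theorem g₃_eq (R : RegularShrinker p n φ) {w : ℝ} (hw : 0 < w) : g₃ n φ w = g₃Ext n φ w := by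
  rw [g₃, R.g₂_eq hw, g₃Ext, g₁_eq hw, shrinkFactor_of_pos hw]
  field_simp

theorem g₃_nonneg (R : RegularShrinker p n φ) (hg : AntitoneOn (g₁ n φ) (Ioi 0)) {w : ℝ}
    (hw : 0 < w) : 0 ≤ g₃ n φ w := by
  obtain ⟨D, hD, hd⟩ := R.diff
  have := neZero_add p (2 * 0)
  have := g₂_nonneg R.cont hD hd (R.int_div 0) (R.int_deriv 0) hg hw
  rw [g₃]
  positivity

/-- This is the origin of `bFun`: the tail transform contributes `4 (φ/w - φ')` through `g₂`, and
integration by parts turns `φ²/w` under `n + 2` degrees of freedom into `(n + 2) φ²/w - 4 φ φ'`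
under `n`. -/
theorem integral_g₃Ext (R : RegularShrinker p n φ) (j : ℕ) :
    Integrable (g₃Ext n φ) (chiRatio (p + 2 * j) (n + 2)) ∧
      n * ∫ w, g₃Ext n φ w ∂(chiRatio (p + 2 * j) (n + 2)) =
        ∫ w, bFun n φ w ∂(chiRatio (p + 2 * j) n) := by
  obtain ⟨D, hD, hd⟩ := R.diff
  have i0 := neZero_add p (2 * j)
  have i1 : NeZero (n + 2) := neZero_add n 2
  set k := p + 2 * j with hk
  have h1 : Integrable (shrinkFactor φ) (chiRatio k n) := R.integrable_shrinkFactor j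
  have hs : ∀ m : ℕ, NeZero m → (fun w => φ w ^ 2 / w) =ᵐ[chiRatio k m]
      fun w => w * shrinkFactor φ w ^ 2 := fun m hm => by
    filter_upwards [ae_chiRatio_pos k m] with w hw
    rw [shrinkFactor_of_pos hw]
    field_simp
  have hqm : Measurable fun w => w * shrinkFactor φ w ^ 2 :=
    measurable_id.mul (R.measurable.pow_const 2)
  have hq : Integrable (fun w => w * shrinkFactor φ w ^ 2) (chiRatio k n) :=
    (integrable_congr (hs n inferInstance)).mp (R.int_sq_div j)
  have hq2 := (integrable_chiRatio_succ hqm hq).2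
  have hsq := integral_sq_div_chiRatio R.cont hD hd (R.int_sq_div j) (R.int_mul_deriv j)
  rw [integral_congr_ae (hs (n + 2) i1), ← hk] at hsq
  have hX : Integrable (fun w => ((n : ℝ) + 2) * (φ w ^ 2 / w) - 4 * (φ w * deriv φ w))
      (chiRatio k n) := ((R.int_sq_div j).const_mul _).sub ((R.int_mul_deriv j).const_mul _)
  set h₂ : ℝ → ℝ := fun w => 2 * (shrinkFactor φ w - deriv φ w) with hh₂
  have hm₂ : Measurable h₂ := (R.measurable.sub (measurable_deriv φ)).const_mul 2
  have hi₂ : Integrable h₂ (chiRatio k n) := (h1.sub (R.int_deriv j)).const_mul 2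
  obtain ⟨ti, te⟩ := integral_tailTransform hm₂ hi₂
  have hge : g₃Ext n φ =ᵐ[chiRatio k (n + 2)] fun w =>
      tailTransform n h₂ w + w * shrinkFactor φ w ^ 2 := by
    filter_upwards [ae_chiRatio_pos k (n + 2)] with w hw
    rw [← R.g₃_eq hw, g₃, g₂, shrinkFactor_of_pos hw]
    have e1 : tailTransform n (fun t => 2 * (φ t / t - deriv φ t)) w = tailTransform n h₂ w :=
      tailTransform_congr (fun t ht => by simp only [hh₂, shrinkFactor_of_pos ht]) hw
    rw [e1]
    field_simp
  refine ⟨(integrable_congr hge).mpr (ti.add hq2), ?_⟩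
  rw [integral_congr_ae hge, integral_add ti hq2, mul_add, te, hsq, ← integral_const_mul,
    ← integral_add (hi₂.const_mul 2) hX]
  refine integral_congr_ae ?_
  filter_upwards [ae_chiRatio_pos k n] with w hw
  simp only [hh₂, bFun, shrinkFactor_of_pos hw]
  ring

theorem integral_g₁ (R : RegularShrinker p n φ) (j : ℕ) :
    Integrable (tailTransform n (shrinkFactor φ)) (chiRatio (p + 2 * j) (n + 2)) ∧
      n * ∫ w, tailTransform n (shrinkFactor φ) w ∂(chiRatio (p + 2 * j) (n + 2)) =
        2 * ∫ w, φ w / w ∂(chiRatio (p + 2 * j) n) := by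
  have i0 := neZero_add p (2 * j)
  have := integral_tailTransform R.measurable (R.integrable_shrinkFactor j)
  rwa [integral_congr_ae ((ae_chiRatio_pos (p + 2 * j) n).mono
    fun w hw => shrinkFactor_of_pos (φ := φ) hw)] at this

theorem beta₂At_eq (R : RegularShrinker p n φ) (j : ℕ) :
    beta₂At p n φ j =
      n * ∫ w, tailTransform n (shrinkFactor φ) w ∂(chiRatio (p + 2 * j) (n + 2)) -
        n * (∫ w, g₃Ext n φ w ∂(chiRatio (p + 2 * j) (n + 2))) / (p + 2 * j) := by
  rw [(R.integral_g₁ j).2, (R.integral_g₃Ext j).2, beta₂At, ratioLaw_eq_chiRatio]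
  have hb : Integrable (bFun n φ) (chiRatio (p + 2 * j) n) := by
    refine (((((R.int_div j).const_mul 4).add ((R.int_sq_div j).const_mul ((n : ℝ) + 2))).sub
      ((R.int_deriv j).const_mul 4)).sub ((R.int_mul_deriv j).const_mul 4)).congr
      (ae_of_all _ fun w => ?_)
    simp only [bFun, Pi.add_apply, Pi.sub_apply]
    ring
  have h1 : Integrable (fun w => 2 * φ w / w) (chiRatio (p + 2 * j) n) :=
    ((R.int_div j).const_mul 2).congr (ae_of_all _ fun w => by simp only; ring)
  rw [integral_sub h1 (hb.div_const _), integral_div, ← integral_const_mul]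
  simp only [mul_div_assoc]

/-- In this form `beta₂At p n φ j` is the `j`-th Poisson component of the scalar coefficient of the
risk reduction matrix. -/
theorem beta₂At_eq_sub (R : RegularShrinker p n φ) (j : ℕ) :
    beta₂At p n φ j =
      ∫ z, z.2 * tailTransform n (shrinkFactor φ) (z.1 / z.2)
          ∂((chiSq (p + 2 * j)).prod (chiSq n)) -
        ∫ z, rankOneCoeff n (shrinkFactor φ) z ∂((chiSq (p + 2 + 2 * j)).prod (chiSq n)) := by
  have i0 := neZero_add p (2 * j)
  have i1 := neZero_add (p + 2 * j) 2
  have hk : ((p : ℝ) + 2 * j) ≠ 0 := by have := NeZero.pos p; positivity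
  rw [R.beta₂At_eq, (integral_snd_mul_comp_ratio (measurable_tailTransform n R.measurable)).2,
    show p + 2 + 2 * j = p + 2 * j + 2 by ring]
  congr 1
  rw [div_eq_iff hk]
  have h := (integral_div_mul_comp_ratio (k := p + 2 * j) (n := n) R.measurable_g₃Ext).2
  push_cast at h
  rw [← h, mul_comm]
  congr 1
  refine integral_congr_ae ?_
  filter_upwards [ae_prod_chiSq_pos (p + 2 * j + 2) n] with z hz
  exact (rankOneCoeff_eq_g₃Ext hz.1 hz.2).symm

theorem beta₂At_le (R : RegularShrinker p n φ) (hg : AntitoneOn (g₁ n φ) (Ioi 0)) (j : ℕ) :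
    beta₂At p n φ j ≤
      n * ∫ w, tailTransform n (shrinkFactor φ) w ∂(chiRatio (p + 2 * j) (n + 2)) := by
  have i0 := neZero_add p (2 * j)
  have i1 : NeZero (n + 2) := neZero_add n 2
  rw [R.beta₂At_eq]
  have : 0 ≤ ∫ w, g₃Ext n φ w ∂(chiRatio (p + 2 * j) (n + 2)) := by
    refine integral_nonneg_of_ae ?_
    filter_upwards [ae_chiRatio_pos (p + 2 * j) (n + 2)] with w hw
    rw [← R.g₃_eq hw]
    exact R.g₃_nonneg hg hw
  have h2 : 0 ≤ n * (∫ w, g₃Ext n φ w ∂(chiRatio (p + 2 * j) (n + 2))) / (p + 2 * j) := by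
    positivity
  linarith

theorem antitoneOn_tail (hg : AntitoneOn (g₁ n φ) (Ioi 0)) :
    AntitoneOn (tailTransform n (shrinkFactor φ)) (Ioi 0) := by
  intro a ha b hb hab
  rw [← g₁_eq ha, ← g₁_eq hb]
  exact hg ha hb hab

theorem antitone_integral_g₁ (R : RegularShrinker p n φ) (hg : AntitoneOn (g₁ n φ) (Ioi 0)) :
    Antitone fun j : ℕ =>
      n * ∫ w, tailTransform n (shrinkFactor φ) w ∂(chiRatio (p + 2 * j) (n + 2)) := by
  refine antitone_nat_of_succ_le fun j => ?_
  have i0 := neZero_add p (2 * j)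
  have i1 : NeZero (n + 2) := neZero_add n 2
  refine mul_le_mul_of_nonneg_left ?_ (by positivity)
  exact integral_chiRatio_succ_le (antitoneOn_tail hg) (R.integral_g₁ j).1 (R.integral_g₁ (j + 1)).1

/-- Discarding the nonnegative `g₃` term leaves means of `g₁`, which decrease in `j`, so the one at
`j = 0` bounds them all. Boundedness is what makes the real supremum an actual upper bound. -/
theorem bddAbove_beta₂At (R : RegularShrinker p n φ) (hg : AntitoneOn (g₁ n φ) (Ioi 0)) :
    BddAbove (range (beta₂At p n φ)) := by
  refine ⟨n * ∫ w, tailTransform n (shrinkFactor φ) w ∂(chiRatio (p + 2 * 0) (n + 2)), ?_⟩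
  rintro _ ⟨j, rfl⟩
  exact (R.beta₂At_le hg j).trans (R.antitone_integral_g₁ hg (Nat.zero_le j))

end RegularShrinker

/-! ### Integrability gained from the improvement on `X`. -/

section

variable {p n : ℕ} [NeZero p] [NeZero n] {φ : ℝ → ℝ} {θ : Fin p → ℝ} {v : ℝ≥0}

theorem statW_pos {z : (Fin p → ℝ) × ℝ} (hz : 0 < z.1 ⬝ᵥ z.1 ∧ 0 < z.2) : 0 < statW z :=
  div_pos hz.1 hz.2

theorem measurable_statW : Measurable (statW (p := p)) := by
  unfold statW; simp only [dotProduct]; fun_prop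

theorem delta_eq {z : (Fin p → ℝ) × ℝ} (hz : 0 < z.1 ⬝ᵥ z.1 ∧ 0 < z.2) :
    delta φ z = (1 - shrinkFactor φ (statW z)) • z.1 := by
  rw [delta, shrinkFactor_of_pos (statW_pos hz)]

theorem integral_normSq_sub (hv : 0 < v) :
    Integrable (fun z => (z.1 - θ) ⬝ᵥ (z.1 - θ)) (sampleLaw p n θ v) ∧
      ∫ z, (z.1 - θ) ⬝ᵥ (z.1 - θ) ∂(sampleLaw p n θ v) = p * v := by
  have key : ∀ i, Integrable (fun z => (z.1 - θ) i * (z.1 - θ) i) (sampleLaw p n θ v) ∧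
      ∫ z, (z.1 - θ) i * (z.1 - θ) i ∂(sampleLaw p n θ v) = v := by
    intro i
    obtain ⟨h1, e1⟩ := integral_coord (n := n) (θ := θ) hv i
    obtain ⟨h2, e2⟩ := integral_coord_mul_coord (n := n) (θ := θ) hv i i
    have e : ∀ z : (Fin p → ℝ) × ℝ, (z.1 - θ) i * (z.1 - θ) i =
        z.1 i * z.1 i - (2 * θ i * z.1 i - θ i * θ i) := fun z => by
      simp only [Pi.sub_apply]; ring
    have h3 : Integrable (fun z : (Fin p → ℝ) × ℝ => 2 * θ i * z.1 i - θ i * θ i)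
        (sampleLaw p n θ v) := (h1.const_mul _).sub (integrable_const _)
    simp only [e]
    refine ⟨h2.sub h3, ?_⟩
    rw [integral_sub h2 h3, integral_sub (h1.const_mul _) (integrable_const _),
      integral_const_mul, e1, e2]
    simp only [Matrix.one_apply_eq, integral_const, probReal_univ, one_smul]
    ring
  simp only [dotProduct]
  refine ⟨integrable_finsetSum _ fun i _ => (key i).1, ?_⟩
  rw [integral_finsetSum _ fun i _ => (key i).1]
  rw [Finset.sum_congr rfl fun i _ => (key i).2]
  simp

theorem meanRisk_fst (hv : 0 < v) :
    meanRisk n Prod.fst θ v = ENNReal.ofReal (p * v) := by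
  rw [meanRisk, ← (integral_normSq_sub (n := n) (θ := θ) hv).2,
    ofReal_integral_eq_lintegral_ofReal (integral_normSq_sub hv).1
      (ae_of_all _ fun z => Finset.sum_nonneg fun i _ => mul_self_nonneg _)]

theorem measurable_shrunk {h : ℝ → ℝ} (hm : Measurable h) :
    Measurable fun z : (Fin p → ℝ) × ℝ => (1 - h (statW z)) • z.1 := by
  have := hm.comp (measurable_statW (p := p))
  exact (measurable_const.sub this).smul measurable_fst

/-- The squared error loss of an improving estimator is integrable. -/
theorem integral_normSq_shrunk_sub (hm : Measurable (shrinkFactor φ)) (hv : 0 < v)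
    (himp : meanRisk n (delta φ) θ v ≤ meanRisk n Prod.fst θ v) :
    Integrable (fun z => ((1 - shrinkFactor φ (statW z)) • z.1 - θ) ⬝ᵥ
      ((1 - shrinkFactor φ (statW z)) • z.1 - θ)) (sampleLaw p n θ v) ∧
    ∫ z, ((1 - shrinkFactor φ (statW z)) • z.1 - θ) ⬝ᵥ
      ((1 - shrinkFactor φ (statW z)) • z.1 - θ) ∂(sampleLaw p n θ v) ≤ p * v := by
  have hmeas : Measurable fun z : (Fin p → ℝ) × ℝ =>
      ((1 - shrinkFactor φ (statW z)) • z.1 - θ) ⬝ᵥ ((1 - shrinkFactor φ (statW z)) • z.1 - θ) := by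
    have h1 := (measurable_shrunk (p := p) hm).sub_const θ
    simp only [dotProduct]
    exact Finset.measurable_sum _ fun i _ =>
      ((measurable_pi_apply i).comp h1).mul ((measurable_pi_apply i).comp h1)
  have hnn : ∀ z : (Fin p → ℝ) × ℝ, 0 ≤ ((1 - shrinkFactor φ (statW z)) • z.1 - θ) ⬝ᵥ
      ((1 - shrinkFactor φ (statW z)) • z.1 - θ) :=
    fun z => Finset.sum_nonneg fun i _ => mul_self_nonneg _
  have hl : ∫⁻ z, ENNReal.ofReal (((1 - shrinkFactor φ (statW z)) • z.1 - θ) ⬝ᵥ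
      ((1 - shrinkFactor φ (statW z)) • z.1 - θ)) ∂(sampleLaw p n θ v) ≤ ENNReal.ofReal (p * v) := by
    rw [meanRisk_fst hv, meanRisk] at himp
    refine le_trans (le_of_eq (lintegral_congr_ae ?_)) himp
    filter_upwards [ae_sampleLaw_pos hv] with z hz
    rw [delta_eq hz]
  have hint : Integrable (fun z => ((1 - shrinkFactor φ (statW z)) • z.1 - θ) ⬝ᵥ
      ((1 - shrinkFactor φ (statW z)) • z.1 - θ)) (sampleLaw p n θ v) :=
    ⟨hmeas.aestronglyMeasurable, (hasFiniteIntegral_iff_ofReal (ae_of_all _ hnn)).mpr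
      (hl.trans_lt ENNReal.ofReal_lt_top)⟩
  refine ⟨hint, ?_⟩
  rwa [← ofReal_integral_eq_lintegral_ofReal hint (ae_of_all _ hnn),
    ENNReal.ofReal_le_ofReal_iff (by positivity)] at hl

/-- Since `h X = (X - θ) - (δ - θ)`, the quantity `‖X‖² h²` is at most `2‖X - θ‖² + 2‖δ - θ‖²`. Both
terms are integrable, the second because the risk of `δ` is bounded by that of `X`. -/
theorem RegularShrinker.statIntegrable (R : RegularShrinker p n φ) (hv : 0 < v)
    (himp : meanRisk n (delta φ) θ v ≤ meanRisk n Prod.fst θ v) :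
    StatIntegrable p n (shrinkFactor φ) θ v := by
  refine ⟨R.measurable, R.integrable_shrinkFactor, ?_⟩
  have h1 := (integral_normSq_sub (n := n) (θ := θ) hv).1
  have h2 := (integral_normSq_shrunk_sub R.measurable hv himp).1
  refine Integrable.mono' ((h1.const_mul 2).add (h2.const_mul 2)) ?_ (ae_of_all _ fun z => ?_)
  · have h3 : Measurable fun z : (Fin p → ℝ) × ℝ => z.1 ⬝ᵥ z.1 := by
      simp only [dotProduct]; fun_prop
    exact (h3.mul ((R.measurable.comp measurable_statW).pow_const 2)).aestronglyMeasurable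
  · simp only [Pi.add_apply]
    set a := shrinkFactor φ (statW z)
    have h0 : 0 ≤ z.1 ⬝ᵥ z.1 := Finset.sum_nonneg fun i _ => mul_self_nonneg _
    rw [Real.norm_of_nonneg (mul_nonneg h0 (sq_nonneg _))]
    simp only [dotProduct, Finset.sum_mul, Finset.mul_sum, ← Finset.sum_add_distrib]
    refine Finset.sum_le_sum fun i _ => ?_
    simp only [Pi.sub_apply, Pi.smul_apply, smul_eq_mul]
    nlinarith [sq_nonneg (z.1 i - θ i + ((1 - a) * z.1 i - θ i))]

/-! ### Unbiasedness -/

theorem RegularShrinker.redHat₀_eq (R : RegularShrinker p n φ) {z : (Fin p → ℝ) × ℝ}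
    (hz : 0 < z.1 ⬝ᵥ z.1 ∧ 0 < z.2) : redHat₀ n φ z = unbiasedRed n (shrinkFactor φ) z := by
  have hw := statW_pos hz
  ext i k
  rw [unbiasedRed, rankOneCoeff_eq_g₃Ext (z := (z.1 ⬝ᵥ z.1, z.2)) hz.1 hz.2]
  change _ = (z.2 * tailTransform n (shrinkFactor φ) (statW z)) * (1 : Matrix (Fin p) (Fin p) ℝ) i k -
    z.2 / (z.1 ⬝ᵥ z.1) * g₃Ext n φ (statW z) * (z.1 i * z.1 k)
  rw [← g₁_eq hw, ← R.g₃_eq hw, g₃]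
  simp only [redHat₀, mseHat₀, proj, Matrix.sub_apply, Matrix.add_apply, Matrix.smul_apply,
    smul_eq_mul, Matrix.vecMulVec_apply]
  ring

theorem RegularShrinker.redMatrix_eq (R : RegularShrinker p n φ) (hp : 3 ≤ p) (hv : 0 < v)
    (himp : meanRisk n (delta φ) θ v ≤ meanRisk n Prod.fst θ v) (i k : Fin p) :
    redMatrix n φ θ v i k = ∫ z, unbiasedRed n (shrinkFactor φ) z i k ∂(sampleLaw p n θ v) := by
  rw [(R.statIntegrable hv himp).integral_unbiasedRed_eq hp hv]
  simp only [redMatrix, mseMatrix, Matrix.sub_apply, Matrix.smul_apply, smul_eq_mul, Matrix.of_apply]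
  congr 1
  refine integral_congr_ae ?_
  filter_upwards [ae_sampleLaw_pos hv] with z hz
  rw [delta_eq hz]
  simp only [Pi.sub_apply, Pi.smul_apply, smul_eq_mul]

theorem RegularShrinker.isUnbiased (R : RegularShrinker p n φ) (hp : 3 ≤ p)
    (himp : ∀ (θ : Fin p → ℝ) (v : ℝ≥0), 0 < v →
      meanRisk n (delta φ) θ v ≤ meanRisk n Prod.fst θ v) :
    IsUnbiased (p := p) n (redHat₀ n φ) (redMatrix n φ) := by
  intro θ v hv i k
  have hae : (fun z => redHat₀ n φ z i k) =ᵐ[sampleLaw p n θ v]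
      fun z => unbiasedRed n (shrinkFactor φ) z i k := by
    filter_upwards [ae_sampleLaw_pos hv] with z hz
    rw [R.redHat₀_eq hz]
  rw [integrable_congr hae, integral_congr_ae hae]
  exact ⟨(R.statIntegrable hv (himp θ v hv)).integrable_unbiasedRed hp hv i k,
    (R.redMatrix_eq hp hv (himp θ v hv) i k).symm⟩

/-- By completeness of the model every unbiased estimator has minimal variance. -/
theorem IsUnbiased.isUMVUE {T : (Fin p → ℝ) × ℝ → Matrix (Fin p) (Fin p) ℝ}
    {τ : (Fin p → ℝ) → ℝ≥0 → Matrix (Fin p) (Fin p) ℝ} (hT : IsUnbiased n T τ) :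
    IsUMVUE n T τ := by
  refine ⟨hT, fun T' hT' θ v hv i k => le_of_eq ?_⟩
  have h := ae_eq_zero_of_forall_integral_eq_zero (p := p) (n := n)
    (f := fun z => T z i k - T' z i k)
    (fun θ v hv => (hT θ v hv i k).1.sub (hT' θ v hv i k).1)
    (fun θ v hv => by
      rw [integral_sub (hT θ v hv i k).1 (hT' θ v hv i k).1, (hT θ v hv i k).2,
        (hT' θ v hv i k).2, sub_self]) θ v hv
  have hae : (fun z => T z i k) =ᵐ[sampleLaw p n θ v] fun z => T' z i k := by
    filter_upwards [h] with z hz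
    exact sub_eq_zero.mp hz
  rw [evariance, evariance, integral_congr_ae hae]
  exact lintegral_congr_ae (hae.mono fun z hz => by simp only [hz])

/-! ### The structure of the risk reduction matrix -/

theorem ae_mixLaw_pos {d : ℕ} [NeZero d] (lam : ℝ) : ∀ᵐ y ∂(mixLaw d n lam), 0 < y.1 ∧ 0 < y.2 := by
  have i1 : ∀ j, NeZero (d + 2 * j) := fun j => RegularShrinker.neZero_add d (2 * j)
  rw [mixLaw_eq_sum, Measure.ae_sum_iff]
  exact fun j => (Measure.smul_absolutelyContinuous).ae_le (ae_prod_chiSq_pos (d + 2 * j) n)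

theorem RegularShrinker.rankOneCoeff_nonneg (R : RegularShrinker p n φ)
    (hg : AntitoneOn (g₁ n φ) (Ioi 0)) {z : ℝ × ℝ} (hz : 0 < z.1 ∧ 0 < z.2) :
    0 ≤ rankOneCoeff n (shrinkFactor φ) z := by
  have hw : 0 < z.1 / z.2 := div_pos hz.1 hz.2
  have := R.g₃_nonneg hg hw
  rw [rankOneCoeff_eq_g₃Ext hz.1 hz.2, ← R.g₃_eq hw]
  exact mul_nonneg (div_nonneg hz.2.le hz.1.le) this

/-- The moment formulas for the unbiased estimator give the form `v (A - B) I - d θθ'`. Here `B` and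
`d` are means of `rankOneCoeff`, which has the sign of `g₃`, and `A - B` expands over the Poisson
components by `beta₂At_eq_sub`. Dropping `B ≥ 0` gives the last bound. -/
theorem RegularShrinker.exists_redMatrix_eq (R : RegularShrinker p n φ) (hp : 3 ≤ p) (hv : 0 < v)
    (himp : meanRisk n (delta φ) θ v ≤ meanRisk n Prod.fst θ v)
    (hg : AntitoneOn (g₁ n φ) (Ioi 0)) :
    ∃ a d : ℝ, 0 ≤ a ∧ 0 ≤ d ∧
      (∀ i k, redMatrix n φ θ v i k = v * a * (1 : Matrix (Fin p) (Fin p) ℝ) i k - d * (θ i * θ k)) ∧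
      HasSum (fun j => poissonWeight (θ ⬝ᵥ θ / (2 * v)) j * beta₂At p n φ j) a ∧
      a ≤ ∫ z, z.2 * tailTransform n (shrinkFactor φ) (z.1 / z.2)
        ∂(mixLaw p n (θ ⬝ᵥ θ / (2 * v))) := by
  have h0v : (0 : ℝ) < v := hv
  have hs := R.statIntegrable hv himp
  have hl := noncentrality_nonneg θ v
  have i2 : NeZero (p + 2) := neZero_add p 2
  have i4 : NeZero (p + 4) := neZero_add p 4
  have hrm := measurable_rankOneCoeff (n := n) hs.measurable
  have iS := (ratio_mixLaw_integrable hl hs.measurable hs.ratio (hs.mix hp hv)).2.2.1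
  have iR := integrable_mixLaw_of_normSq hv hrm (hs.integrable_normSq_rankOneCoeff hp hv)
  set lam := θ ⬝ᵥ θ / (2 * v) with hlam
  set A := ∫ z, z.2 * tailTransform n (shrinkFactor φ) (z.1 / z.2) ∂(mixLaw p n lam)
  set B := ∫ z, rankOneCoeff n (shrinkFactor φ) z ∂(mixLaw (p + 2) n lam)
  set d := ∫ z, rankOneCoeff n (shrinkFactor φ) z ∂(mixLaw (p + 4) n lam)
  have hB : 0 ≤ B := integral_nonneg_of_ae
    ((ae_mixLaw_pos lam).mono fun z hz => R.rankOneCoeff_nonneg hg hz)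
  have hd : 0 ≤ d := integral_nonneg_of_ae
    ((ae_mixLaw_pos lam).mono fun z hz => R.rankOneCoeff_nonneg hg hz)
  have hred : ∀ i k, redMatrix n φ θ v i k =
      v * (A - B) * (1 : Matrix (Fin p) (Fin p) ℝ) i k - d * (θ i * θ k) := by
    intro i k
    rw [R.redMatrix_eq hp hv himp, hs.integral_unbiasedRed hp hv]
    ring
  have hsum : HasSum (fun j => poissonWeight lam j * beta₂At p n φ j) (A - B) := by
    have h := (hasSum_integral_mixLaw hl iS).sub (hasSum_integral_mixLaw hl iR)
    simp only [← mul_sub, ← R.beta₂At_eq_sub] at h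
    exact h
  refine ⟨A - B, d, ?_, hd, hred, hsum, by linarith⟩
  -- The trace is `p v` minus the risk of `δ`, hence nonnegative by improvement. As `d ‖θ‖² ≥ 0`,
  -- the scalar coefficient must then be nonnegative.
  have htr : 0 ≤ ∑ i, redMatrix n φ θ v i i := by
    obtain ⟨q1, q2⟩ := integral_normSq_shrunk_sub R.measurable hv himp
    have e : ∑ i, mseMatrix n φ θ v i i =
        ∫ z, ((1 - shrinkFactor φ (statW z)) • z.1 - θ) ⬝ᵥ
          ((1 - shrinkFactor φ (statW z)) • z.1 - θ) ∂(sampleLaw p n θ v) := by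
      simp only [dotProduct]
      rw [integral_finsetSum]
      · refine Finset.sum_congr rfl fun i _ => ?_
        simp only [mseMatrix, Matrix.of_apply]
        refine integral_congr_ae ?_
        filter_upwards [ae_sampleLaw_pos hv] with z hz
        rw [delta_eq hz]
      · intro i _
        have hmm := (measurable_shrunk (p := p) R.measurable).sub_const θ
        refine q1.mono' (((measurable_pi_apply i).comp hmm).mul
          ((measurable_pi_apply i).comp hmm)).aestronglyMeasurable (ae_of_all _ fun z => ?_)
        rw [Real.norm_of_nonneg (mul_self_nonneg _)]
        exact Finset.single_le_sum (f := fun i => ((1 - shrinkFactor φ (statW z)) • z.1 - θ) i *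
          ((1 - shrinkFactor φ (statW z)) • z.1 - θ) i) (fun i _ => mul_self_nonneg _)
          (Finset.mem_univ i)
    rw [← e] at q2
    simp only [redMatrix, Matrix.sub_apply, Matrix.smul_apply, Matrix.one_apply_eq, smul_eq_mul,
      mul_one, Finset.sum_sub_distrib, Finset.sum_const, Finset.card_univ, Fintype.card_fin,
      nsmul_eq_mul]
    linarith
  simp only [hred, Matrix.one_apply_eq, mul_one, Finset.sum_sub_distrib, Finset.sum_const,
    Finset.card_univ, Fintype.card_fin, nsmul_eq_mul, ← Finset.mul_sum] at htr
  have hθ : 0 ≤ ∑ i, θ i * θ i := Finset.sum_nonneg fun i _ => mul_self_nonneg _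
  have hpp : (0 : ℝ) < p := by have := NeZero.pos p; positivity
  have h1 : 0 ≤ p * v * (A - B) := by nlinarith [mul_nonneg hd hθ]
  exact nonneg_of_mul_nonneg_right h1 (by positivity)

/-- A Poisson average lies below the supremum of its terms; since the average is nonnegative, so is
the supremum. -/
theorem RegularShrinker.beta₂_nonneg (R : RegularShrinker p n φ) (hp : 3 ≤ p)
    (himp : ∀ (θ : Fin p → ℝ) (v : ℝ≥0), 0 < v →
      meanRisk n (delta φ) θ v ≤ meanRisk n Prod.fst θ v)
    (hg : AntitoneOn (g₁ n φ) (Ioi 0)) (hv : 0 < v) :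
    0 ≤ beta₂ p n φ ∧ ∃ a d : ℝ, 0 ≤ d ∧ a ≤ beta₂ p n φ ∧
      ∀ i k, redMatrix n φ θ v i k =
        v * a * (1 : Matrix (Fin p) (Fin p) ℝ) i k - d * (θ i * θ k) := by
  obtain ⟨a, d, ha, hd, hred, hsum, -⟩ := R.exists_redMatrix_eq hp hv (himp θ v hv) hg
  have h1 := (hasSum_poissonWeight (θ ⬝ᵥ θ / (2 * v))).mul_right (beta₂ p n φ)
  rw [one_mul] at h1
  have hab : a ≤ beta₂ p n φ := hasSum_le (fun j => mul_le_mul_of_nonneg_left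
    (le_ciSup (R.bddAbove_beta₂At hg) j) (poissonWeight_nonneg (noncentrality_nonneg θ v) j)) hsum h1
  exact ⟨ha.trans hab, a, d, hd, hab, hred⟩

/-- Improvement makes every Poisson average of `E_j[S g₁]` nonnegative, and these means decrease in
`j`, so each is nonnegative. A negative value of `g₁` would persist to its right, and the ratio
laws, which escape to infinity, would then give a negative mean. -/
theorem RegularShrinker.g₁_nonneg (R : RegularShrinker p n φ) (hp : 3 ≤ p)
    (himp : ∀ (θ : Fin p → ℝ) (v : ℝ≥0), 0 < v →
      meanRisk n (delta φ) θ v ≤ meanRisk n Prod.fst θ v)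
    (hg : AntitoneOn (g₁ n φ) (Ioi 0)) {w : ℝ} (hw : 0 < w) : 0 ≤ g₁ n φ w := by
  have i1 : NeZero (n + 2) := neZero_add n 2
  have hn : 0 < (n : ℝ) := by have := NeZero.pos n; positivity
  have hpos : ∀ j, 0 ≤ n * ∫ w, tailTransform n (shrinkFactor φ) w
      ∂(chiRatio (p + 2 * j) (n + 2)) := by
    refine nonneg_of_antitone_of_poisson_average (R.antitone_integral_g₁ hg) fun lam hl => ?_
    -- Every noncentrality `lam` is attained, with unit variance and `‖θ‖² = 2 lam`.
    obtain ⟨θ, hθ⟩ : ∃ θ : Fin p → ℝ, θ ⬝ᵥ θ / (2 * ((1 : ℝ≥0) : ℝ)) = lam := by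
      refine ⟨Pi.single 0 (Real.sqrt (2 * lam)), ?_⟩
      rw [single_dotProduct, Pi.single_eq_same, Real.mul_self_sqrt (by positivity), NNReal.coe_one]
      ring
    obtain ⟨a, d, ha, -, -, -, hle⟩ :=
      R.exists_redMatrix_eq hp one_pos (himp θ 1 one_pos) hg
    have hs := R.statIntegrable one_pos (himp θ 1 one_pos)
    have hm := hs.mix hp one_pos
    rw [hθ] at hle hm
    refine ⟨_, ha.trans hle, ?_⟩
    have h := hasSum_integral_mixLaw hl
      (ratio_mixLaw_integrable hl hs.measurable hs.ratio hm).2.2.1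
    have e : ∀ j, ∫ z, z.2 * tailTransform n (shrinkFactor φ) (z.1 / z.2)
        ∂((chiSq (p + 2 * j)).prod (chiSq n)) =
        n * ∫ w, tailTransform n (shrinkFactor φ) w ∂(chiRatio (p + 2 * j) (n + 2)) := fun j => by
      have i0 := neZero_add p (2 * j)
      exact (integral_snd_mul_comp_ratio (measurable_tailTransform n R.measurable)).2
    simpa only [e] using h
  by_contra! hneg
  rw [g₁_eq hw] at hneg
  obtain ⟨j, hj⟩ := exists_integral_chiRatio_neg (antitoneOn_tail hg)
    (fun j => (R.integral_g₁ j).1) hw hneg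
  have := hpos j
  nlinarith

end

/-! ### Moments of the chi-square law and a covariance inequality -/

theorem integral_id_mul_chiSq {k : ℕ} [NeZero k] (G : ℝ → ℝ) :
    (Integrable (fun y => y * G y) (chiSq k) ↔ Integrable G (chiSq (k + 2))) ∧
    ∫ y, y * G y ∂(chiSq k) = k * ∫ y, G y ∂(chiSq (k + 2)) := by
  have hk : 0 < (k : ℝ) := by have := NeZero.pos k; positivity
  have hd : Measurable fun y : ℝ => ENNReal.ofReal y := by fun_prop
  have hae : (fun y : ℝ => (ENNReal.ofReal y).toReal • G y) =ᵐ[chiSq k] fun y => y * G y := by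
    filter_upwards [ae_chiSq_pos k] with y hy
    rw [ENNReal.toReal_ofReal hy.le, smul_eq_mul]
  constructor
  · rw [← integrable_congr hae, ← integrable_withDensity_iff_integrable_smul' hd (by simp),
      chiSq_withDensity, integrable_smul_measure (by simpa using NeZero.ne k) ENNReal.ofReal_ne_top]
  · rw [← integral_congr_ae hae, ← integral_withDensity_eq_integral_toReal_smul hd (by simp),
      chiSq_withDensity, integral_smul_measure, ENNReal.toReal_ofReal hk.le, smul_eq_mul]

theorem chiSq_moments (n : ℕ) [NeZero n] :
    Integrable (fun y => y) (chiSq n) ∧ ∫ y, y ∂(chiSq n) = n ∧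
    Integrable (fun y => y ^ 2) (chiSq n) ∧ ∫ y, y ^ 2 ∂(chiSq n) = n * (n + 2) := by
  have i1 : NeZero (n + 2) := RegularShrinker.neZero_add n 2
  have i2 : NeZero (n + 2 + 2) := RegularShrinker.neZero_add (n + 2) 2
  have m1 : ∀ k : ℕ, NeZero k → NeZero (k + 2) →
      Integrable (fun y => y) (chiSq k) ∧ ∫ y, y ∂(chiSq k) = k := by
    intro k _ _
    obtain ⟨h1, h2⟩ := integral_id_mul_chiSq (k := k) fun _ => (1 : ℝ)
    simp only [mul_one, integral_const, probReal_univ, smul_eq_mul] at h1 h2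
    exact ⟨h1.mpr (integrable_const _), h2⟩
  obtain ⟨a1, a2⟩ := m1 n inferInstance i1
  obtain ⟨b1, b2⟩ := m1 (n + 2) i1 i2
  obtain ⟨h1, h2⟩ := integral_id_mul_chiSq (k := n) fun y => y
  simp only [← sq] at h1 h2
  refine ⟨a1, a2, h1.mpr b1, ?_⟩
  rw [h2, b2]
  push_cast
  ring

section

variable {p n : ℕ} [NeZero p] [NeZero n] {φ : ℝ → ℝ} {θ : Fin p → ℝ} {v : ℝ≥0}

theorem integrable_snd_sq : Integrable (fun z => z.2 ^ 2) (sampleLaw p n θ v) := by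
  have h : Integrable (fun y : ℝ => y ^ 2) ((chiSq n).map fun y : ℝ => (v : ℝ) * y) := by
    rw [integrable_map_measure (by fun_prop) (by fun_prop)]
    refine ((chiSq_moments n).2.2.1.const_mul ((v : ℝ) ^ 2)).congr (ae_of_all _ fun y => ?_)
    simp only [Function.comp]
    ring
  exact h.comp_snd _

/-- The constant `n + 2` is forced here: `E[S] = n v` and `E[S²] = n (n + 2) v²`. -/
theorem integral_mul_sub_scaled_chiSq :
    Integrable (fun y : ℝ => y * (v - y / (n + 2))) ((chiSq n).map fun y : ℝ => (v : ℝ) * y) ∧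
    ∫ y : ℝ, y * (v - y / (n + 2)) ∂((chiSq n).map fun y : ℝ => (v : ℝ) * y) = 0 := by
  have hm : Measurable fun y : ℝ => y * (v - y / (n + 2)) := by fun_prop
  have hm' : Measurable fun y : ℝ => (v : ℝ) * y := by fun_prop
  obtain ⟨h1, e1, h2, e2⟩ := chiSq_moments n
  have e : ∀ y : ℝ, (v : ℝ) * y * (v - v * y / (n + 2)) =
      (v : ℝ) ^ 2 * y - (v : ℝ) ^ 2 / (n + 2) * y ^ 2 := fun y => by ring
  constructor
  · rw [integrable_map_measure hm.aestronglyMeasurable hm'.aemeasurable]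
    simp only [Function.comp_def, e]
    exact (h1.const_mul _).sub (h2.const_mul _)
  · rw [integral_map hm'.aemeasurable hm.aestronglyMeasurable]
    simp only [e]
    rw [integral_sub (h1.const_mul _) (h2.const_mul _), integral_const_mul, integral_const_mul,
      e1, e2]
    have : (n : ℝ) + 2 ≠ 0 := by positivity
    field_simp
    ring

/-- Negative correlation of `S (v - S / (n + 2))` and an antitone function of `W`. -/
theorem integral_mul_antitone_statW_nonpos (hv : 0 < v) {ψ : ℝ → ℝ} (hψ : AntitoneOn ψ (Ioi 0))
    (hi : Integrable (fun z => z.2 * (v - z.2 / (n + 2)) * ψ (statW z)) (sampleLaw p n θ v)) :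
    ∫ z, z.2 * (v - z.2 / (n + 2)) * ψ (statW z) ∂(sampleLaw p n θ v) ≤ 0 := by
  have h0v : (0 : ℝ) < v := hv
  have hae := ae_sampleLaw_pos (p := p) (n := n) (θ := θ) hv
  unfold sampleLaw at hi hae ⊢
  set μ := Measure.pi fun i => gaussianReal (θ i) v
  set ν := (chiSq n).map fun y : ℝ => (v : ℝ) * y
  rw [integral_prod _ hi]
  refine integral_nonpos_of_ae ?_
  filter_upwards [hi.prod_right_ae, Measure.ae_ae_of_ae_prod hae] with x hx hpos
  obtain ⟨q1, q2⟩ := integral_mul_sub_scaled_chiSq (n := n) (v := v)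
  -- The value of `ψ(W)` at `S = v (n + 2)`, where the factor changes sign. For fixed `X`, `W`
  -- decreases in `S`, so replacing `ψ(W)` by `c` raises the integrand on both sides of that point.
  set c := ψ ((x ⬝ᵥ x) / (v * (n + 2)))
  have hle : ∫ y, y * (v - y / (n + 2)) * ψ (statW (x, y)) ∂ν ≤
      ∫ y, y * (v - y / (n + 2)) * c ∂ν := by
    refine integral_mono_ae hx (q1.mul_const c) ?_
    filter_upwards [hpos] with y hy
    obtain ⟨hU, hS⟩ := hy
    have hW : 0 < statW (x, y) := statW_pos ⟨hU, hS⟩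
    have hW' : 0 < (x ⬝ᵥ x) / (v * ((n : ℝ) + 2)) := by positivity
    rcases le_total y (v * (n + 2)) with h | h
    · have h1 : 0 ≤ (v : ℝ) - y / (n + 2) := by
        rw [sub_nonneg, div_le_iff₀ (by positivity)]
        exact h
      exact mul_le_mul_of_nonneg_left
        (hψ hW' hW (div_le_div_of_nonneg_left hU.le hS h)) (mul_nonneg hS.le h1)
    · have h1 : (v : ℝ) - y / (n + 2) ≤ 0 := by
        rw [sub_nonpos, le_div_iff₀ (by positivity)]
        exact h
      exact mul_le_mul_of_nonpos_left
        (hψ hW hW' (div_le_div_of_nonneg_left hU.le (by positivity) h))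
        (mul_nonpos_of_nonneg_of_nonpos hS.le h1)
  rw [integral_mul_const, q2, zero_mul] at hle
  exact hle

/-- A measurable function that agrees with a given antitone function on `(0, ∞)`. -/
theorem exists_measurable_of_antitoneOn {ψ : ℝ → ℝ} (hψ : AntitoneOn ψ (Ioi 0)) :
    ∃ ψ' : ℝ → ℝ, Measurable ψ' ∧ ∀ w, 0 < w → ψ' w = ψ w := by
  refine ⟨fun w => ψ (Real.exp (Real.log w)), ?_, fun w hw => congrArg ψ (Real.exp_log hw)⟩
  have h : Antitone fun y => ψ (Real.exp y) := fun a b hab =>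
    hψ (Real.exp_pos a) (Real.exp_pos b) (Real.exp_le_exp.mpr hab)
  exact h.measurable.comp Real.measurable_log

/-! ### The loss -/

theorem trace_sq_one_add_rankOne (c e d : ℝ) (x y : Fin p → ℝ) :
    ((c • (1 : Matrix (Fin p) (Fin p) ℝ) + e • Matrix.vecMulVec x x + d • Matrix.vecMulVec y y) *
      (c • (1 : Matrix (Fin p) (Fin p) ℝ) + e • Matrix.vecMulVec x x +
        d • Matrix.vecMulVec y y)).trace =
      p * c ^ 2 + e ^ 2 * (x ⬝ᵥ x) ^ 2 + d ^ 2 * (y ⬝ᵥ y) ^ 2 + 2 * c * e * (x ⬝ᵥ x) +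
        2 * c * d * (y ⬝ᵥ y) + 2 * e * d * (x ⬝ᵥ y) ^ 2 := by
  have hyx : y ⬝ᵥ x = x ⬝ᵥ y := dotProduct_comm _ _
  simp only [add_mul, mul_add, Matrix.smul_mul, Matrix.mul_smul, Matrix.one_mul, Matrix.mul_one,
    Matrix.vecMulVec_mul_vecMulVec, Matrix.trace_add, Matrix.trace_smul, Matrix.trace_one,
    Matrix.trace_vecMulVec, Fintype.card_fin, smul_eq_mul, dotProduct_smul, hyx]
  ring

/-- The loss of `α (I - P) + γ P` at `b I - d θ θ'`, where `t = (x'θ)² / ‖x‖²` and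
`N = ‖θ‖²`. -/
def structuredLoss (p : ℕ) (b d N t α γ : ℝ) : ℝ :=
  (p - 1) * (α - b) ^ 2 + (γ - b) ^ 2 + 2 * (α - b) * (d * (N - t)) + 2 * (γ - b) * (d * t) +
    d ^ 2 * N ^ 2

theorem trace_loss_eq {x : Fin p → ℝ} (hx : 0 < x ⬝ᵥ x) (α γ b d : ℝ)
    {M : Matrix (Fin p) (Fin p) ℝ}
    (hM : ∀ i k, M i k = b * (1 : Matrix (Fin p) (Fin p) ℝ) i k - d * (θ i * θ k)) :
    ((α • (1 - proj x) + γ • proj x - M) * (α • (1 - proj x) + γ • proj x - M)).trace =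
      structuredLoss p b d (θ ⬝ᵥ θ) ((x ⬝ᵥ θ) ^ 2 / (x ⬝ᵥ x)) α γ := by
  have e : α • (1 - proj x) + γ • proj x - M =
      (α - b) • (1 : Matrix (Fin p) (Fin p) ℝ) + ((γ - α) * (x ⬝ᵥ x)⁻¹) • Matrix.vecMulVec x x +
        d • Matrix.vecMulVec θ θ := by
    ext i k
    simp only [Matrix.sub_apply, Matrix.add_apply, Matrix.smul_apply, smul_eq_mul, hM, proj,
      Matrix.vecMulVec_apply]
    ring
  rw [e, trace_sq_one_add_rankOne, structuredLoss]
  field_simp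
  ring

theorem structuredLoss_nonneg_aux {x : Fin p → ℝ} (hx : 0 < x ⬝ᵥ x) :
    0 ≤ (x ⬝ᵥ θ) ^ 2 / (x ⬝ᵥ x) ∧ (x ⬝ᵥ θ) ^ 2 / (x ⬝ᵥ x) ≤ θ ⬝ᵥ θ := by
  refine ⟨by positivity, ?_⟩
  rw [div_le_iff₀ hx]
  have := Finset.sum_mul_sq_le_sq_mul_sq Finset.univ x θ
  simp only [dotProduct, ← sq]
  linarith

/-- Used with `α = S g₁`: finite risk of the unbiased estimator makes `S g₁` square integrable,
which dominates the correction terms in the risk comparison. -/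
theorem sq_le_structuredLoss (hp : 3 ≤ p) {b d N t α γ : ℝ} (ht : 0 ≤ t)
    (htN : t ≤ N) :
    α ^ 2 ≤ 4 * structuredLoss p b d N t α γ + (8 * d ^ 2 * N ^ 2 + 2 * b ^ 2) := by
  have hp' : (3 : ℝ) ≤ p := by exact_mod_cast hp
  have h1 : (α - b) ^ 2 ≤ (p - 1) * (α - b) ^ 2 := by nlinarith [sq_nonneg (α - b)]
  have h2 := sq_nonneg (γ - b + d * t)
  have h3 : d ^ 2 * t ^ 2 ≤ d ^ 2 * N ^ 2 := by gcongr
  have h4 : (d * (N - t)) ^ 2 ≤ d ^ 2 * N ^ 2 := by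
    rw [mul_pow]
    have : 0 ≤ N - t := by linarith
    gcongr
    linarith
  have h5 := sq_nonneg ((α - b) + 2 * (d * (N - t)))
  have h6 := sq_nonneg (α - 2 * b)
  unfold structuredLoss
  nlinarith

/-- With `p - 1 ≥ 1`, the loss is at least `(α - b + d(N - t))² + (γ - b + dt)² + 2 d² t (N - t)`.
-/
theorem structuredLoss_nonneg (hp : 3 ≤ p) {b d N t α γ : ℝ} (ht : 0 ≤ t) (htN : t ≤ N) :
    0 ≤ structuredLoss p b d N t α γ := by
  have hp' : (3 : ℝ) ≤ p := by exact_mod_cast hp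
  have h1 : (α - b) ^ 2 ≤ (p - 1) * (α - b) ^ 2 := by nlinarith [sq_nonneg (α - b)]
  have h2 := sq_nonneg (γ - b + d * t)
  have h3 := sq_nonneg (α - b + d * (N - t))
  have h4 : 0 ≤ d ^ 2 * (2 * (t * (N - t))) :=
    mul_nonneg (sq_nonneg d) (mul_nonneg zero_le_two (mul_nonneg ht (by linarith)))
  unfold structuredLoss
  nlinarith

/-- Comparison of two structured losses with the smaller coefficients on the left. -/
theorem structuredLoss_le (hp : 3 ≤ p) {b d N t α γ α₀ γ₀ A B : ℝ} (hd : 0 ≤ d) (ht : 0 ≤ t)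
    (htN : t ≤ N) (hα : α ≤ α₀) (hγ : γ ≤ γ₀)
    (hA : (α₀ - α) * (2 * b - α - α₀) ≤ 2 * A) (hB : (γ₀ - γ) * (2 * b - γ - γ₀) ≤ 2 * B) :
    structuredLoss p b d N t α γ ≤
      structuredLoss p b d N t α₀ γ₀ + (2 * (p - 1) * A + 2 * B) := by
  have hp' : (3 : ℝ) ≤ p := by exact_mod_cast hp
  -- `h1` and `h2` are the gains in the cross terms with `d`; they have a favourable sign and are
  -- discarded.
  have h1 : 0 ≤ (α₀ - α) * (d * (N - t)) :=
    mul_nonneg (by linarith) (mul_nonneg hd (by linarith))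
  have h2 : 0 ≤ (γ₀ - γ) * (d * t) := mul_nonneg (by linarith) (mul_nonneg hd ht)
  have h3 := mul_le_mul_of_nonneg_left hA (by linarith : (0 : ℝ) ≤ p - 1)
  unfold structuredLoss
  nlinarith

theorem redHat_eq (ξ η : ℝ → ℝ) (z : (Fin p → ℝ) × ℝ) :
    redHat n φ ξ η z = (z.2 * (g₁ n φ (statW z) * ξ (statW z))) • (1 - proj z.1) +
      (z.2 * (g₁ n φ (statW z) * η (statW z) - g₃ n φ (statW z))) • proj z.1 := by
  ext i k
  simp only [redHat, mseHat, Matrix.sub_apply, Matrix.add_apply, Matrix.smul_apply, smul_eq_mul]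
  ring

theorem redHat₀_eq_redHat (z : (Fin p → ℝ) × ℝ) :
    redHat₀ n φ z = redHat n φ (fun _ => 1) (fun _ => 1) z := by
  ext i k
  simp only [redHat₀, mseHat₀, redHat, mseHat, g₃, Matrix.sub_apply, Matrix.add_apply,
    Matrix.smul_apply, smul_eq_mul]
  ring

/-- When `x = 1` or `g = 0` both sides vanish. Otherwise `hc` gives `g x - c ≥ β/N`, and `g - c` is
no smaller, so the sum of the two coefficients is at least `2 s β/N`. Together with `b ≤ v β` this
bounds the second factor by `2β (v - s/N)`, and the first factor is `s g (1 - x) ≥ 0`. -/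
theorem shrink_coefficient_le {s g c x b β N v : ℝ} (hs : 0 < s) (hg : 0 ≤ g) (hx : x ≤ 1)
    (hb : b ≤ v * β) (hc : x < 1 → 0 < g → c + β / N ≤ g * x) :
    (s * (g - c) - s * (g * x - c)) * (2 * b - s * (g * x - c) - s * (g - c)) ≤
      2 * (β * (s * (v - s / N) * (g * (1 - x)))) := by
  rcases hx.eq_or_lt with rfl | hx1
  · simp
  rcases hg.eq_or_lt with rfl | hg0
  · simp
  have h := hc hx1 hg0
  have h1 : 0 ≤ s * (g * (1 - x)) := mul_nonneg hs.le (mul_nonneg hg (by linarith))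
  have h2 : g * x ≤ g := mul_le_of_le_one_right hg hx
  have h3 : 2 * b - s * (g * x - c) - s * (g - c) ≤ 2 * (β * (v - s / N)) := by
    have h4 : s * (2 * (β / N)) ≤ s * (g * x - c + (g - c)) :=
      mul_le_mul_of_nonneg_left (by linarith) hs.le
    have h5 : β * (s / N) = s * (β / N) := by ring
    nlinarith
  have := mul_le_mul_of_nonneg_left h3 h1
  linarith

/-- By `|v - S/(n + 2)| ≤ v + S`, the product is dominated by `v²`, `S²` and `(S g)²`. Since `ψ` is
only monotone, measurability is taken from a version that agrees with it on `(0, ∞)`. -/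
theorem integrable_mul_statW {g ψ : ℝ → ℝ} (hv : 0 < v)
    (hg : Integrable (fun z => (z.2 * g (statW z)) ^ 2) (sampleLaw p n θ v))
    (hψ : AntitoneOn ψ (Ioi 0)) (h0 : ∀ w, 0 < w → 0 ≤ ψ w) (hle : ∀ w, 0 < w → ψ w ≤ g w) :
    Integrable (fun z => z.2 * (v - z.2 / (n + 2)) * ψ (statW z)) (sampleLaw p n θ v) := by
  have h0v : (0 : ℝ) < v := hv
  obtain ⟨ψ', hm, he⟩ := exists_measurable_of_antitoneOn hψ
  have hmeas : Measurable fun z : (Fin p → ℝ) × ℝ =>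
      z.2 * (v - z.2 / (n + 2)) * ψ' (statW z) := by
    have := hm.comp (measurable_statW (p := p))
    exact Measurable.mul (by fun_prop) this
  have hae : (fun z => z.2 * (v - z.2 / (n + 2)) * ψ' (statW z)) =ᵐ[sampleLaw p n θ v]
      fun z => z.2 * (v - z.2 / (n + 2)) * ψ (statW z) := by
    filter_upwards [ae_sampleLaw_pos hv] with z hz
    rw [he _ (statW_pos hz)]
  refine Integrable.mono' (((integrable_const (2 * (v : ℝ) ^ 2)).add
    (integrable_snd_sq.const_mul 2)).add hg) (hmeas.aestronglyMeasurable.congr hae) ?_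
  filter_upwards [ae_sampleLaw_pos hv] with z hz
  have hw := statW_pos hz
  have h1 := h0 _ hw
  have h2 := hle _ hw
  simp only [Pi.add_apply]
  set s := z.2
  have hs : 0 < s := hz.2
  have h3 : |(v : ℝ) - s / (n + 2)| ≤ v + s := by
    have h4 : s / ((n : ℝ) + 2) ≤ s := div_le_self hs.le (by linarith [(n.cast_nonneg : (0 : ℝ) ≤ n)])
    have h5 : 0 ≤ s / ((n : ℝ) + 2) := by positivity
    rw [abs_le]
    constructor <;> linarith
  rw [Real.norm_eq_abs, abs_mul, abs_mul, abs_of_pos hs, abs_of_nonneg h1]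
  have h6 : s * ψ (statW z) ≤ s * g (statW z) := mul_le_mul_of_nonneg_left h2 hs.le
  calc s * |(v : ℝ) - s / (n + 2)| * ψ (statW z)
      = |(v : ℝ) - s / (n + 2)| * (s * ψ (statW z)) := by ring
    _ ≤ (v + s) * (s * g (statW z)) :=
        mul_le_mul h3 h6 (mul_nonneg hs.le h1) (by positivity)
    _ ≤ 2 * (v : ℝ) ^ 2 + 2 * s ^ 2 + (s * g (statW z)) ^ 2 := by
        nlinarith [sq_nonneg ((v : ℝ) + s - s * g (statW z)), sq_nonneg ((v : ℝ) - s),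
          sq_nonneg (s * g (statW z)), sq_nonneg ((v : ℝ) + s)]

/-- A product of nonnegative nonincreasing functions is nonincreasing; this is where the sign of
`g₁` matters for the covariance inequality. -/
theorem antitoneOn_mul_one_sub {g ξ : ℝ → ℝ} (hg : AntitoneOn g (Ioi 0))
    (hg0 : ∀ w, 0 < w → 0 ≤ g w) (hξ : MonotoneOn ξ (Ioi 0)) (hξ1 : ∀ w, 0 < w → ξ w ≤ 1) :
    AntitoneOn (fun w => g w * (1 - ξ w)) (Ioi 0) := fun _ ha _ hb hab =>
  mul_le_mul (hg ha hb hab) (sub_le_sub_left (hξ ha hb hab) _)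
    (sub_nonneg.mpr (hξ1 _ hb)) (hg0 _ ha)

theorem le_one_of_monotoneOn_of_tendsto {ξ : ℝ → ℝ} (hξ : MonotoneOn ξ (Ioi 0))
    (hl : Tendsto ξ atTop (𝓝 1)) {w : ℝ} (hw : 0 < w) : ξ w ≤ 1 := by
  refine ge_of_tendsto hl ?_
  filter_upwards [eventually_ge_atTop w] with t ht
  exact hξ hw (hw.trans_le ht) ht

theorem le_mul_of_min_le {g c x : ℝ} (h : min 1 (1 / g * c) ≤ x) (hx : x < 1) (hg : 0 < g) :
    c ≤ g * x := by
  have h1 : 1 / g * c ≤ x := (min_le_iff.mp h).resolve_left (not_le.mpr hx)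
  rwa [one_div_mul_eq_div, div_le_iff₀' hg] at h1

/-- The function `f` needs no measurability, since it enters only through monotonicity of the lower
integral. -/
theorem lintegral_ofReal_le_of_le_add {α : Type*} [MeasurableSpace α] {μ : Measure α}
    {f g h : α → ℝ} (hf : 0 ≤ᵐ[μ] f) (hg : 0 ≤ᵐ[μ] g) (hgi : Integrable g μ)
    (hhi : Integrable h μ) (hh : ∫ x, h x ∂μ ≤ 0) (hle : ∀ᵐ x ∂μ, f x ≤ g x + h x) :
    ∫⁻ x, ENNReal.ofReal (f x) ∂μ ≤ ∫⁻ x, ENNReal.ofReal (g x) ∂μ := by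
  have hnn : 0 ≤ᵐ[μ] fun x => g x + h x := by
    filter_upwards [hle, hf] with x h1 h2
    exact le_trans h2 h1
  calc ∫⁻ x, ENNReal.ofReal (f x) ∂μ ≤ ∫⁻ x, ENNReal.ofReal (g x + h x) ∂μ :=
        lintegral_mono_ae (hle.mono fun z hz => ENNReal.ofReal_le_ofReal hz)
    _ = ENNReal.ofReal (∫ x, g x + h x ∂μ) :=
        (ofReal_integral_eq_lintegral_ofReal (hgi.add hhi) hnn).symm
    _ ≤ ENNReal.ofReal (∫ x, g x ∂μ) := by
        refine ENNReal.ofReal_le_ofReal ?_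
        rw [integral_add hgi hhi]
        linarith
    _ = ∫⁻ x, ENNReal.ofReal (g x) ∂μ := ofReal_integral_eq_lintegral_ofReal hgi hg

/-- The loss of `redHat n φ ξ η` at `b I - d θ θ'`. -/
def redLoss (n : ℕ) (φ : ℝ → ℝ) (θ : Fin p → ℝ) (b d : ℝ) (ξ η : ℝ → ℝ)
    (z : (Fin p → ℝ) × ℝ) : ℝ :=
  structuredLoss p b d (θ ⬝ᵥ θ) ((z.1 ⬝ᵥ θ) ^ 2 / (z.1 ⬝ᵥ z.1))
    (z.2 * (g₁ n φ (statW z) * ξ (statW z)))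
    (z.2 * (g₁ n φ (statW z) * η (statW z) - g₃ n φ (statW z)))

theorem matrixRisk_redHat (hv : 0 < v) {b d : ℝ}
    (hM : ∀ i k, redMatrix n φ θ v i k =
      b * (1 : Matrix (Fin p) (Fin p) ℝ) i k - d * (θ i * θ k)) (ξ η : ℝ → ℝ) :
    matrixRisk n (redHat n φ ξ η) (redMatrix n φ) θ v =
      ∫⁻ z, ENNReal.ofReal (redLoss n φ θ b d ξ η z) ∂(sampleLaw p n θ v) := by
  refine lintegral_congr_ae ?_
  filter_upwards [ae_sampleLaw_pos hv] with z hz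
  rw [redHat_eq, trace_loss_eq hz.1 _ _ b d hM, redLoss]

theorem redLoss_nonneg (hp : 3 ≤ p) (hv : 0 < v) (b d : ℝ) (ξ η : ℝ → ℝ) :
    0 ≤ᵐ[sampleLaw p n θ v] redLoss n φ θ b d ξ η := by
  filter_upwards [ae_sampleLaw_pos hv] with z hz
  obtain ⟨h1, h2⟩ := structuredLoss_nonneg_aux (θ := θ) hz.1
  exact structuredLoss_nonneg hp h1 h2

theorem RegularShrinker.integrable_redLoss (R : RegularShrinker p n φ) (hp : 3 ≤ p) (hv : 0 < v)
    {b d : ℝ} (hfin : ∫⁻ z, ENNReal.ofReal (redLoss n φ θ b d (fun _ => 1) (fun _ => 1) z)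
      ∂(sampleLaw p n θ v) ≠ ⊤) :
    Integrable (redLoss n φ θ b d (fun _ => 1) (fun _ => 1)) (sampleLaw p n θ v) ∧
      Integrable (fun z => (z.2 * g₁ n φ (statW z)) ^ 2) (sampleLaw p n θ v) := by
  have htm : Measurable fun z : (Fin p → ℝ) × ℝ => (z.1 ⬝ᵥ θ) ^ 2 / (z.1 ⬝ᵥ z.1) := by
    simp only [dotProduct]; fun_prop
  have hTm : Measurable fun z : (Fin p → ℝ) × ℝ =>
      tailTransform n (shrinkFactor φ) (statW z) :=
    (measurable_tailTransform n R.measurable).comp measurable_statW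
  have hGm : Measurable fun z : (Fin p → ℝ) × ℝ => g₃Ext n φ (statW z) :=
    R.measurable_g₃Ext.comp measurable_statW
  have hm : Measurable fun z : (Fin p → ℝ) × ℝ =>
      structuredLoss p b d (θ ⬝ᵥ θ) ((z.1 ⬝ᵥ θ) ^ 2 / (z.1 ⬝ᵥ z.1))
        (z.2 * tailTransform n (shrinkFactor φ) (statW z))
        (z.2 * (tailTransform n (shrinkFactor φ) (statW z) - g₃Ext n φ (statW z))) := by
    unfold structuredLoss
    fun_prop
  have hi : Integrable (redLoss n φ θ b d (fun _ => 1) (fun _ => 1)) (sampleLaw p n θ v) := by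
    refine ⟨hm.aestronglyMeasurable.congr ?_,
      (hasFiniteIntegral_iff_ofReal (redLoss_nonneg hp hv b d _ _)).mpr
        (lt_top_iff_ne_top.mpr hfin)⟩
    filter_upwards [ae_sampleLaw_pos hv] with z hz
    have hw := statW_pos hz
    rw [redLoss, g₁_eq hw, R.g₃_eq hw, mul_one]
  refine ⟨hi, Integrable.mono' ((hi.const_mul 4).add
    (integrable_const (8 * d ^ 2 * (θ ⬝ᵥ θ) ^ 2 + 2 * b ^ 2))) ?_ ?_⟩
  · have hm2 : Measurable fun z : (Fin p → ℝ) × ℝ =>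
      (z.2 * tailTransform n (shrinkFactor φ) (statW z)) ^ 2 := by fun_prop
    refine hm2.aestronglyMeasurable.congr ?_
    filter_upwards [ae_sampleLaw_pos hv] with z hz
    rw [g₁_eq (statW_pos hz)]
  · filter_upwards [ae_sampleLaw_pos hv] with z hz
    obtain ⟨h1, h2⟩ := structuredLoss_nonneg_aux (θ := θ) hz.1
    rw [Real.norm_of_nonneg (sq_nonneg _), Pi.add_apply, redLoss, mul_one]
    exact sq_le_structuredLoss hp h1 h2

/-- The scalar estimate is applied once along `I - P`, with offset `0`, and once along `P`, with
offset `g₃`; these are the thresholds in `xi₂` and `eta₂`. -/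
theorem redLoss_le (hp : 3 ≤ p) {b d β : ℝ} {ξ η : ℝ → ℝ} (hd : 0 ≤ d) (hbβ : b ≤ v * β)
    {z : (Fin p → ℝ) × ℝ} (hz : 0 < z.1 ⬝ᵥ z.1 ∧ 0 < z.2) (hg0 : 0 ≤ g₁ n φ (statW z))
    (hξ1 : ξ (statW z) ≤ 1) (hη1 : η (statW z) ≤ 1)
    (hξ : min 1 (1 / g₁ n φ (statW z) * (β / ((n : ℝ) + 2))) ≤ ξ (statW z))
    (hη : min 1 (1 / g₁ n φ (statW z) * (g₃ n φ (statW z) + β / ((n : ℝ) + 2))) ≤ η (statW z)) :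
    redLoss n φ θ b d ξ η z ≤ redLoss n φ θ b d (fun _ => 1) (fun _ => 1) z +
      (2 * (p - 1) * (β * (z.2 * (v - z.2 / (n + 2)) * (g₁ n φ (statW z) * (1 - ξ (statW z))))) +
        2 * (β * (z.2 * (v - z.2 / (n + 2)) * (g₁ n φ (statW z) * (1 - η (statW z)))))) := by
  obtain ⟨h1, h2⟩ := structuredLoss_nonneg_aux (θ := θ) hz.1
  have kA := shrink_coefficient_le (N := (n : ℝ) + 2) (c := 0) hz.2 hg0 hξ1 hbβ
    (fun h h' => by rw [zero_add]; exact le_mul_of_min_le hξ h h')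
  have kB := shrink_coefficient_le (N := (n : ℝ) + 2) (c := g₃ n φ (statW z)) hz.2 hg0 hη1 hbβ
    (fun h h' => le_mul_of_min_le hη h h')
  rw [sub_zero, sub_zero] at kA
  rw [redLoss, redLoss, mul_one]
  exact structuredLoss_le hp hd h1 h2
    (mul_le_mul_of_nonneg_left (mul_le_of_le_one_right hg0 hξ1) hz.2.le)
    (mul_le_mul_of_nonneg_left (sub_le_sub_right (mul_le_of_le_one_right hg0 hη1) _) hz.2.le) kA kB

/-- The risk comparison. -/
theorem RegularShrinker.matrixRisk_le (R : RegularShrinker p n φ) (hp : 3 ≤ p)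
    (himp : ∀ (θ : Fin p → ℝ) (v : ℝ≥0), 0 < v →
      meanRisk n (delta φ) θ v ≤ meanRisk n Prod.fst θ v)
    (hg : AntitoneOn (g₁ n φ) (Ioi 0)) {ξ η : ℝ → ℝ}
    (hξm : MonotoneOn ξ (Ioi 0)) (hηm : MonotoneOn η (Ioi 0))
    (hξ1 : ∀ w, 0 < w → ξ w ≤ 1) (hη1 : ∀ w, 0 < w → η w ≤ 1)
    (hξ : ∀ w, 0 < w → xi₂ p n φ w ≤ ξ w) (hη : ∀ w, 0 < w → eta₂ p n φ w ≤ η w) (hv : 0 < v) :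
    matrixRisk n (redHat n φ ξ η) (redMatrix n φ) θ v ≤
      matrixRisk n (redHat₀ n φ) (redMatrix n φ) θ v := by
  obtain ⟨hβ, a, d, hd, hab, hM⟩ := R.beta₂_nonneg (θ := θ) hp himp hg hv
  have hg0 : ∀ w, 0 < w → 0 ≤ g₁ n φ w := fun w hw => R.g₁_nonneg hp himp hg hw
  have hbβ : (v : ℝ) * a ≤ v * beta₂ p n φ := mul_le_mul_of_nonneg_left hab v.2
  have hrisk₀ : matrixRisk n (redHat₀ n φ) (redMatrix n φ) θ v =
      matrixRisk n (redHat n φ (fun _ => 1) (fun _ => 1)) (redMatrix n φ) θ v := by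
    simp only [matrixRisk, redHat₀_eq_redHat]
  rw [hrisk₀, matrixRisk_redHat hv hM, matrixRisk_redHat hv hM]
  -- If the unbiased estimator has infinite risk nothing is to be proved; otherwise finiteness
  -- supplies the square integrability of `S g₁`.
  by_cases htop : ∫⁻ z, ENNReal.ofReal (redLoss n φ θ (v * a) d (fun _ => 1) (fun _ => 1) z)
      ∂(sampleLaw p n θ v) = ⊤
  · rw [htop]
    exact le_top
  obtain ⟨hL₀i, hsq⟩ := R.integrable_redLoss hp hv htop
  have hξ0 : ∀ w, 0 < w → 0 ≤ ξ w := fun w hw =>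
    le_trans (le_min zero_le_one (mul_nonneg (one_div_nonneg.mpr (hg0 w hw)) (by positivity))) (hξ w hw)
  have hη0 : ∀ w, 0 < w → 0 ≤ η w := fun w hw =>
    le_trans (le_min zero_le_one (mul_nonneg (one_div_nonneg.mpr (hg0 w hw))
      (add_nonneg (R.g₃_nonneg hg hw) (by positivity)))) (hη w hw)
  have hcorr : ∀ ζ : ℝ → ℝ, MonotoneOn ζ (Ioi 0) → (∀ w, 0 < w → 0 ≤ ζ w) →
      (∀ w, 0 < w → ζ w ≤ 1) →
      Integrable (fun z => z.2 * (v - z.2 / (n + 2)) * (g₁ n φ (statW z) * (1 - ζ (statW z))))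
        (sampleLaw p n θ v) ∧
      ∫ z, z.2 * (v - z.2 / (n + 2)) * (g₁ n φ (statW z) * (1 - ζ (statW z)))
        ∂(sampleLaw p n θ v) ≤ 0 := by
    intro ζ hm h0 h1
    have hanti := antitoneOn_mul_one_sub hg hg0 hm h1
    have hi := integrable_mul_statW (ψ := fun w => g₁ n φ w * (1 - ζ w)) hv hsq hanti
      (fun w hw => mul_nonneg (hg0 w hw) (sub_nonneg.mpr (h1 w hw)))
      (fun w hw => mul_le_of_le_one_right (hg0 w hw) (by linarith [h0 w hw]))
    exact ⟨hi, integral_mul_antitone_statW_nonpos hv hanti hi⟩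
  obtain ⟨iA, eA⟩ := hcorr ξ hξm hξ0 hξ1
  obtain ⟨iB, eB⟩ := hcorr η hηm hη0 hη1
  have iA' := (iA.const_mul (beta₂ p n φ)).const_mul (2 * ((p : ℝ) - 1))
  have iB' := (iB.const_mul (beta₂ p n φ)).const_mul 2
  refine lintegral_ofReal_le_of_le_add (redLoss_nonneg hp hv _ _ _ _)
    (redLoss_nonneg hp hv _ _ _ _) hL₀i (iA'.add iB') ?_ ?_
  · simp only [Pi.add_apply]
    rw [integral_add iA' iB', integral_const_mul, integral_const_mul, integral_const_mul,
      integral_const_mul]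
    have hp' : (3 : ℝ) ≤ p := by exact_mod_cast hp
    have q1 := mul_nonpos_of_nonneg_of_nonpos hβ eA
    have q2 := mul_nonpos_of_nonneg_of_nonpos hβ eB
    have q3 := mul_nonpos_of_nonneg_of_nonpos (by linarith : (0 : ℝ) ≤ 2 * (p - 1)) q1
    linarith
  · filter_upwards [ae_sampleLaw_pos hv] with z hz
    have hw := statW_pos hz
    exact redLoss_le hp hd hbβ hz (hg0 _ hw) (hξ1 _ hw) (hη1 _ hw) (hξ _ hw) (hη _ hw)

end

end

end Shrinkage

theorem mainTheorem4 (p n : ℕ) (hp : 3 ≤ p) (hn : 1 ≤ n)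
    (φ : ℝ → ℝ)
    -- regularity of `φ` on `(0, ∞)`
    (hφ_cont : ContinuousOn φ (Set.Ioi 0))
    (hφ_diff : ∃ D : Set ℝ, D.Countable ∧ ∀ w, 0 < w → w ∉ D → DifferentiableAt ℝ φ w)
    -- the expectations that define `β⁽²⁾` exist
    (hφ_int₁ : ∀ j, Integrable (fun w => φ w / w) (Shrinkage.ratioLaw p n j))
    (hφ_int₂ : ∀ j, Integrable (fun w => φ w ^ 2 / w) (Shrinkage.ratioLaw p n j))
    (hφ_int₃ : ∀ j, Integrable (fun w => deriv φ w) (Shrinkage.ratioLaw p n j))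
    (hφ_int₄ : ∀ j, Integrable (fun w => φ w * deriv φ w) (Shrinkage.ratioLaw p n j))
    -- `δ_φ` improves on `X`
    (hφ_impr : ∀ (θ : Fin p → ℝ) (v : ℝ≥0), 0 < v →
      Shrinkage.meanRisk n (Shrinkage.delta φ) θ v ≤ Shrinkage.meanRisk n Prod.fst θ v)
    -- condition (i)
    (hg₁ : AntitoneOn (Shrinkage.g₁ n φ) (Set.Ioi 0))
    (hg₃ : MonotoneOn (fun w => Shrinkage.g₃ n φ w / Shrinkage.g₁ n φ w) (Set.Ioi 0))
    (ξ η : ℝ → ℝ)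
    -- condition (ii)
    (hξ_mono : MonotoneOn ξ (Set.Ioi 0)) (hη_mono : MonotoneOn η (Set.Ioi 0))
    (hξ_lim : Tendsto ξ atTop (𝓝 1)) (hη_lim : Tendsto η atTop (𝓝 1))
    -- condition (iii)
    (hξ : ∀ w, 0 < w → Shrinkage.xi₂ p n φ w ≤ ξ w)
    (hη : ∀ w, 0 < w → Shrinkage.eta₂ p n φ w ≤ η w) :
    Shrinkage.IsUMVUE (p := p) n (Shrinkage.redHat₀ n φ) (Shrinkage.redMatrix n φ) ∧
      ∀ (θ : Fin p → ℝ) (v : ℝ≥0), 0 < v →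
        Shrinkage.matrixRisk n (Shrinkage.redHat n φ ξ η) (Shrinkage.redMatrix n φ) θ v ≤
          Shrinkage.matrixRisk n (Shrinkage.redHat₀ n φ) (Shrinkage.redMatrix n φ) θ v := by
  have i1 : NeZero p := ⟨by omega⟩
  have i2 : NeZero n := ⟨by omega⟩
  have R : Shrinkage.RegularShrinker p n φ :=
    ⟨hφ_cont, hφ_diff, hφ_int₁, hφ_int₂, hφ_int₃, hφ_int₄⟩
  exact ⟨(R.isUnbiased hp hφ_impr).isUMVUE, fun θ v hv =>
    R.matrixRisk_le hp hφ_impr hg₁ hξ_mono hη_mono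
      (fun w hw => Shrinkage.le_one_of_monotoneOn_of_tendsto hξ_mono hξ_lim hw)
      (fun w hw => Shrinkage.le_one_of_monotoneOn_of_tendsto hη_mono hη_lim hw) hξ hη hv⟩
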